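/- Let $d\ge 1$ be an integer and $\beta\ge\frac{d-1}{2}$. Write $|E|$ for the Lebesgue measure of $E\subset\mathbb{R}^d$, $B(0,r)$ for the open ball, $\widehat\varphi(\xi)=\int\varphi(x)e^{-2i\pi\langle x,\xi\rangle}\,dx$ (extended to $L^2(\mathbb{R}^d)$ in the usual way), and $|\varphi|^*$ for the symmetric decreasing rearrangement $|\varphi|^*(x)=\int_0^\infty\chi_{\{|\varphi|>\lambda\}^*}(x)\,d\lambda$, where $E^*$ is the open ball centred at $0$ with $|E^*|=|E|$. Let $(1-|\xi|^2)_+^\beta$ denote $(1-|\xi|^2)^\beta$ for $|\xi|<1$ and $0$ otherwise. Then there is a constant $C$, depending only on $d$ and $\beta$, such that the following holds for every $v_0\in L^2(\mathbb{R}^d)$. Let $v\in C([0,\infty);L^2(\mathbb{R}^d))$ be the solution, in the sense of tempered distributions, of the free Schrödinger equation $$ i\partial_t v+\frac1{4\pi}\Delta_x v=0\quad(t>0),\qquad v(x,0)=v_0(x). $$ Let $\Sigma\subset\mathbb{R}^d$ be a measurable set of finite measure and let $\tau\ge 0$ satisfy $|B(0,\tau)|=|\Sigma|$. (1) For every $t>0$,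 $$ \int_\Sigma|v(x,t)|^2\,dx\le C\int_{B(0,\tau)}\bigl|\widehat{|\widehat{v_0}|^*}(\xi)\bigr|^2\,d\xi . $$ Moreover, if $0\le S<\infty$ and $|\{\xi:\widehat{v_0}(\xi)\ne0\}|\le S$, then $$ \int_\Sigma|v(x,t)|\,dx\le C|\Sigma|^{1/2}\bigl(1+|\Sigma|^{1/d}\bigr)^{d/2}(1+S)\int_{\mathbb{R}^d}(1-|\xi|^2)_+^\beta\,\widehat{|\widehat{v_0}|^*}(\xi)\,d\xi , $$ where the integral on the right is real. (2) For every $t>0$, $$ \int_\Sigma|v(x,t)|^2\,dx\le Ct^{-d}\int_{B(0,\tau)}\bigl|\widehat{|v_0|^*}(\xi/t)\bigr|^2\,d\xi = C\int_{B(0,\tau/t)}\bigl|\widehat{|v_0|^*}(\xi)\bigr|^2\,d\xi . $$ Moreover, if $0\le S<\infty$ and $|\{x:v_0(x)\ne0\}|\le S$, then $$ \int_\Sigma|v(x,t)|\,dx\le C|\Sigma|^{1/2}\bigl(1+|\Sigma|^{1/d}/t\bigr)^{d/2}(1+S)^{d/2}\int_{\mathbb{R}^d}(1-|\xi|^2)_+^\beta\,\widehat{|v_0|^*}(\xi)\,d\xi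 , $$ where the integral on the right is real. -/

import Mathlib

open MeasureTheory Set Metric
open scoped FourierTransform SchwartzMap Laplacian ENNReal

/-- The complex Hilbert space `L²(ℝᵈ)`. Its Fourier transform `𝓕` is Mathlib's Plancherel
extension of `∫ φ(t) exp(-2πi⟨t,ξ⟩) dt`. -/
abbrev L2Space (d : ℕ) : Type :=
  Lp ℂ 2 (volume : Measure (EuclideanSpace ℝ (Fin d)))

/-- The radius `r ≥ 0` with `|B(0,1)| r ^ d = |A|`, for a set `A` of finite measure in `ℝᵈ`,
`d ≥ 1`. -/
noncomputable def symmRadius {d : ℕ} (A : Set (EuclideanSpace ℝ (Fin d))) : ℝ :=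
  (volume.real A / volume.real (ball (0 : EuclideanSpace ℝ (Fin d)) 1)) ^ (1 / (d : ℝ))

/-- The symmetric rearrangement of a set of finite measure: the open centred ball of the same
measure. -/
noncomputable def symmRearrSet {d : ℕ} (A : Set (EuclideanSpace ℝ (Fin d))) :
    Set (EuclideanSpace ℝ (Fin d)) :=
  ball 0 (symmRadius A)

/-- The symmetric decreasing rearrangement `|φ|^*` of a function vanishing at infinity, given by
the layer-cake formula `|φ|^*(x) = ∫_0^∞ χ_{{y : |φ(y)| > s}^*}(x) ds`. -/
noncomputable def symmRearr {d : ℕ} (φ : EuclideanSpace ℝ (Fin d) → ℂ)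
    (x : EuclideanSpace ℝ (Fin d)) : ℝ :=
  ∫ s in Ioi (0 : ℝ), (symmRearrSet {y | s < ‖φ y‖}).indicator (fun _ => (1 : ℝ)) x

theorem volume_symmRearrSet {d : ℕ} (hd : d ≠ 0) {A : Set (EuclideanSpace ℝ (Fin d))}
    (hA : volume A ≠ ∞) : volume (symmRearrSet A) = volume A := by
  have : Nonempty (Fin d) := ⟨⟨0, Nat.pos_of_ne_zero hd⟩⟩
  have hb : volume (ball (0 : EuclideanSpace ℝ (Fin d)) 1) ≠ ∞ := measure_ball_lt_top.ne
  have hb0 : 0 < volume.real (ball (0 : EuclideanSpace ℝ (Fin d)) 1) :=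
    ENNReal.toReal_pos (measure_ball_pos _ _ one_pos).ne' hb
  have hq : 0 ≤ volume.real A / volume.real (ball (0 : EuclideanSpace ℝ (Fin d)) 1) := by
    positivity
  have hr : 0 ≤ symmRadius A := Real.rpow_nonneg hq _
  have hpow : symmRadius A ^ d =
      volume.real A / volume.real (ball (0 : EuclideanSpace ℝ (Fin d)) 1) := by
    unfold symmRadius
    rw [one_div]
    exact Real.rpow_inv_natCast_pow hq hd
  unfold symmRearrSet
  rw [Measure.addHaar_ball _ _ hr, finrank_euclideanSpace_fin, hpow, ENNReal.ofReal_div_of_pos hb0,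
    measureReal_def, measureReal_def, ENNReal.ofReal_toReal hA, ENNReal.ofReal_toReal hb]
  exact ENNReal.div_mul_cancel (measure_ball_pos _ _ one_pos).ne' hb

theorem symmRearr_nonneg {d : ℕ} (φ : EuclideanSpace ℝ (Fin d) → ℂ)
    (x : EuclideanSpace ℝ (Fin d)) : 0 ≤ symmRearr φ x :=
  integral_nonneg fun _ => indicator_nonneg (fun _ _ => zero_le_one) x

theorem volume_level_ne_top {d : ℕ} (f : L2Space d) {s : ℝ} (hs : 0 < s) :
    volume {y | s < ‖f y‖} ≠ ∞ := by
  have h := (Lp.memLp f).meas_ge_lt_top two_ne_zero ENNReal.ofNat_ne_top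
    (ε := ⟨s, hs.le⟩) (by intro h; exact hs.ne' (congrArg Subtype.val h))
  refine (lt_of_le_of_lt (measure_mono ?_) h).ne
  intro y hy
  exact (show s < ‖f y‖ from hy).le

theorem symmRadius_anti {d : ℕ} (f : L2Space d) {s t : ℝ} (hs : 0 < s) (hst : s ≤ t) :
    symmRadius {y | t < ‖f y‖} ≤ symmRadius {y | s < ‖f y‖} := by
  unfold symmRadius
  refine Real.rpow_le_rpow (by positivity) ?_ (by positivity)
  refine div_le_div_of_nonneg_right ?_ measureReal_nonneg
  refine measureReal_mono ?_ (volume_level_ne_top f hs)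
  intro y hy
  exact lt_of_le_of_lt hst hy

theorem level_symmRearr_subset {d : ℕ} (f : L2Space d) {s : ℝ} (hs : 0 < s) :
    {x | s < symmRearr f x} ⊆ symmRearrSet {y | s < ‖f y‖} := by
  intro x hx
  by_contra hxn
  refine (lt_irrefl s) (lt_of_lt_of_le (show s < symmRearr f x from hx) ?_)
  have hsupp : ∀ t ∈ Ioi (0 : ℝ),
      (symmRearrSet {y | t < ‖f y‖}).indicator (fun _ => (1 : ℝ)) x
        ≤ (Ioc 0 s).indicator (fun _ => (1 : ℝ)) t := by
    intro t ht
    by_cases hts : t ≤ s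
    · rw [indicator_of_mem (show t ∈ Ioc 0 s from ⟨ht, hts⟩)]
      exact indicator_le_self' (fun _ _ => zero_le_one) x
    · rw [indicator_of_notMem]
      · exact indicator_nonneg (fun _ _ => zero_le_one) t
      · intro hmem
        exact hxn (ball_subset_ball (symmRadius_anti f hs (not_le.mp hts).le) hmem)
  calc symmRearr f x ≤ ∫ t in Ioi (0 : ℝ), (Ioc 0 s).indicator (fun _ => (1 : ℝ)) t := by
        refine integral_mono_of_nonneg
          (Filter.Eventually.of_forall fun t => indicator_nonneg (fun _ _ => zero_le_one) x) ?_ ?_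
        · refine ((integrable_indicator_iff measurableSet_Ioc).2 ?_).mono_measure
            Measure.restrict_le_self
          exact integrableOn_const measure_Ioc_lt_top.ne
        · exact (ae_restrict_iff' measurableSet_Ioi).2 (Filter.Eventually.of_forall hsupp)
    _ = s := by
        rw [setIntegral_indicator measurableSet_Ioc,
          inter_eq_self_of_subset_right Ioc_subset_Ioi_self]
        simp [hs.le]

theorem stronglyMeasurable_symmRearr {d : ℕ} (f : L2Space d) :
    StronglyMeasurable (symmRearr f) := by
  -- clamp the level so that the radius becomes a globally antitone function of the parameter
  have hR : ∃ R : ℝ → ℝ, Measurable R ∧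
      ∀ s ∈ Ioi (0 : ℝ), R s = symmRadius {y | s < ‖f y‖} := by
    refine ⟨(Ioi (0 : ℝ)).indicator fun s => symmRadius {y | s < ‖f y‖}, ?_, fun s hs =>
      indicator_of_mem hs _⟩
    refine measurable_of_restrict_of_restrict_compl (s := Ioi (0 : ℝ)) measurableSet_Ioi ?_ ?_
    · have h : (Ioi (0 : ℝ)).domRestrict
          ((Ioi (0 : ℝ)).indicator fun s => symmRadius {y | s < ‖f y‖}) =
          fun s : Ioi (0 : ℝ) => symmRadius {y | (s : ℝ) < ‖f y‖} :=
        funext fun s => indicator_of_mem s.2 _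
      rw [h]
      refine Antitone.measurable ?_
      intro s t hst
      exact symmRadius_anti f s.2 hst
    · have h : (Ioi (0 : ℝ))ᶜ.domRestrict
          ((Ioi (0 : ℝ)).indicator fun s => symmRadius {y | s < ‖f y‖}) = fun _ => 0 :=
        funext fun s => indicator_of_notMem s.2 _
      rw [h]
      exact measurable_const
  obtain ⟨R, hRm, hR⟩ := hR
  have hset : MeasurableSet {p : EuclideanSpace ℝ (Fin d) × ℝ | ‖p.1‖ < R p.2} :=
    measurableSet_lt (by fun_prop) (by fun_prop)
  have hsm : StronglyMeasurable (fun x : EuclideanSpace ℝ (Fin d) => ∫ s in Ioi (0 : ℝ),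
      {p : EuclideanSpace ℝ (Fin d) × ℝ | ‖p.1‖ < R p.2}.indicator (fun _ => (1 : ℝ)) (x, s)) :=
    (stronglyMeasurable_const.indicator hset).integral_prod_right'
  convert hsm using 2 with x
  refine setIntegral_congr_fun measurableSet_Ioi fun s hs => ?_
  change (ball 0 (symmRadius {y | s < ‖f y‖})).indicator (fun _ => (1 : ℝ)) x =
    {p : EuclideanSpace ℝ (Fin d) × ℝ | ‖p.1‖ < R p.2}.indicator (fun _ => (1 : ℝ)) (x, s)
  have hiff : x ∈ ball (0 : EuclideanSpace ℝ (Fin d)) (symmRadius {y | s < ‖f y‖}) ↔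
      (x, s) ∈ {p : EuclideanSpace ℝ (Fin d) × ℝ | ‖p.1‖ < R p.2} := by
    change _ ↔ ‖x‖ < R s
    rw [mem_ball_zero_iff, hR s hs]
  by_cases hx : x ∈ ball (0 : EuclideanSpace ℝ (Fin d)) (symmRadius {y | s < ‖f y‖})
  · rw [indicator_of_mem hx, indicator_of_mem (hiff.1 hx)]
  · rw [indicator_of_notMem hx, indicator_of_notMem (fun h => hx (hiff.2 h))]

/-- `|φ|^*` is square integrable when `φ` is. -/
theorem memLp_symmRearr {d : ℕ} (f : L2Space d) :
    MemLp (fun x => (symmRearr f x : ℂ)) 2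
      (volume : Measure (EuclideanSpace ℝ (Fin d))) := by
  rcases eq_or_ne d 0 with rfl | hd
  · have : IsFiniteMeasure (volume : Measure (EuclideanSpace ℝ (Fin 0))) :=
      ⟨by rw [Subsingleton.eq_univ_of_nonempty (⟨0, by simp⟩ :
        (closedBall (0 : EuclideanSpace ℝ (Fin 0)) 1).Nonempty) |>.symm]
          exact measure_closedBall_lt_top⟩
    have : (fun x => (symmRearr f x : ℂ)) = fun _ => (symmRearr f 0 : ℂ) := by
      funext x
      rw [Subsingleton.elim x 0]
    rw [this]
    exact memLp_const _
  have hm := stronglyMeasurable_symmRearr f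
  have hsm : AEStronglyMeasurable (fun x => (symmRearr f x : ℂ))
      (volume : Measure (EuclideanSpace ℝ (Fin d))) :=
    (Complex.measurable_ofReal.comp hm.measurable).aestronglyMeasurable
  refine ⟨hsm, ?_⟩
  have hf := (eLpNorm_lt_top_iff_lintegral_rpow_enorm_lt_top two_ne_zero
    ENNReal.ofNat_ne_top).1 (Lp.memLp f).2
  refine (eLpNorm_lt_top_iff_lintegral_rpow_enorm_lt_top two_ne_zero
    ENNReal.ofNat_ne_top).2 (lt_of_le_of_lt ?_ hf)
  have e1 : ∀ x, ‖(symmRearr f x : ℂ)‖ₑ ^ (2 : ℝ≥0∞).toReal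
      = ENNReal.ofReal (symmRearr f x ^ (2 : ℝ)) := by
    intro x
    rw [← ofReal_norm, Complex.norm_real, Real.norm_of_nonneg (symmRearr_nonneg _ _),
      ENNReal.toReal_ofNat, ENNReal.ofReal_rpow_of_nonneg (symmRearr_nonneg _ _) zero_le_two]
  have e2 : ∀ x, ‖f x‖ₑ ^ (2 : ℝ≥0∞).toReal = ENNReal.ofReal (‖f x‖ ^ (2 : ℝ)) := by
    intro x
    rw [← ofReal_norm, ENNReal.toReal_ofNat,
      ENNReal.ofReal_rpow_of_nonneg (norm_nonneg _) zero_le_two]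
  simp_rw [e1, e2]
  rw [lintegral_rpow_eq_lintegral_meas_lt_mul _ (Filter.Eventually.of_forall
      (symmRearr_nonneg f)) hm.measurable.aemeasurable two_pos,
    lintegral_rpow_eq_lintegral_meas_lt_mul _ (Filter.Eventually.of_forall fun x => norm_nonneg _)
      (Lp.aestronglyMeasurable f).norm.aemeasurable two_pos]
  refine mul_le_mul_right (setLIntegral_mono' measurableSet_Ioi fun s hs => ?_) _
  refine mul_le_mul_left ?_ _
  calc volume {x | s < symmRearr f x} ≤ volume (symmRearrSet {y | s < ‖f y‖}) :=
        measure_mono (level_symmRearr_subset f hs)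
    _ = volume {y | s < ‖f y‖} := volume_symmRearrSet hd (volume_level_ne_top f hs)

/-- The symmetric decreasing rearrangement of an `L²` function, as an element of `L²`. -/
noncomputable def rearrL2 {d : ℕ} (f : L2Space d) : L2Space d :=
  (memLp_symmRearr f).toLp (fun x => (symmRearr f x : ℂ))

/-- The Bochner-Riesz weight `(1 - |ξ|²)_+^β`, which vanishes outside the open unit ball (also
when `β = 0`). -/
noncomputable def bochnerRieszWeight {d : ℕ} (β : ℝ) (ξ : EuclideanSpace ℝ (Fin d)) : ℝ :=
  (ball (0 : EuclideanSpace ℝ (Fin d)) 1).indicator (fun η => (1 - ‖η‖ ^ 2) ^ β) ξ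

/-- The Bochner-Riesz integral `∫ (1 - |ξ|²)_+^β ĝ(ξ) dξ` of `g ∈ L²`. -/
noncomputable def bochnerRieszIntegral {d : ℕ} (β : ℝ) (g : L2Space d) : ℂ :=
  ∫ ξ : EuclideanSpace ℝ (Fin d), (bochnerRieszWeight β ξ : ℂ) * (𝓕 g : L2Space d) ξ

/-- `v` is the `L²` solution on `[0, ∞)` of the free Schrödinger equation
`i ∂ₜ v + (1 / 4π) Δ v = 0`, `v(0) = v₀`: it is continuous in time with values in `L²(ℝᵈ)`, has
the initial value `v₀`, and satisfies `∂ₜ v = (i / 4π) Δ v` in the sense of tempered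
distributions at every time `t > 0`, that is, after pairing with every Schwartz function `η`
and moving the Laplacian onto `η`. -/
structure IsFreeSchrodingerSolution {d : ℕ} (v₀ : L2Space d) (v : ℝ → L2Space d) : Prop where
  continuousOn : ContinuousOn v (Ici 0)
  initial : v 0 = v₀
  equation : ∀ (η : 𝓢(EuclideanSpace ℝ (Fin d), ℂ)) (t : ℝ), 0 < t →
    HasDerivAt (fun s : ℝ => ∫ x, v s x * η x)
      (Complex.I / (4 * Real.pi) * ∫ x, v t x * (Δ η) x) t

/-! ### The Plancherel transform and the integral transform agree on `L¹ ∩ L²`. -/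

section FourierL2

variable {d : ℕ}

/-! For fixed `t` the solution is `v t = 𝓕⁻ (e^{-iπt|ξ|²} 𝓕 v₀)`. It can be read as an operator `T`
applied to a function `f` in two ways: to `f = 𝓕 v₀`, with `T` the inverse transform after a
unimodular multiplication, or to `f = v₀`, with `T` the Schrödinger propagator. In both readings `T`
contracts `L²` and maps `L¹` to `L^∞` with norm at most `K`, where `K = 1` in the first case and `K
= t^{-d/2}` in the second (the dispersive estimate, `ae_norm_gaussianPropagator_le`). Everything
else uses only these two bounds.

Upper bound. Write `f* = symmRearr f`, fix a radius `r` and cut `f` at the height `c` that `f*` has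
on the sphere of radius `r`. The part of `f` above `c` has `L¹` norm at most `M = ∫_{B(0,r)} f*`,
and the part below `c` has squared `L²` norm at most a multiple of `r^{-d} M²` plus the tail `Q =
∫_{|x|≥r} (f*)²`. Hence `∫_A |T f|²` is at most a multiple of `K²|A| M² + r^{-d} M² + Q`
(`setIntegral_sq_le_of_weakType`, `integral_min_sq_le`).

Lower bound for the `L²` estimates. A difference of two Gaussians minorizes the indicator of
`B(0,σ)`. By Parseval the Gaussian averages of `|𝓕 f*|²` become heat-kernel energies of `f*`, and
positivity and monotonicity bound these below by `r^{-d} M² + ωQ` with `r = √(d+1)/σ` and `ω =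
|B(0,1)|` (`le_setIntegral_norm_fourier_rearrL2_sq`). Choosing `σ` so that `K²|A| = σ^d ω` makes the
two bounds match (`exists_setIntegral_sq_le`); this gives `σ = τ` and `σ = τ/t` in the two readings.

Lower bound for the `L¹` estimates. Take `r = 1`, and bound the low part by `S c²` through its
support. It remains to bound `∫_{B(0,1)} f*` by the Bochner-Riesz integral, which is the pairing of
`f*` with `V = 𝓕 (1-|ξ|²)_+^β`. Since `f*` is a superposition of centred balls, it suffices that
`∫_{B(0,R)} V ≥ c |B(0,1) ∩ B(0,R)|` for every `R`. In polar coordinates this is a lower bound for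
`∫₀ˣ t^{d-1} u(t) dt`, where `u` is the Poisson integral of the Bessel function with `γ = β +
(d-1)/2` (`exists_le_integral_pow_mul_poissonIntegral`). The condition `β ≥ (d-1)/2` is exactly `d -
1 ≤ γ`. The positivity comes from a Sturm comparison: each negative arch of `t^{γ+1} u(t)` is
dominated by the positive values that precede it (`sturm_reflection`). -/

theorem L2Space.norm_sq_eq (f : L2Space d) : ‖f‖ ^ 2 = ∫ x, ‖f x‖ ^ 2 := by
  have h : (inner ℂ f f : ℂ) = ((∫ x, ‖f x‖ ^ 2 : ℝ) : ℂ) := by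
    rw [L2.inner_def, ← integral_complex_ofReal]
    refine integral_congr_ae (Filter.Eventually.of_forall fun x => ?_)
    simp [inner_self_eq_norm_sq_to_K]
  rw [inner_self_eq_norm_sq_to_K] at h
  exact Complex.ofReal_injective (by simpa using h)

theorem L2Space.integrable_norm_sq (f : L2Space d) : Integrable fun x => ‖f x‖ ^ 2 :=
  (memLp_two_iff_integrable_sq_norm (Lp.aestronglyMeasurable f)).1 (Lp.memLp f)

theorem norm_toLp_sq {f : EuclideanSpace ℝ (Fin d) → ℂ} (hf : MemLp f 2) :
    ‖(hf.toLp f : L2Space d)‖ ^ 2 = ∫ x, ‖f x‖ ^ 2 := by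
  rw [L2Space.norm_sq_eq]
  refine integral_congr_ae ?_
  filter_upwards [hf.coeFn_toLp] with x hx
  rw [hx]

theorem integral_mul_fourier (f : L2Space d) (φ : 𝓢(EuclideanSpace ℝ (Fin d), ℂ)) :
    ∫ x, φ x * (𝓕 f : L2Space d) x = ∫ x, (𝓕 φ) x * f x := by
  have h := DFunLike.congr_fun (Lp.fourier_toTemperedDistribution_eq f) φ
  rw [TemperedDistribution.fourier_apply] at h
  simpa using h.symm

theorem integral_fourier_mul_eq {f g : EuclideanSpace ℝ (Fin d) → ℂ} (hf : Integrable f)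
    (hg : Integrable g) : ∫ ξ, 𝓕 f ξ * g ξ = ∫ x, f x * 𝓕 g x := by
  have h := VectorFourier.integral_fourierIntegral_smul_eq_flip
    (L := innerₗ (EuclideanSpace ℝ (Fin d))) (μ := volume) (ν := volume)
    Real.continuous_fourierChar continuous_inner hf hg
  rw [flip_innerₗ] at h
  exact h

theorem continuous_fourier {f : EuclideanSpace ℝ (Fin d) → ℂ} (hf : Integrable f) :
    Continuous (𝓕 f) :=
  VectorFourier.fourierIntegral_continuous Real.continuous_fourierChar
    (L := innerₗ (EuclideanSpace ℝ (Fin d))) continuous_inner hf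

theorem norm_fourier_le (f : EuclideanSpace ℝ (Fin d) → ℂ) (ξ : EuclideanSpace ℝ (Fin d)) :
    ‖𝓕 f ξ‖ ≤ ∫ x, ‖f x‖ :=
  VectorFourier.norm_fourierIntegral_le_integral_norm _ _ _ _ _

/-- Both sides are locally integrable and have the same pairing with every smooth compactly
supported function: in either case the transform can be moved onto the test function. -/
theorem fourier_toLp_ae_eq {f : EuclideanSpace ℝ (Fin d) → ℂ} (hf : Integrable f)
    (hf2 : MemLp f 2) : (𝓕 (hf2.toLp f) : L2Space d) =ᵐ[volume] 𝓕 f := by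
  refine ae_eq_of_integral_contDiff_smul_eq ((Lp.memLp _).locallyIntegrable one_le_two)
    (continuous_fourier hf).locallyIntegrable fun g hg hgs => ?_
  have hg₁ : HasCompactSupport (Complex.ofRealCLM ∘ g) := hgs.comp_left rfl
  have hg₂ : ContDiff ℝ (↑(⊤ : ℕ∞)) (Complex.ofRealCLM ∘ g) := by fun_prop
  have h1 := integral_mul_fourier (hf2.toLp f) (hg₁.toSchwartzMap hg₂)
  have h2 := integral_fourier_mul_eq (f := hg₁.toSchwartzMap hg₂) (g := f)
    (SchwartzMap.integrable _) hf
  have h3 : ∫ x, (𝓕 (hg₁.toSchwartzMap hg₂)) x * (hf2.toLp f) x =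
      ∫ x, (𝓕 (hg₁.toSchwartzMap hg₂)) x * f x := by
    refine integral_congr_ae ?_
    filter_upwards [hf2.coeFn_toLp] with x hx
    rw [hx]
  rw [h3, SchwartzMap.fourier_coe, h2] at h1
  simpa using h1

/-- The test function is replaced by its inverse transform, so that the duality formula for `𝓕`
applies; the remaining sign is absorbed by the substitution `x ↦ -x`. -/
theorem fourierInv_toLp_ae_eq {f : EuclideanSpace ℝ (Fin d) → ℂ} (hf : Integrable f)
    (hf2 : MemLp f 2) : (𝓕⁻ (hf2.toLp f) : L2Space d) =ᵐ[volume] 𝓕⁻ f := by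
  have hc : Continuous (𝓕⁻ f) := by
    rw [show 𝓕⁻ f = fun w => 𝓕 f (-w) from funext fun w => Real.fourierInv_eq_fourier_neg f w]
    exact (continuous_fourier hf).comp continuous_neg
  refine ae_eq_of_integral_contDiff_smul_eq ((Lp.memLp _).locallyIntegrable one_le_two)
    hc.locallyIntegrable fun g hg hgs => ?_
  have hg₁ : HasCompactSupport (Complex.ofRealCLM ∘ g) := hgs.comp_left rfl
  have hg₂ : ContDiff ℝ (↑(⊤ : ℕ∞)) (Complex.ofRealCLM ∘ g) := by fun_prop
  set φ := hg₁.toSchwartzMap hg₂ with hφ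
  have h1 := integral_mul_fourier (𝓕⁻ (hf2.toLp f)) (𝓕⁻ φ)
  have h4 : (𝓕 (𝓕⁻ (hf2.toLp f)) : L2Space d) = hf2.toLp f := FourierTransform.fourier_fourierInv_eq _
  rw [h4, FourierTransform.fourier_fourierInv_eq] at h1
  have h3 : ∫ x, (𝓕⁻ φ) x * (hf2.toLp f) x = ∫ x, (𝓕⁻ φ) x * f x := by
    refine integral_congr_ae ?_
    filter_upwards [hf2.coeFn_toLp] with x hx
    rw [hx]
  have h2 := integral_fourier_mul_eq (f := φ) (g := fun x => f (-x))
    (SchwartzMap.integrable _) hf.comp_neg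
  have h5 : 𝓕 (fun x => f (-x)) = 𝓕⁻ f := by
    rw [Real.fourierInv_eq_fourier_comp_neg]
  have h6 : ∫ x, (𝓕⁻ φ) x * f x = ∫ x, 𝓕 (φ : EuclideanSpace ℝ (Fin d) → ℂ) x * f (-x) := by
    rw [← integral_neg_eq_self]
    refine integral_congr_ae (Filter.Eventually.of_forall fun x => ?_)
    simp only [SchwartzMap.fourierInv_coe, Real.fourierInv_eq_fourier_neg, neg_neg]
  rw [h3, h6, h2, h5] at h1
  simpa [hφ] using h1.symm

end FourierL2

/-! ### Complex Gaussian multipliers and the dispersive estimate. -/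

section GaussianMultiplier

variable {d : ℕ}

/-- The complex Gaussian `exp (-π z |ξ|²)`. -/
noncomputable def complexGaussian (z : ℂ) (ξ : EuclideanSpace ℝ (Fin d)) : ℂ :=
  Complex.exp (-(Real.pi * z) * (‖ξ‖ : ℂ) ^ 2)

theorem continuous_complexGaussian (z : ℂ) :
    Continuous (complexGaussian z : EuclideanSpace ℝ (Fin d) → ℂ) := by
  unfold complexGaussian
  fun_prop

theorem norm_complexGaussian (z : ℂ) (ξ : EuclideanSpace ℝ (Fin d)) :
    ‖complexGaussian z ξ‖ = Real.exp (-(Real.pi * z.re * ‖ξ‖ ^ 2)) := by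
  rw [complexGaussian, Complex.norm_exp]
  congr 1
  rw [← Complex.ofReal_pow, mul_comm, Complex.re_ofReal_mul, Complex.neg_re, Complex.re_ofReal_mul]
  ring

theorem norm_complexGaussian_le_one {z : ℂ} (hz : 0 ≤ z.re) (ξ : EuclideanSpace ℝ (Fin d)) :
    ‖complexGaussian z ξ‖ ≤ 1 := by
  rw [norm_complexGaussian, Real.exp_le_one_iff]
  have := Real.pi_pos
  have : 0 ≤ Real.pi * z.re * ‖ξ‖ ^ 2 := by positivity
  linarith

theorem memLp_complexGaussian_mul {z : ℂ} (hz : 0 ≤ z.re)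
    {f : EuclideanSpace ℝ (Fin d) → ℂ} (hf : MemLp f 2) :
    MemLp (fun ξ => complexGaussian z ξ * f ξ) 2 := by
  refine hf.of_le_mul (c := 1)
    ((continuous_complexGaussian z).aestronglyMeasurable.mul hf.aestronglyMeasurable)
    (Filter.Eventually.of_forall fun x => ?_)
  rw [norm_mul]
  gcongr
  exact norm_complexGaussian_le_one hz x

theorem integrable_complexGaussian {z : ℂ} (hz : 0 < z.re) :
    Integrable (complexGaussian z : EuclideanSpace ℝ (Fin d) → ℂ) := by
  have hb : 0 < ((Real.pi : ℂ) * z).re := by simpa using mul_pos Real.pi_pos hz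
  refine (GaussianFourier.integrable_cexp_neg_mul_sq_norm_add hb 0
    (0 : EuclideanSpace ℝ (Fin d))).congr (Filter.Eventually.of_forall fun v => ?_)
  simp [complexGaussian]

/-- Multiplication by a bounded complex Gaussian, on `L²`. -/
noncomputable def gaussianMul (z : ℂ) (hz : 0 ≤ z.re) : L2Space d →ₗ[ℂ] L2Space d where
  toFun f := (memLp_complexGaussian_mul hz (Lp.memLp f)).toLp _
  map_add' f g := by
    rw [← MemLp.toLp_add]
    refine MemLp.toLp_congr _ _ ?_
    filter_upwards [Lp.coeFn_add f g] with x hx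
    rw [hx, Pi.add_apply, Pi.add_apply, mul_add]
  map_smul' c f := by
    rw [RingHom.id_apply, ← MemLp.toLp_const_smul]
    refine MemLp.toLp_congr _ _ ?_
    filter_upwards [Lp.coeFn_smul c f] with x hx
    rw [hx, Pi.smul_apply, Pi.smul_apply, smul_eq_mul, smul_eq_mul]
    ring

theorem coeFn_gaussianMul {z : ℂ} (hz : 0 ≤ z.re) (f : L2Space d) :
    gaussianMul z hz f =ᵐ[volume] fun ξ => complexGaussian z ξ * f ξ :=
  (memLp_complexGaussian_mul hz (Lp.memLp f)).coeFn_toLp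

theorem norm_gaussianMul_le {z : ℂ} (hz : 0 ≤ z.re) (f : L2Space d) :
    ‖gaussianMul z hz f‖ ≤ ‖f‖ := by
  refine Lp.norm_le_norm_of_ae_le ?_
  filter_upwards [coeFn_gaussianMul hz f] with x hx
  rw [hx, norm_mul]
  exact mul_le_of_le_one_left (norm_nonneg _) (norm_complexGaussian_le_one hz x)

/-- Dominated convergence: two multipliers of modulus at most 1 differ by at most 2, so `4‖f‖²`
dominates. This allows imaginary `z` to be reached from `Re z > 0`. -/
theorem tendsto_gaussianMul (f : L2Space d) {z : ℕ → ℂ} {w : ℂ} (hz : ∀ n, 0 ≤ (z n).re)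
    (hw : 0 ≤ w.re) (h : Filter.Tendsto z Filter.atTop (nhds w)) :
    Filter.Tendsto (fun n => gaussianMul (z n) (hz n) f) Filter.atTop
      (nhds (gaussianMul w hw f)) := by
  rw [tendsto_iff_norm_sub_tendsto_zero]
  have key : Filter.Tendsto (fun n => ‖gaussianMul (z n) (hz n) f - gaussianMul w hw f‖ ^ 2)
      Filter.atTop (nhds 0) := by
    have e : ∀ n, ‖gaussianMul (z n) (hz n) f - gaussianMul w hw f‖ ^ 2 =
        ∫ ξ, ‖(complexGaussian (z n) ξ - complexGaussian w ξ) * f ξ‖ ^ 2 := by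
      intro n
      rw [L2Space.norm_sq_eq]
      refine integral_congr_ae ?_
      filter_upwards [coeFn_gaussianMul (hz n) f, coeFn_gaussianMul hw f,
        Lp.coeFn_sub (gaussianMul (z n) (hz n) f) (gaussianMul w hw f)] with x h1 h2 h3
      rw [h3, Pi.sub_apply, h1, h2, sub_mul]
    simp_rw [e]
    rw [← integral_zero (EuclideanSpace ℝ (Fin d)) ℝ]
    refine tendsto_integral_of_dominated_convergence (fun ξ => 4 * ‖f ξ‖ ^ 2) (fun n => ?_)
      ((L2Space.integrable_norm_sq f).const_mul 4) (fun n => ?_) ?_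
    · exact ((((continuous_complexGaussian (z n)).sub
        (continuous_complexGaussian w)).aestronglyMeasurable.mul
        (Lp.aestronglyMeasurable f)).norm.pow 2)
    · refine Filter.Eventually.of_forall fun x => ?_
      rw [Real.norm_of_nonneg (by positivity), norm_mul, mul_pow]
      gcongr
      have h2 : ‖complexGaussian (z n) x - complexGaussian w x‖ ≤ 2 :=
        (norm_sub_le _ _).trans (by
          linarith [norm_complexGaussian_le_one (hz n) x, norm_complexGaussian_le_one hw x])
      nlinarith [norm_nonneg (complexGaussian (z n) x - complexGaussian w x)]
    · refine Filter.Eventually.of_forall fun x => ?_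
      have h1 : Continuous fun z : ℂ =>
          ‖(complexGaussian z x - complexGaussian w x) * f x‖ ^ 2 := by
        unfold complexGaussian
        fun_prop
      have h2 := (h1.tendsto w).comp h
      simpa [Function.comp_def] using h2
  have := key.sqrt
  simpa [Real.sqrt_sq (norm_nonneg _)] using this

/-- The phase `e^{2πi⟨x,ξ⟩}` is absorbed into the Gaussian and the transform is moved from `f` onto
this product, whose transform is explicit. For `Re z > 0` all integrals converge absolutely. -/
theorem fourierInv_complexGaussian_mul_fourier {z : ℂ} (hz : 0 < z.re)
    {f : EuclideanSpace ℝ (Fin d) → ℂ} (hf : Integrable f) (x : EuclideanSpace ℝ (Fin d)) :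
    𝓕⁻ (fun ξ => complexGaussian z ξ * 𝓕 f ξ) x =
      ∫ y, ((1 / z) ^ ((d : ℂ) / 2) * complexGaussian (1 / z) (x - y)) * f y := by
  have hb : 0 < ((Real.pi : ℂ) * z).re := by simpa using mul_pos Real.pi_pos hz
  have hz0 : z ≠ 0 := fun h => by simp [h] at hz
  have hpi : (Real.pi : ℂ) ≠ 0 := by exact_mod_cast Real.pi_ne_zero
  set G : EuclideanSpace ℝ (Fin d) → ℂ := fun v =>
    Complex.exp (-(Real.pi * z) * (‖v‖ : ℂ) ^ 2 + 2 * Real.pi * Complex.I * (inner ℝ x v : ℝ))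
    with hG
  have hGi : Integrable G := GaussianFourier.integrable_cexp_neg_mul_sq_norm_add hb _ _
  have h1 := integral_fourier_mul_eq hGi hf
  rw [Real.fourierInv_eq']
  calc ∫ ξ, Complex.exp (↑(2 * Real.pi * inner ℝ ξ x) * Complex.I) •
        (complexGaussian z ξ * 𝓕 f ξ) = ∫ ξ, G ξ * 𝓕 f ξ := by
        refine integral_congr_ae (Filter.Eventually.of_forall fun ξ => ?_)
        simp only [hG, complexGaussian, smul_eq_mul]
        rw [← mul_assoc, ← Complex.exp_add, real_inner_comm]
        congr 2
        push_cast
        ring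
    _ = ∫ y, 𝓕 G y * f y := h1.symm
    _ = _ := by
        refine integral_congr_ae (Filter.Eventually.of_forall fun y => ?_)
        simp only [hG]
        rw [fourier_gaussian_innerProductSpace' hb x y, finrank_euclideanSpace_fin]
        congr 2
        · congr 1
          field_simp
        · rw [complexGaussian]
          congr 1
          field_simp

theorem norm_fourierInv_complexGaussian_mul_fourier_le {z : ℂ} (hz : 0 < z.re)
    {f : EuclideanSpace ℝ (Fin d) → ℂ} (hf : Integrable f) (x : EuclideanSpace ℝ (Fin d)) :
    ‖𝓕⁻ (fun ξ => complexGaussian z ξ * 𝓕 f ξ) x‖ ≤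
      (1 / ‖z‖) ^ ((d : ℝ) / 2) * ∫ y, ‖f y‖ := by
  rw [fourierInv_complexGaussian_mul_fourier hz hf, ← integral_const_mul]
  have hz0 : z ≠ 0 := fun h => by simp [h] at hz
  have hz1 : 0 ≤ (1 / z).re := by
    rw [one_div, Complex.inv_re]
    exact div_nonneg hz.le (Complex.normSq_nonneg _)
  refine norm_integral_le_of_norm_le (hf.norm.const_mul _)
    (Filter.Eventually.of_forall fun y => ?_)
  rw [norm_mul, norm_mul]
  have h2 : ‖(1 / z) ^ ((d : ℂ) / 2)‖ = (1 / ‖z‖) ^ ((d : ℝ) / 2) := by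
    rw [show ((d : ℂ) / 2) = (((d : ℝ) / 2 : ℝ) : ℂ) by push_cast; rfl,
      Complex.norm_cpow_real, norm_div, norm_one]
  rw [h2]
  gcongr
  exact mul_le_of_le_one_right (by positivity) (norm_complexGaussian_le_one hz1 _)

/-- The Fourier multiplier with symbol `exp (-π z |ξ|²)`, on `L²`. -/
noncomputable def gaussianPropagator (z : ℂ) (hz : 0 ≤ z.re) : L2Space d →ₗ[ℂ] L2Space d :=
  (Lp.fourierTransformₗᵢ (EuclideanSpace ℝ (Fin d)) ℂ).symm.toLinearEquiv.toLinearMap ∘ₗ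
    gaussianMul z hz ∘ₗ (Lp.fourierTransformₗᵢ (EuclideanSpace ℝ (Fin d)) ℂ).toLinearEquiv.toLinearMap

theorem gaussianPropagator_apply {z : ℂ} (hz : 0 ≤ z.re) (f : L2Space d) :
    gaussianPropagator z hz f = 𝓕⁻ (gaussianMul z hz (𝓕 f)) := rfl

theorem Lp.norm_fourierInv_eq (f : L2Space d) : ‖(𝓕⁻ f : L2Space d)‖ = ‖f‖ :=
  (Lp.fourierTransformₗᵢ _ _).symm.norm_map f

theorem norm_gaussianPropagator_le {z : ℂ} (hz : 0 ≤ z.re) (f : L2Space d) :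
    ‖gaussianPropagator z hz f‖ ≤ ‖f‖ := by
  rw [gaussianPropagator_apply, Lp.norm_fourierInv_eq]
  exact (norm_gaussianMul_le hz _).trans (Lp.norm_fourier_eq f).le

theorem ae_norm_gaussianPropagator_le_of_re_pos {z : ℂ} (hz : 0 < z.re)
    {f : L2Space d} (hf : Integrable f) :
    ∀ᵐ x, ‖gaussianPropagator z hz.le f x‖ ≤ (1 / ‖z‖) ^ ((d : ℝ) / 2) * ∫ y, ‖f y‖ := by
  have h1 : (𝓕 f : L2Space d) =ᵐ[volume] 𝓕 (f : EuclideanSpace ℝ (Fin d) → ℂ) := by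
    have := fourier_toLp_ae_eq hf (Lp.memLp f)
    rwa [Lp.toLp_coeFn] at this
  have h2 : gaussianMul z hz.le (𝓕 f) =ᵐ[volume]
      fun ξ => complexGaussian z ξ * 𝓕 (f : EuclideanSpace ℝ (Fin d) → ℂ) ξ := by
    filter_upwards [coeFn_gaussianMul hz.le (𝓕 f), h1] with x hx h1x
    rw [hx, h1x]
  have h3 : MemLp (fun ξ => complexGaussian z ξ * 𝓕 (f : EuclideanSpace ℝ (Fin d) → ℂ) ξ) 2 :=
    (Lp.memLp _).ae_eq h2
  have h4 : Integrable
      (fun ξ => complexGaussian z ξ * 𝓕 (f : EuclideanSpace ℝ (Fin d) → ℂ) ξ) :=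
    (integrable_complexGaussian hz).mul_bdd
      (continuous_fourier hf).aestronglyMeasurable
      (Filter.Eventually.of_forall fun ξ => norm_fourier_le f ξ)
  have h5 := fourierInv_toLp_ae_eq h4 h3
  have h6 : h3.toLp _ = gaussianMul z hz.le (𝓕 f) := by
    rw [← Lp.toLp_coeFn (gaussianMul z hz.le (𝓕 f)) (Lp.memLp _)]
    exact MemLp.toLp_congr _ _ h2.symm
  rw [gaussianPropagator_apply]
  rw [h6] at h5
  filter_upwards [h5] with x hx
  rw [hx]
  exact norm_fourierInv_complexGaussian_mul_fourier_le hz hf x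

/-- The dispersive estimate. -/
theorem ae_norm_gaussianPropagator_le {z : ℂ} (hz : 0 ≤ z.re) (hz0 : z ≠ 0)
    {f : L2Space d} (hf : Integrable f) :
    ∀ᵐ x, ‖gaussianPropagator z hz f x‖ ≤ (1 / ‖z‖) ^ ((d : ℝ) / 2) * ∫ y, ‖f y‖ := by
  -- For imaginary `z` the Gaussian is not integrable, so the kernel formula is used at `z +
  -- 1/(n+1)`. Convergence in `L²` yields almost everywhere convergence along a subsequence, and the
  -- pointwise bounds pass to the limit.
  set w : ℕ → ℂ := fun n => z + ((1 / ((n : ℝ) + 1) : ℝ) : ℂ) with hw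
  have hwre : ∀ n, 0 < (w n).re := fun n => by
    simp only [hw, Complex.add_re, Complex.ofReal_re]
    positivity
  have hwt : Filter.Tendsto w Filter.atTop (nhds z) := by
    have h := (Complex.continuous_ofReal.tendsto 0).comp
      (tendsto_one_div_add_atTop_nhds_zero_nat (𝕜 := ℝ))
    simpa [hw, Function.comp_def] using h.const_add z
  have ht : Filter.Tendsto (fun n => gaussianPropagator (w n) (hwre n).le f) Filter.atTop
      (nhds (gaussianPropagator z hz f)) := by
    simp_rw [gaussianPropagator_apply]
    exact ((Lp.fourierTransformₗᵢ (EuclideanSpace ℝ (Fin d)) ℂ).symm.continuous.tendsto _).comp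
      (tendsto_gaussianMul (𝓕 f) (fun n => (hwre n).le) hz hwt)
  obtain ⟨ns, hns, hae⟩ := (tendstoInMeasure_of_tendsto_Lp ht).exists_seq_tendsto_ae
  have hall : ∀ᵐ x, ∀ n, ‖gaussianPropagator (w n) (hwre n).le f x‖ ≤
      (1 / ‖w n‖) ^ ((d : ℝ) / 2) * ∫ y, ‖f y‖ :=
    ae_all_iff.2 fun n => ae_norm_gaussianPropagator_le_of_re_pos (hwre n) hf
  filter_upwards [hae, hall] with x hx hb
  have hc : Filter.Tendsto (fun n => (1 / ‖w (ns n)‖) ^ ((d : ℝ) / 2) * ∫ y, ‖f y‖) Filter.atTop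
      (nhds ((1 / ‖z‖) ^ ((d : ℝ) / 2) * ∫ y, ‖f y‖)) := by
    refine Filter.Tendsto.mul_const _ (Filter.Tendsto.rpow_const ?_ (Or.inr (by positivity)))
    exact tendsto_const_nhds.div (hwt.comp hns.tendsto_atTop).norm (norm_ne_zero_iff.2 hz0)
  exact le_of_tendsto_of_tendsto hx.norm hc (Filter.Eventually.of_forall fun n => hb (ns n))

end GaussianMultiplier

/-! ### A distributional solution is given by the Fourier multiplier. -/

section SchrodingerUniqueness

variable {d : ℕ}

theorem laplacian_fourier_schwartz (ψ : 𝓢(EuclideanSpace ℝ (Fin d), ℂ))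
    (x : EuclideanSpace ℝ (Fin d)) :
    (Δ (𝓕 ψ)) x = -(2 * Real.pi : ℂ) ^ 2 *
      (𝓕 (SchwartzMap.smulLeftCLM ℂ (fun ξ : EuclideanSpace ℝ (Fin d) => ‖ξ‖ ^ 2) ψ)) x := by
  have hg : Function.HasTemperateGrowth (fun ξ : EuclideanSpace ℝ (Fin d) => ‖ξ‖ ^ 2) := by
    fun_prop
  have h1 : ∀ ξ, (𝓕 (𝓕 ψ)) ξ = ψ (-ξ) := by
    intro ξ
    have h : (𝓕⁻ (𝓕 ψ)) (-ξ) = ψ (-ξ) := by rw [FourierTransform.fourierInv_fourier_eq]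
    rw [← h, SchwartzMap.fourierInv_coe, Real.fourierInv_eq_fourier_neg, neg_neg]
    rfl
  rw [SchwartzMap.laplacian_eq_fourierMultiplierCLM, SchwartzMap.fourierMultiplierCLM_apply,
    smul_apply, SchwartzMap.fourierInv_coe, Real.fourierInv_eq_fourier_comp_neg]
  have h2 : (fun ξ => (SchwartzMap.smulLeftCLM ℂ
      (fun ξ : EuclideanSpace ℝ (Fin d) => ‖ξ‖ ^ 2) (𝓕 (𝓕 ψ))) (-ξ)) =
      SchwartzMap.smulLeftCLM ℂ (fun ξ : EuclideanSpace ℝ (Fin d) => ‖ξ‖ ^ 2) ψ := by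
    funext ξ
    rw [SchwartzMap.smulLeftCLM_apply_apply hg, SchwartzMap.smulLeftCLM_apply_apply hg, h1,
      norm_neg, neg_neg]
  rw [h2, SchwartzMap.fourier_coe, Complex.real_smul]
  push_cast
  ring

/-- Testing the equation against `𝓕 ψ` turns the Laplacian into multiplication by `-4π²|ξ|²`, and
`(i/4π)(-4π²) = -iπ`. -/
theorem IsFreeSchrodingerSolution.hasDerivAt_fourier {v₀ : L2Space d} {v : ℝ → L2Space d}
    (h : IsFreeSchrodingerSolution v₀ v) (ψ : 𝓢(EuclideanSpace ℝ (Fin d), ℂ)) {t : ℝ}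
    (ht : 0 < t) :
    HasDerivAt (fun s : ℝ => ∫ ξ, ψ ξ * (𝓕 (v s) : L2Space d) ξ)
      (-(Complex.I * Real.pi) * ∫ ξ, ((‖ξ‖ : ℂ) ^ 2 * ψ ξ) * (𝓕 (v t) : L2Space d) ξ) t := by
  have hg : Function.HasTemperateGrowth (fun ξ : EuclideanSpace ℝ (Fin d) => ‖ξ‖ ^ 2) := by
    fun_prop
  have hpi : (Real.pi : ℂ) ≠ 0 := by exact_mod_cast Real.pi_ne_zero
  have h1 := h.equation (𝓕 ψ) t ht
  have h2 : ∀ s, ∫ x, v s x * (𝓕 ψ) x = ∫ ξ, ψ ξ * (𝓕 (v s) : L2Space d) ξ := by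
    intro s
    rw [integral_mul_fourier]
    simp_rw [mul_comm]
  simp_rw [h2] at h1
  convert h1 using 1
  set χ := SchwartzMap.smulLeftCLM ℂ (fun ξ : EuclideanSpace ℝ (Fin d) => ‖ξ‖ ^ 2) ψ
  have h3 : ∫ ξ, ((‖ξ‖ : ℂ) ^ 2 * ψ ξ) * (𝓕 (v t) : L2Space d) ξ = ∫ x, (𝓕 χ) x * v t x := by
    rw [← integral_mul_fourier]
    refine integral_congr_ae (Filter.Eventually.of_forall fun ξ => ?_)
    simp [χ, SchwartzMap.smulLeftCLM_apply_apply hg]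
  have h4 : ∫ x, v t x * (Δ (𝓕 ψ)) x =
      ∫ x, (-(2 * Real.pi) ^ 2 : ℂ) * ((𝓕 χ) x * v t x) := by
    refine integral_congr_ae (Filter.Eventually.of_forall fun x => ?_)
    simp only [laplacian_fourier_schwartz]
    ring
  rw [h3, h4, integral_const_mul]
  field_simp
  ring

theorem norm_integral_mul_le {f : EuclideanSpace ℝ (Fin d) → ℂ} (hf : MemLp f 2)
    (w : L2Space d) : ‖∫ x, f x * w x‖ ≤ √(∫ x, ‖f x‖ ^ 2) * ‖w‖ := by
  have hfc : MemLp (fun x => (starRingEnd ℂ) (f x)) 2 := hf.star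
  have h := norm_inner_le_norm (𝕜 := ℂ) (hfc.toLp _ : L2Space d) w
  have h1 : ‖(hfc.toLp _ : L2Space d)‖ = √(∫ x, ‖f x‖ ^ 2) := by
    rw [← Real.sqrt_sq (norm_nonneg (hfc.toLp _ : L2Space d)), norm_toLp_sq]
    simp
  have h2 : (inner ℂ (hfc.toLp _ : L2Space d) w : ℂ) = ∫ x, f x * w x := by
    rw [L2.inner_def]
    refine integral_congr_ae ?_
    filter_upwards [hfc.coeFn_toLp] with x hx
    rw [hx]
    simp [mul_comm]
  rwa [h1, h2] at h

theorem norm_complexGaussian_sub_le (s s₀ : ℝ) (ξ : EuclideanSpace ℝ (Fin d)) :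
    ‖complexGaussian (-(Complex.I * s)) ξ - complexGaussian (-(Complex.I * s₀)) ξ‖ ≤
      Real.pi * ‖ξ‖ ^ 2 * |s - s₀| := by
  have e : ∀ r : ℝ, complexGaussian (-(Complex.I * r)) ξ =
      Complex.exp (Complex.I * ((Real.pi * ‖ξ‖ ^ 2 * r : ℝ) : ℂ)) := by
    intro r
    rw [complexGaussian]
    congr 1
    push_cast
    ring
  have e2 : complexGaussian (-(Complex.I * s)) ξ - complexGaussian (-(Complex.I * s₀)) ξ =
      Complex.exp (Complex.I * ((Real.pi * ‖ξ‖ ^ 2 * s₀ : ℝ) : ℂ)) *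
        (Complex.exp (Complex.I * ((Real.pi * ‖ξ‖ ^ 2 * (s - s₀) : ℝ) : ℂ)) - 1) := by
    rw [e, e, mul_sub, ← Complex.exp_add, mul_one]
    congr 2
    push_cast
    ring
  rw [e2, norm_mul, mul_comm Complex.I, Complex.norm_exp_ofReal_mul_I, one_mul]
  refine (Real.norm_exp_I_mul_ofReal_sub_one_le).trans ?_
  rw [Real.norm_eq_abs, abs_mul, abs_of_nonneg (by have := Real.pi_pos; positivity)]

theorem hasDerivAt_complexGaussian (s : ℝ) (ξ : EuclideanSpace ℝ (Fin d)) :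
    HasDerivAt (fun r : ℝ => complexGaussian (-(Complex.I * r)) ξ)
      (Complex.I * Real.pi * (‖ξ‖ : ℂ) ^ 2 * complexGaussian (-(Complex.I * s)) ξ) s := by
  have h : HasDerivAt (fun r : ℝ => -(Real.pi * -(Complex.I * (r : ℂ))) * (‖ξ‖ : ℂ) ^ 2)
      (Complex.I * Real.pi * (‖ξ‖ : ℂ) ^ 2) s := by
    have h1 : HasDerivAt (fun r : ℝ => (r : ℂ)) 1 s := Complex.ofRealCLM.hasDerivAt
    have h2 := h1.const_mul (Complex.I * Real.pi * (‖ξ‖ : ℂ) ^ 2)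
    rw [mul_one] at h2
    refine h2.congr_of_eventuallyEq (Filter.Eventually.of_forall fun r => ?_)
    ring
  exact h.cexp.congr_deriv (mul_comm _ _)

theorem contDiff_complexGaussian (z : ℂ) :
    ContDiff ℝ (↑(⊤ : ℕ∞)) (complexGaussian z : EuclideanSpace ℝ (Fin d) → ℂ) := by
  have h : (complexGaussian z : EuclideanSpace ℝ (Fin d) → ℂ) = fun ξ =>
      Complex.exp (-(Real.pi * z) * Complex.ofRealCLM (‖ξ‖ ^ 2)) := by
    funext ξ
    simp [complexGaussian]
  rw [h]
  have h1 : ContDiff ℝ (↑(⊤ : ℕ∞)) fun ξ : EuclideanSpace ℝ (Fin d) => ‖ξ‖ ^ 2 :=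
    contDiff_norm_sq ℝ
  exact (contDiff_const.mul (Complex.ofRealCLM.contDiff.comp h1)).cexp

theorem re_neg_I_mul (s : ℝ) : (-(Complex.I * (s : ℂ))).re = 0 := by simp

theorem re_I_mul (s : ℝ) : (Complex.I * (s : ℂ)).re = 0 := by simp

section Pairing

variable {v₀ : L2Space d} {v : ℝ → L2Space d} {φ : EuclideanSpace ℝ (Fin d) → ℂ}

/-- Pairing of the backward evolved test function with the Fourier transform of the solution. -/
noncomputable def evolvedPairing (φ : EuclideanSpace ℝ (Fin d) → ℂ) (s : ℝ) (w : L2Space d) : ℂ :=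
  ∫ ξ, (complexGaussian (-(Complex.I * s)) ξ * φ ξ) * w ξ

theorem memLp_evolved (hφ : MemLp φ 2) (s : ℝ) :
    MemLp (fun ξ => complexGaussian (-(Complex.I * s)) ξ * φ ξ) 2 :=
  memLp_complexGaussian_mul (re_neg_I_mul s).ge hφ

theorem evolvedPairing_sub (hφ : MemLp φ 2) (s : ℝ) (w w' : L2Space d) :
    evolvedPairing φ s (w - w') = evolvedPairing φ s w - evolvedPairing φ s w' := by
  unfold evolvedPairing
  refine Eq.trans ?_ (integral_sub ((memLp_evolved hφ s).integrable_mul (Lp.memLp w))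
    ((memLp_evolved hφ s).integrable_mul (Lp.memLp w')))
  refine integral_congr_ae ?_
  filter_upwards [Lp.coeFn_sub w w'] with ξ h
  simp only [h, Pi.sub_apply]
  ring

theorem norm_evolvedPairing_le (hφ : MemLp φ 2) (s : ℝ) (w : L2Space d) :
    ‖evolvedPairing φ s w‖ ≤ √(∫ ξ, ‖φ ξ‖ ^ 2) * ‖w‖ := by
  refine (norm_integral_mul_le (memLp_evolved hφ s) w).trans_eq ?_
  have : ∀ ξ : EuclideanSpace ℝ (Fin d), ‖complexGaussian (-(Complex.I * s)) ξ‖ = 1 := by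
    intro ξ
    rw [norm_complexGaussian, re_neg_I_mul]
    simp
  simp_rw [norm_mul, this, one_mul]

/-- On the support of `φ` the phase `e^{iπs|ξ|²}` is Lipschitz in `s` with constant `πρ²`. The
factor `‖w‖` on the right is what later makes the cross term in the product rule negligible. -/
theorem norm_evolvedPairing_sub_le (hφ : MemLp φ 2) {ρ : ℝ} (hρ : ∀ ξ, φ ξ ≠ 0 → ‖ξ‖ ≤ ρ)
    (s s₀ : ℝ) (w : L2Space d) :
    ‖evolvedPairing φ s w - evolvedPairing φ s₀ w‖ ≤
      Real.pi * ρ ^ 2 * |s - s₀| * √(∫ ξ, ‖φ ξ‖ ^ 2) * ‖w‖ := by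
  have hpi := Real.pi_pos
  have e : evolvedPairing φ s w - evolvedPairing φ s₀ w =
      ∫ ξ, (complexGaussian (-(Complex.I * s)) ξ * φ ξ -
        complexGaussian (-(Complex.I * s₀)) ξ * φ ξ) * w ξ := by
    unfold evolvedPairing
    refine (integral_sub ((memLp_evolved hφ s).integrable_mul (Lp.memLp w))
      ((memLp_evolved hφ s₀).integrable_mul (Lp.memLp w))).symm.trans ?_
    simp only [sub_mul, Pi.mul_apply]
  rw [e]
  refine (norm_integral_mul_le ((memLp_evolved hφ s).sub (memLp_evolved hφ s₀)) w).trans ?_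
  gcongr
  rw [← Real.sqrt_sq (by positivity : 0 ≤ Real.pi * ρ ^ 2 * |s - s₀|),
    ← Real.sqrt_mul (by positivity), ← integral_const_mul]
  refine Real.sqrt_le_sqrt (integral_mono_of_nonneg
    (Filter.Eventually.of_forall fun ξ => by positivity)
    (((memLp_two_iff_integrable_sq_norm hφ.aestronglyMeasurable).1 hφ).const_mul _)
    (Filter.Eventually.of_forall fun ξ => ?_))
  simp only [Pi.sub_apply]
  rw [← sub_mul, norm_mul, mul_pow]
  by_cases h0 : φ ξ = 0
  · simp [h0]
  · have h1 := norm_complexGaussian_sub_le s s₀ ξ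
    have h2 := hρ ξ h0
    gcongr
    refine h1.trans ?_
    gcongr

theorem hasDerivAt_evolvedPairing_left (hφ : MemLp φ 2) {ρ : ℝ}
    (hρ : ∀ ξ, φ ξ ≠ 0 → ‖ξ‖ ≤ ρ) (s₀ : ℝ) (w : L2Space d) :
    HasDerivAt (fun s => evolvedPairing φ s w)
      (Complex.I * Real.pi *
        ∫ ξ, ((‖ξ‖ : ℂ) ^ 2 * (complexGaussian (-(Complex.I * s₀)) ξ * φ ξ)) * w ξ) s₀ := by
  have hpi := Real.pi_pos
  have hm : ∀ s : ℝ, AEStronglyMeasurable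
      (fun ξ => (complexGaussian (-(Complex.I * s)) ξ * φ ξ) * w ξ) volume := fun s =>
    ((memLp_evolved hφ s).aestronglyMeasurable).mul (Lp.aestronglyMeasurable w)
  have h := (hasDerivAt_integral_of_dominated_loc_of_deriv_le (μ := volume) (x₀ := s₀)
    (F := fun s ξ => (complexGaussian (-(Complex.I * (s : ℝ))) ξ * φ ξ) * w ξ)
    (F' := fun s ξ => (Complex.I * Real.pi * (‖ξ‖ : ℂ) ^ 2 *
      complexGaussian (-(Complex.I * (s : ℝ))) ξ) * φ ξ * w ξ)
    (bound := fun ξ => Real.pi * ρ ^ 2 * ‖φ ξ * w ξ‖) (s := univ) Filter.univ_mem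
    (Filter.Eventually.of_forall hm) ((memLp_evolved hφ s₀).integrable_mul (Lp.memLp w)) ?_ ?_
    ((hφ.integrable_mul (Lp.memLp w)).norm.const_mul _) ?_).2
  · rw [← integral_const_mul]
    have e : ∀ ξ, Complex.I * Real.pi *
        (((‖ξ‖ : ℂ) ^ 2 * (complexGaussian (-(Complex.I * s₀)) ξ * φ ξ)) * w ξ) =
        (Complex.I * Real.pi * (‖ξ‖ : ℂ) ^ 2 *
          complexGaussian (-(Complex.I * s₀)) ξ) * φ ξ * w ξ := fun ξ => by ring
    simp_rw [e]
    exact h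
  · have hc : Continuous fun ξ : EuclideanSpace ℝ (Fin d) => Complex.I * Real.pi * (‖ξ‖ : ℂ) ^ 2 *
        complexGaussian (-(Complex.I * s₀)) ξ := by
      have := continuous_complexGaussian (d := d) (-(Complex.I * s₀))
      fun_prop
    exact (hc.aestronglyMeasurable.mul hφ.aestronglyMeasurable).mul (Lp.aestronglyMeasurable w)
  · refine Filter.Eventually.of_forall fun ξ s _ => ?_
    by_cases h0 : φ ξ = 0
    · simp [h0]
    rw [mul_assoc, norm_mul]
    gcongr
    rw [norm_mul, norm_mul, norm_mul, Complex.norm_I, one_mul, norm_pow, Complex.norm_real,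
      Complex.norm_real, Real.norm_of_nonneg hpi.le, norm_norm]
    calc Real.pi * ‖ξ‖ ^ 2 * ‖complexGaussian (-(Complex.I * s)) ξ‖ ≤ Real.pi * ‖ξ‖ ^ 2 * 1 := by
          gcongr
          exact norm_complexGaussian_le_one (re_neg_I_mul s).ge ξ
      _ ≤ Real.pi * ρ ^ 2 := by
          rw [mul_one]
          gcongr
          exact hρ ξ h0
  · refine Filter.Eventually.of_forall fun ξ s _ => ?_
    exact ((hasDerivAt_complexGaussian s ξ).mul_const (φ ξ)).mul_const (w ξ)

/-- A product rule: the derivative of the phase contributes `+iπ|ξ|²`, the equation contributes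
`-iπ|ξ|²`, and the two cancel. -/
theorem hasDerivAt_evolvedPairing (h : IsFreeSchrodingerSolution v₀ v)
    (hs : ContDiff ℝ (↑(⊤ : ℕ∞)) φ) (hc : HasCompactSupport φ) {s₀ : ℝ} (hs₀ : 0 < s₀) :
    HasDerivAt (fun s => evolvedPairing φ s (𝓕 (v s))) 0 s₀ := by
  have hφ : MemLp φ 2 := hs.continuous.memLp_of_hasCompactSupport hc
  obtain ⟨ρ, hρ⟩ := hc.isCompact.isBounded.subset_closedBall 0
  have hρ' : ∀ ξ, φ ξ ≠ 0 → ‖ξ‖ ≤ ρ := fun ξ hξ =>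
    mem_closedBall_zero_iff.1 (hρ (subset_tsupport φ hξ))
  have hψs : ContDiff ℝ (↑(⊤ : ℕ∞)) fun ξ => complexGaussian (-(Complex.I * s₀)) ξ * φ ξ :=
    (contDiff_complexGaussian _).mul hs
  have hψc : HasCompactSupport fun ξ => complexGaussian (-(Complex.I * s₀)) ξ * φ ξ :=
    hc.mul_left
  have ha := h.hasDerivAt_fourier (hψc.toSchwartzMap hψs) hs₀
  have hb := hasDerivAt_evolvedPairing_left hφ hρ' s₀ (𝓕 (v s₀))
  -- The cross term of the product rule. The solution is only continuous in `L²` and only weakly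
  -- differentiable, but this term is at most a constant times `|s - s₀| ‖𝓕 (v s) - 𝓕 (v s₀)‖`,
  -- hence `o(s - s₀)`.
  have hcd : HasDerivAt (fun s => evolvedPairing φ s (𝓕 (v s) - 𝓕 (v s₀)) -
      evolvedPairing φ s₀ (𝓕 (v s) - 𝓕 (v s₀))) 0 s₀ := by
    rw [hasDerivAt_iff_isLittleO]
    have hv : Filter.Tendsto (fun s => Real.pi * ρ ^ 2 * √(∫ ξ, ‖φ ξ‖ ^ 2) *
        ‖(𝓕 (v s) - 𝓕 (v s₀) : L2Space d)‖) (nhds s₀) (nhds 0) := by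
      have h1 : ContinuousAt v s₀ := h.continuousOn.continuousAt (Ici_mem_nhds hs₀)
      have h2 : ContinuousAt (fun s => (𝓕 (v s) : L2Space d)) s₀ :=
        (Lp.fourierTransformₗᵢ (EuclideanSpace ℝ (Fin d)) ℂ).continuous.continuousAt.comp h1
      have h3 := ((h2.tendsto.sub_const (𝓕 (v s₀))).norm).const_mul
        (Real.pi * ρ ^ 2 * √(∫ ξ, ‖φ ξ‖ ^ 2))
      simpa using h3
    refine (Asymptotics.isLittleO_iff).2 fun c hc0 => ?_
    filter_upwards [hv.eventually (gt_mem_nhds hc0)] with s hsc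
    simp only [sub_self, smul_zero, sub_zero]
    refine (norm_evolvedPairing_sub_le hφ hρ' s s₀ _).trans ?_
    rw [Real.norm_eq_abs]
    nlinarith [abs_nonneg (s - s₀)]
  have hsum := (ha.add hb).add hcd
  have hd0 : (-(Complex.I * Real.pi) * ∫ ξ, ((‖ξ‖ : ℂ) ^ 2 * (hψc.toSchwartzMap hψs) ξ) *
        (𝓕 (v s₀) : L2Space d) ξ) + (Complex.I * Real.pi *
        ∫ ξ, ((‖ξ‖ : ℂ) ^ 2 * (complexGaussian (-(Complex.I * s₀)) ξ * φ ξ)) *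
          (𝓕 (v s₀) : L2Space d) ξ) + 0 = 0 := by
    simp
  rw [hd0] at hsum
  have hsum' := hsum.sub_const (evolvedPairing φ s₀ (𝓕 (v s₀)))
  refine hsum'.congr_of_eventuallyEq (Filter.Eventually.of_forall fun s => ?_)
  simp only [Pi.add_apply]
  rw [evolvedPairing_sub hφ, evolvedPairing_sub hφ]
  have e : ∫ ξ, (hψc.toSchwartzMap hψs) ξ * (𝓕 (v s) : L2Space d) ξ =
      evolvedPairing φ s₀ (𝓕 (v s)) := rfl
  rw [e]
  ring

/-- The pairing has zero derivative on the open half-line, hence is constant there. The equation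
says nothing at time 0, so the initial value enters through the limit as `s` decreases to 0. -/
theorem evolvedPairing_eq (h : IsFreeSchrodingerSolution v₀ v)
    (hs : ContDiff ℝ (↑(⊤ : ℕ∞)) φ) (hc : HasCompactSupport φ) {t : ℝ} (ht : 0 < t) :
    evolvedPairing φ t (𝓕 (v t)) = evolvedPairing φ 0 (𝓕 v₀) := by
  have hφ : MemLp φ 2 := hs.continuous.memLp_of_hasCompactSupport hc
  obtain ⟨ρ, hρ⟩ := hc.isCompact.isBounded.subset_closedBall 0
  have hρ' : ∀ ξ, φ ξ ≠ 0 → ‖ξ‖ ≤ ρ := fun ξ hξ =>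
    mem_closedBall_zero_iff.1 (hρ (subset_tsupport φ hξ))
  have hconst : ∀ s ∈ Ioi (0 : ℝ), evolvedPairing φ s (𝓕 (v s)) =
      evolvedPairing φ t (𝓕 (v t)) := by
    intro s hs0
    have := (convex_Ioi (0 : ℝ)).norm_image_sub_le_of_norm_hasDerivWithin_le (C := 0)
      (f := fun s => evolvedPairing φ s (𝓕 (v s))) (f' := fun _ => 0)
      (fun x hx => (hasDerivAt_evolvedPairing h hs hc hx).hasDerivWithinAt)
      (fun x _ => by simp) (show t ∈ Ioi (0 : ℝ) from ht) hs0
    rw [zero_mul, norm_le_zero_iff, sub_eq_zero] at this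
    exact this
  have hlim : Filter.Tendsto (fun s => evolvedPairing φ s (𝓕 (v s))) (nhdsWithin 0 (Ioi 0))
      (nhds (evolvedPairing φ 0 (𝓕 v₀))) := by
    rw [tendsto_iff_norm_sub_tendsto_zero]
    have hv : Filter.Tendsto v (nhdsWithin 0 (Ioi 0)) (nhds v₀) := by
      have := (h.continuousOn 0 (by simp)).tendsto
      rw [h.initial] at this
      exact this.mono_left (nhdsWithin_mono _ Ioi_subset_Ici_self)
    have hV : Filter.Tendsto (fun s => (𝓕 (v s) : L2Space d)) (nhdsWithin 0 (Ioi 0))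
        (nhds (𝓕 v₀)) :=
      ((Lp.fourierTransformₗᵢ (EuclideanSpace ℝ (Fin d)) ℂ).continuous.tendsto v₀).comp hv
    have h1 : Filter.Tendsto (fun s => √(∫ ξ, ‖φ ξ‖ ^ 2) * ‖(𝓕 (v s) - 𝓕 v₀ : L2Space d)‖)
        (nhdsWithin 0 (Ioi 0)) (nhds 0) := by
      simpa using ((hV.sub_const (𝓕 v₀)).norm).const_mul (√(∫ ξ, ‖φ ξ‖ ^ 2))
    have h2 : Filter.Tendsto (fun s : ℝ => Real.pi * ρ ^ 2 * |s - 0| * √(∫ ξ, ‖φ ξ‖ ^ 2) *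
        ‖(𝓕 v₀ : L2Space d)‖) (nhdsWithin 0 (Ioi 0)) (nhds 0) := by
      have : Continuous fun s : ℝ => Real.pi * ρ ^ 2 * |s - 0| * √(∫ ξ, ‖φ ξ‖ ^ 2) *
        ‖(𝓕 v₀ : L2Space d)‖ := by fun_prop
      have h3 := this.tendsto 0
      simp only [sub_self, abs_zero, mul_zero, zero_mul] at h3
      exact h3.mono_left nhdsWithin_le_nhds
    have h12 := h1.add h2
    rw [add_zero] at h12
    refine squeeze_zero (fun s => norm_nonneg _) (fun s => ?_) h12
    have e : evolvedPairing φ s (𝓕 (v s)) - evolvedPairing φ 0 (𝓕 v₀) =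
        evolvedPairing φ s (𝓕 (v s) - 𝓕 v₀) +
          (evolvedPairing φ s (𝓕 v₀) - evolvedPairing φ 0 (𝓕 v₀)) := by
      rw [evolvedPairing_sub hφ]
      ring
    rw [e]
    exact (norm_add_le _ _).trans (add_le_add (norm_evolvedPairing_le hφ s _)
      (norm_evolvedPairing_sub_le hφ hρ' s 0 _))
  refine tendsto_nhds_unique (tendsto_const_nhds.congr' ?_) hlim
  filter_upwards [self_mem_nhdsWithin] with s hs0
  exact (hconst s hs0).symm

end Pairing

/-- The conserved pairings against all test functions determine `e^{iπt|ξ|²} 𝓕 (v t)` almost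
everywhere; the unimodular factor is then inverted. -/
theorem IsFreeSchrodingerSolution.fourier_eq {v₀ : L2Space d} {v : ℝ → L2Space d}
    (h : IsFreeSchrodingerSolution v₀ v) {t : ℝ} (ht : 0 < t) :
    𝓕 (v t) = gaussianMul (Complex.I * t) (re_I_mul t).ge (𝓕 v₀) := by
  have key : ∀ᵐ ξ, complexGaussian (-(Complex.I * t)) ξ * (𝓕 (v t) : L2Space d) ξ =
      (𝓕 v₀ : L2Space d) ξ := by
    refine ae_eq_of_integral_contDiff_smul_eq
      ((memLp_complexGaussian_mul (re_neg_I_mul t).ge (Lp.memLp (𝓕 (v t)))).locallyIntegrable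
        one_le_two) ((Lp.memLp _).locallyIntegrable one_le_two) fun g hg hgs => ?_
    have hg₁ : HasCompactSupport (Complex.ofRealCLM ∘ g) := hgs.comp_left rfl
    have hg₂ : ContDiff ℝ (↑(⊤ : ℕ∞)) (Complex.ofRealCLM ∘ g) := by fun_prop
    have := evolvedPairing_eq h hg₂ hg₁ ht
    unfold evolvedPairing at this
    convert this using 3
    · simp
      ring
    · simp [complexGaussian]
  refine Lp.ext ?_
  filter_upwards [key, coeFn_gaussianMul (re_I_mul t).ge (𝓕 v₀)] with ξ h1 h2
  rw [h2, ← h1, ← mul_assoc, complexGaussian, complexGaussian, ← Complex.exp_add]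
  have : -(Real.pi * (Complex.I * t)) * (‖ξ‖ : ℂ) ^ 2 +
      -(Real.pi * -(Complex.I * t)) * (‖ξ‖ : ℂ) ^ 2 = 0 := by ring
  rw [this, Complex.exp_zero, one_mul]

theorem IsFreeSchrodingerSolution.eq_gaussianPropagator {v₀ : L2Space d} {v : ℝ → L2Space d}
    (h : IsFreeSchrodingerSolution v₀ v) {t : ℝ} (ht : 0 < t) :
    v t = gaussianPropagator (Complex.I * t) (re_I_mul t).ge v₀ := by
  rw [gaussianPropagator_apply, ← h.fourier_eq ht]
  exact (FourierTransform.fourierInv_fourier_eq _).symm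

end SchrodingerUniqueness

/-! ### Monotonicity and equimeasurability of the rearrangement. -/

section Rearrangement

variable {d : ℕ}

theorem volume_real_unitBall_pos :
    0 < volume.real (ball (0 : EuclideanSpace ℝ (Fin d)) 1) :=
  ENNReal.toReal_pos (measure_ball_pos _ _ one_pos).ne' measure_ball_lt_top.ne

theorem volume_real_ball_eq (hd : d ≠ 0) {r : ℝ} (hr : 0 ≤ r) :
    volume.real (ball (0 : EuclideanSpace ℝ (Fin d)) r) =
      r ^ d * volume.real (ball (0 : EuclideanSpace ℝ (Fin d)) 1) := by
  have : Nonempty (Fin d) := ⟨⟨0, Nat.pos_of_ne_zero hd⟩⟩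
  rw [measureReal_def, Measure.addHaar_ball _ _ hr, finrank_euclideanSpace_fin, ENNReal.toReal_mul,
    ENNReal.toReal_ofReal (by positivity), measureReal_def]

theorem measureReal_level_le (f : L2Space d) {s : ℝ} (hs : 0 < s) :
    volume.real {y | s < ‖f y‖} ≤ ‖f‖ ^ 2 / s ^ 2 := by
  rw [le_div_iff₀ (by positivity), mul_comm, L2Space.norm_sq_eq]
  refine le_trans ?_ (mul_meas_ge_le_integral_of_nonneg
    (Filter.Eventually.of_forall fun x => by positivity) (L2Space.integrable_norm_sq f) (s ^ 2))
  gcongr ?_ * ?_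
  refine measureReal_mono (fun y hy => ?_) ?_
  · have : s < ‖f y‖ := hy
    show s ^ 2 ≤ ‖f y‖ ^ 2
    gcongr
  · exact ((L2Space.integrable_norm_sq f).measure_ge_lt_top (by positivity)).ne

theorem tendsto_symmRadius_level (hd : d ≠ 0) (f : L2Space d) :
    Filter.Tendsto (fun s : ℝ => symmRadius {y | s < ‖f y‖}) Filter.atTop (nhds 0) := by
  have h1 : Filter.Tendsto (fun s : ℝ => volume.real {y | s < ‖f y‖}) Filter.atTop (nhds 0) := by
    refine squeeze_zero' (Filter.Eventually.of_forall fun s => measureReal_nonneg)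
      ((Filter.eventually_gt_atTop 0).mono fun s hs => measureReal_level_le f hs) ?_
    exact tendsto_const_nhds.div_atTop (Filter.tendsto_pow_atTop two_ne_zero)
  have hd' : (0 : ℝ) < 1 / d := by positivity
  have h2 := (h1.div_const (volume.real (ball (0 : EuclideanSpace ℝ (Fin d)) 1))).rpow_const
    (p := 1 / (d : ℝ)) (Or.inr hd'.le)
  rwa [zero_div, Real.zero_rpow hd'.ne'] at h2

/-- The radii of the level balls tend to 0, so a point off the origin leaves them at a finite
height. At the origin the layer-cake integral diverges when `f` is essentially unbounded, and the
Bochner integral then takes the default value 0. This is why `x ≠ 0` is carried through the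
pointwise statements on `symmRearr`. -/
theorem integrableOn_level_indicator (hd : d ≠ 0) (f : L2Space d)
    {x : EuclideanSpace ℝ (Fin d)} (hx : x ≠ 0) :
    IntegrableOn (fun s : ℝ => (symmRearrSet {y | s < ‖f y‖}).indicator (fun _ => (1 : ℝ)) x)
      (Ioi 0) := by
  obtain ⟨M, hM⟩ := Filter.eventually_atTop.1
    ((tendsto_symmRadius_level hd f).eventually (gt_mem_nhds (norm_pos_iff.2 hx)))
  have hanti : AntitoneOn
      (fun s : ℝ => (symmRearrSet {y | s < ‖f y‖}).indicator (fun _ => (1 : ℝ)) x) (Ioi 0) := by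
    intro s hs t _ hst
    exact indicator_le_indicator_of_subset (ball_subset_ball (symmRadius_anti f hs hst))
      (fun _ => zero_le_one) x
  have hb : IntegrableOn ((Ioc 0 M).indicator fun _ => (1 : ℝ)) (Ioi (0 : ℝ)) :=
    ((integrable_indicator_iff measurableSet_Ioc).2
      (integrableOn_const measure_Ioc_lt_top.ne)).integrableOn
  refine Integrable.mono' hb
    (aemeasurable_restrict_of_antitoneOn measurableSet_Ioi hanti).aestronglyMeasurable
    ((ae_restrict_iff' measurableSet_Ioi).2 (Filter.Eventually.of_forall fun s hs => ?_))
  rw [Real.norm_of_nonneg (indicator_nonneg (fun _ _ => zero_le_one) x)]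
  by_cases hsM : s ≤ M
  · rw [indicator_of_mem (show s ∈ Ioc 0 M from ⟨hs, hsM⟩)]
    exact indicator_le_self' (fun _ _ => zero_le_one) x
  · rw [indicator_of_notMem]
    · exact indicator_nonneg (fun _ _ => zero_le_one) s
    · intro hmem
      have h1 : ‖x‖ < symmRadius {y | s < ‖f y‖} := mem_ball_zero_iff.1 hmem
      exact lt_asymm h1 (hM s (not_le.1 hsM).le)

theorem symmRearr_anti (hd : d ≠ 0) (f : L2Space d) {x y : EuclideanSpace ℝ (Fin d)}
    (hx : x ≠ 0) (hxy : ‖x‖ ≤ ‖y‖) : symmRearr f y ≤ symmRearr f x := by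
  refine integral_mono_of_nonneg
    (Filter.Eventually.of_forall fun s => indicator_nonneg (fun _ _ => zero_le_one) y)
    (integrableOn_level_indicator hd f hx) (Filter.Eventually.of_forall fun s => ?_)
  by_cases hy : y ∈ symmRearrSet {y | s < ‖f y‖}
  · have hxm : x ∈ symmRearrSet {y | s < ‖f y‖} :=
      mem_ball_zero_iff.2 (hxy.trans_lt (mem_ball_zero_iff.1 hy))
    simp [indicator_of_mem hy, indicator_of_mem hxm]
  · simp only [indicator_of_notMem hy]
    exact indicator_nonneg (fun _ _ => zero_le_one) x

theorem le_symmRearr (hd : d ≠ 0) (f : L2Space d) {x : EuclideanSpace ℝ (Fin d)} (hx : x ≠ 0)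
    {s : ℝ} (hs : 0 < s) (hxs : ‖x‖ < symmRadius {y | s < ‖f y‖}) : s ≤ symmRearr f x := by
  have h1 : ∫ t in Ioi (0 : ℝ), (Ioc 0 s).indicator (fun _ => (1 : ℝ)) t = s := by
    rw [setIntegral_indicator measurableSet_Ioc,
      inter_eq_self_of_subset_right Ioc_subset_Ioi_self]
    simp [hs.le]
  rw [← h1]
  refine integral_mono_of_nonneg
    (Filter.Eventually.of_forall fun t => indicator_nonneg (fun _ _ => zero_le_one) t)
    (integrableOn_level_indicator hd f hx) (Filter.Eventually.of_forall fun t => ?_)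
  by_cases ht : t ∈ Ioc 0 s
  · have hxm : x ∈ symmRearrSet {y | t < ‖f y‖} :=
      mem_ball_zero_iff.2 (hxs.trans_le (symmRadius_anti f ht.1 ht.2))
    simp [indicator_of_mem ht, indicator_of_mem hxm]
  · simp only [indicator_of_notMem ht]
    exact indicator_nonneg (fun _ _ => zero_le_one) x

/-- Strictness comes from continuity from below: the levels `s + 1/(n+1)` exhaust `{|f| > s}`, so
their radii converge to that of level `s`, and `x` already lies in the ball of a slightly higher
level. -/
theorem lt_symmRearr (hd : d ≠ 0) (f : L2Space d) {x : EuclideanSpace ℝ (Fin d)} (hx : x ≠ 0)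
    {s : ℝ} (hs : 0 < s) (hxs : ‖x‖ < symmRadius {y | s < ‖f y‖}) : s < symmRearr f x := by
  have hU : {y | s < ‖f y‖} = ⋃ n : ℕ, {y | s + 1 / ((n : ℝ) + 1) < ‖f y‖} := by
    ext y
    simp only [mem_iUnion, mem_ofPred_eq]
    constructor
    · intro h
      obtain ⟨n, hn⟩ := exists_nat_one_div_lt (sub_pos.2 h)
      exact ⟨n, by linarith⟩
    · rintro ⟨n, hn⟩
      have : (0 : ℝ) < 1 / ((n : ℝ) + 1) := by positivity
      linarith
  have hmono : Monotone fun n : ℕ => {y | s + 1 / ((n : ℝ) + 1) < ‖f y‖} := by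
    intro m n hmn y hy
    have : (1 : ℝ) / ((n : ℝ) + 1) ≤ 1 / ((m : ℝ) + 1) := by gcongr
    have hy' : s + 1 / ((m : ℝ) + 1) < ‖f y‖ := hy
    show s + 1 / ((n : ℝ) + 1) < ‖f y‖
    linarith
  have ht : Filter.Tendsto (fun n : ℕ => volume.real {y | s + 1 / ((n : ℝ) + 1) < ‖f y‖})
      Filter.atTop (nhds (volume.real {y | s < ‖f y‖})) := by
    have h := tendsto_measure_iUnion_atTop (μ := volume) hmono
    rw [← hU] at h
    exact (ENNReal.tendsto_toReal (volume_level_ne_top f hs)).comp h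
  have ht2 : Filter.Tendsto (fun n : ℕ => symmRadius {y | s + 1 / ((n : ℝ) + 1) < ‖f y‖})
      Filter.atTop (nhds (symmRadius {y | s < ‖f y‖})) :=
    (ht.div_const _).rpow_const (Or.inr (by positivity))
  obtain ⟨n, hn⟩ := (ht2.eventually (lt_mem_nhds hxs)).exists
  have h0 : (0 : ℝ) < 1 / ((n : ℝ) + 1) := by positivity
  exact (lt_add_of_pos_right s h0).trans_le (le_symmRearr hd f hx (by positivity) hn)

theorem volume_level_symmRearr (hd : d ≠ 0) (f : L2Space d) {s : ℝ} (hs : 0 < s) :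
    volume {x | s < symmRearr f x} = volume {y | s < ‖f y‖} := by
  have : Nonempty (Fin d) := ⟨⟨0, Nat.pos_of_ne_zero hd⟩⟩
  rw [← volume_symmRearrSet hd (volume_level_ne_top f hs)]
  refine le_antisymm (measure_mono (level_symmRearr_subset f hs)) ?_
  rw [← measure_sdiff_null (measure_singleton (0 : EuclideanSpace ℝ (Fin d)))]
  exact measure_mono fun x hx => lt_symmRearr hd f hx.2 hs (mem_ball_zero_iff.1 hx.1)

theorem measurable_symmRearr (f : L2Space d) : Measurable (symmRearr f) :=
  (stronglyMeasurable_symmRearr f).measurable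

/-- By the layer-cake formula both sides depend only on the measures of the levels above `c`, which
agree. -/
theorem lintegral_sub_symmRearr (hd : d ≠ 0) (f : L2Space d) {c : ℝ} (hc : 0 ≤ c) :
    ∫⁻ x, ENNReal.ofReal (max (‖f x‖ - c) 0) = ∫⁻ x, ENNReal.ofReal (max (symmRearr f x - c) 0) := by
  have hm := measurable_symmRearr f
  have hf := (Lp.stronglyMeasurable f).measurable
  have h0 : ∀ u : EuclideanSpace ℝ (Fin d) → ℝ, ∀ᵐ x, 0 ≤ max (u x - c) 0 := fun u =>
    Filter.Eventually.of_forall fun x => le_max_right _ _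
  rw [lintegral_eq_lintegral_meas_lt volume (h0 fun x => ‖f x‖) (by fun_prop),
    lintegral_eq_lintegral_meas_lt volume (h0 (symmRearr f)) (by fun_prop)]
  refine setLIntegral_congr_fun measurableSet_Ioi fun s hs => ?_
  have hs' : (0 : ℝ) < s := hs
  have e : ∀ a : ℝ, s < max (a - c) 0 ↔ s + c < a := fun a => by
    rw [lt_max_iff, lt_sub_iff_add_lt]
    exact or_iff_left (not_lt.2 hs'.le)
  simp only [e]
  exact (volume_level_symmRearr hd f (by positivity)).symm

theorem lintegral_min_symmRearr (hd : d ≠ 0) (f : L2Space d) {c : ℝ} (hc : 0 ≤ c) :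
    ∫⁻ x, ENNReal.ofReal (min ‖f x‖ c ^ (2 : ℝ)) =
      ∫⁻ x, ENNReal.ofReal (min (symmRearr f x) c ^ (2 : ℝ)) := by
  have hm := measurable_symmRearr f
  have hf := (Lp.stronglyMeasurable f).measurable
  rw [lintegral_rpow_eq_lintegral_meas_lt_mul _
      (Filter.Eventually.of_forall fun x => le_min (norm_nonneg _) hc) (by fun_prop) two_pos,
    lintegral_rpow_eq_lintegral_meas_lt_mul _
      (Filter.Eventually.of_forall fun x => le_min (symmRearr_nonneg _ _) hc) (by fun_prop) two_pos]
  congr 1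
  refine setLIntegral_congr_fun measurableSet_Ioi fun s hs => ?_
  have hs' : (0 : ℝ) < s := hs
  simp only [lt_min_iff]
  by_cases hsc : s < c
  · simp only [hsc, and_true]
    rw [volume_level_symmRearr hd f hs']
  · simp [hsc]

theorem memLp_symmRearr_real (f : L2Space d) : MemLp (symmRearr f) 2 := by
  have h := (memLp_symmRearr f).norm
  refine h.ae_eq (Filter.Eventually.of_forall fun x => ?_)
  simp [abs_of_nonneg (symmRearr_nonneg f x)]

theorem integrableOn_symmRearr_ball (f : L2Space d) (r : ℝ) :
    IntegrableOn (symmRearr f) (ball 0 r) := by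
  have : IsFiniteMeasure (volume.restrict (ball (0 : EuclideanSpace ℝ (Fin d)) r)) :=
    ⟨by rw [Measure.restrict_apply_univ]; exact measure_ball_lt_top⟩
  exact ((memLp_symmRearr_real f).restrict _).integrable one_le_two

theorem integrable_symmRearr_sq (f : L2Space d) : Integrable fun x => symmRearr f x ^ 2 :=
  (memLp_symmRearr_real f).integrable_sq

/-- After passing to the rearrangement, `(f* - c)_+` vanishes outside the ball of radius `r` and is
at most `f*` inside it. -/
theorem integral_sub_symmRearr_le (hd : d ≠ 0) (f : L2Space d) {c r : ℝ} (hc : 0 ≤ c)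
    (h : ∀ x, r ≤ ‖x‖ → symmRearr f x ≤ c) :
    Integrable (fun x => max (‖f x‖ - c) 0) ∧
      ∫ x, max (‖f x‖ - c) 0 ≤ ∫ x in ball 0 r, symmRearr f x := by
  have hm := measurable_symmRearr f
  have hf := (Lp.stronglyMeasurable f).measurable
  have h1 : ∫⁻ x, ENNReal.ofReal (max (‖f x‖ - c) 0) ≤
      ENNReal.ofReal (∫ x in ball 0 r, symmRearr f x) := by
    rw [lintegral_sub_symmRearr hd f hc, ofReal_integral_eq_lintegral_ofReal
      (integrableOn_symmRearr_ball f r)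
      (Filter.Eventually.of_forall fun x => symmRearr_nonneg f x),
      ← lintegral_indicator measurableSet_ball]
    refine lintegral_mono fun x => ?_
    by_cases hx : x ∈ ball (0 : EuclideanSpace ℝ (Fin d)) r
    · rw [indicator_of_mem hx]
      exact ENNReal.ofReal_le_ofReal
        (max_le (by linarith) (symmRearr_nonneg f x))
    · rw [indicator_of_notMem hx]
      have := h x (by simpa using hx)
      rw [max_eq_right (by linarith)]
      simp
  have h0 : ∀ᵐ x, 0 ≤ max (‖f x‖ - c) 0 := Filter.Eventually.of_forall fun x => le_max_right _ _
  have hi : Integrable (fun x => max (‖f x‖ - c) 0) := by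
    refine ⟨by fun_prop, ?_⟩
    rw [hasFiniteIntegral_iff_ofReal h0]
    exact h1.trans_lt ENNReal.ofReal_lt_top
  refine ⟨hi, ?_⟩
  rw [← ofReal_integral_eq_lintegral_ofReal hi h0] at h1
  exact (ENNReal.ofReal_le_ofReal_iff (integral_nonneg fun x => symmRearr_nonneg f x)).1 h1

theorem integral_min_symmRearr (hd : d ≠ 0) (f : L2Space d) {c : ℝ} (hc : 0 ≤ c) :
    ∫ x, min ‖f x‖ c ^ 2 = ∫ x, min (symmRearr f x) c ^ 2 := by
  have hm := measurable_symmRearr f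
  have hf := (Lp.stronglyMeasurable f).measurable
  rw [integral_eq_lintegral_of_nonneg_ae (Filter.Eventually.of_forall fun x => sq_nonneg _)
      (by fun_prop),
    integral_eq_lintegral_of_nonneg_ae (Filter.Eventually.of_forall fun x => sq_nonneg _)
      (by fun_prop)]
  have := lintegral_min_symmRearr hd f hc
  simp only [Real.rpow_two] at this
  rw [this]

end Rearrangement

/-! ### Splitting at a height and interpolation between the two operator bounds. -/

section WeakType

variable {d : ℕ}

/-- `f₂` keeps the phase of `f` and truncates its modulus at `c`; the remainder `f₁` has modulus
`(|f| - c)_+`. -/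
theorem exists_truncation (hd : d ≠ 0) (f : L2Space d) {c r : ℝ} (hc : 0 ≤ c)
    (h : ∀ x, r ≤ ‖x‖ → symmRearr f x ≤ c) :
    ∃ f₁ f₂ : L2Space d, f = f₁ + f₂ ∧ Integrable f₁ ∧
      ∫ x, ‖f₁ x‖ ≤ ∫ x in ball 0 r, symmRearr f x ∧ ‖f₂‖ ^ 2 = ∫ x, min ‖f x‖ c ^ 2 := by
  have hf := (Lp.stronglyMeasurable f).measurable
  -- Where `f` vanishes the quotient is `0 / 0 = 0`, and the product is 0 as wanted.
  set q : EuclideanSpace ℝ (Fin d) → ℂ := fun x => ((min ‖f x‖ c / ‖f x‖ : ℝ) : ℂ) * f x with hq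
  have hqm : Measurable q := by fun_prop
  have hqn : ∀ x, ‖q x‖ = min ‖f x‖ c := by
    intro x
    rw [hq, norm_mul, Complex.norm_real, Real.norm_of_nonneg (by positivity)]
    by_cases h0 : ‖f x‖ = 0
    · simp [h0, hc]
    · field_simp
  have hpn : ∀ x, ‖f x - q x‖ = max (‖f x‖ - c) 0 := by
    intro x
    have e : f x - q x = ((1 - min ‖f x‖ c / ‖f x‖ : ℝ) : ℂ) * f x := by
      rw [hq]; push_cast; ring
    rw [e, norm_mul, Complex.norm_real]
    by_cases h0 : ‖f x‖ = 0
    · simp [h0, hc]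
    · have h1 : min ‖f x‖ c / ‖f x‖ ≤ 1 :=
        (div_le_one (by positivity)).2 (min_le_left _ _)
      rw [Real.norm_of_nonneg (by linarith), sub_mul, div_mul_cancel₀ _ h0, one_mul]
      rcases le_total ‖f x‖ c with h2 | h2
      · rw [min_eq_left h2, max_eq_right (by linarith), sub_self]
      · rw [min_eq_right h2, max_eq_left (by linarith)]
  have hq2 : MemLp q 2 := (Lp.memLp f).mono hqm.aestronglyMeasurable
    (Filter.Eventually.of_forall fun x => by rw [hqn]; exact min_le_left _ _)
  have hp2 : MemLp (fun x => f x - q x) 2 := (Lp.memLp f).sub hq2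
  have hc1 := hp2.coeFn_toLp
  obtain ⟨hi, hle⟩ := integral_sub_symmRearr_le hd f hc h
  have hpi : Integrable (fun x => f x - q x) := by
    refine (integrable_norm_iff hp2.aestronglyMeasurable).1 ?_
    simpa only [hpn] using hi
  refine ⟨hp2.toLp _, hq2.toLp _, ?_, (integrable_congr hc1).2 hpi, ?_, ?_⟩
  · refine Lp.ext ?_
    filter_upwards [Lp.coeFn_add (hp2.toLp _ : L2Space d) (hq2.toLp q), hc1, hq2.coeFn_toLp]
      with x h1 h2 h3
    rw [h1, Pi.add_apply, h2, h3]
    ring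
  · refine le_trans (integral_congr_ae ?_).le hle
    filter_upwards [hc1] with x hx
    rw [hx, hpn]
  · rw [norm_toLp_sq]
    simp_rw [hqn]

/-- An operator bounded on `L²` and from `L¹` to `L^∞` is controlled by the rearrangement. -/
theorem setIntegral_sq_le_of_weakType (hd : d ≠ 0) (T : L2Space d →ₗ[ℂ] L2Space d) {K : ℝ}
    (hT₂ : ∀ h, ‖T h‖ ≤ ‖h‖)
    (hT₁ : ∀ h : L2Space d, Integrable h → ∀ᵐ x, ‖T h x‖ ≤ K * ∫ y, ‖h y‖)
    (f : L2Space d) {A : Set (EuclideanSpace ℝ (Fin d))} (hA : volume A ≠ ∞) (hK : 0 ≤ K)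
    {c r : ℝ} (hc : 0 ≤ c) (h : ∀ x, r ≤ ‖x‖ → symmRearr f x ≤ c) :
    ∫ x in A, ‖T f x‖ ^ 2 ≤
      2 * (K ^ 2 * volume.real A * (∫ x in ball 0 r, symmRearr f x) ^ 2) +
        2 * ∫ x, min ‖f x‖ c ^ 2 := by
  obtain ⟨f₁, f₂, hf, hi, hle, hn⟩ := exists_truncation hd f hc h
  have hfin : IsFiniteMeasure (volume.restrict A) :=
    ⟨by rw [Measure.restrict_apply_univ]; exact hA.lt_top⟩
  set I := ∫ x in ball 0 r, symmRearr f x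
  -- The high part is bounded pointwise through `L¹ → L^∞`. The low part is kept and integrated
  -- below with the `L²` bound.
  have hae : ∀ᵐ x, ‖T f x‖ ^ 2 ≤ 2 * (K * I) ^ 2 + 2 * ‖T f₂ x‖ ^ 2 := by
    rw [hf, map_add]
    filter_upwards [Lp.coeFn_add (T f₁) (T f₂), hT₁ f₁ hi] with x h1 h2
    rw [h1, Pi.add_apply]
    have h3 : ‖T f₁ x‖ ≤ K * I := h2.trans (by gcongr)
    have h4 := norm_add_le (T f₁ x) (T f₂ x)
    have h5 : ‖T f₁ x + T f₂ x‖ ^ 2 ≤ (K * I + ‖T f₂ x‖) ^ 2 := by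
      gcongr
      linarith
    nlinarith [sq_nonneg (K * I - ‖T f₂ x‖)]
  have hi2 := L2Space.integrable_norm_sq (T f₂)
  calc ∫ x in A, ‖T f x‖ ^ 2 ≤ ∫ x in A, (2 * (K * I) ^ 2 + 2 * ‖T f₂ x‖ ^ 2) := by
        refine setIntegral_mono_ae (L2Space.integrable_norm_sq _).integrableOn ?_ hae
        exact (integrable_const _).add (hi2.integrableOn.const_mul 2)
    _ = 2 * (K * I) ^ 2 * volume.real A + 2 * ∫ x in A, ‖T f₂ x‖ ^ 2 := by
        rw [integral_add (integrable_const _) (hi2.integrableOn.const_mul 2), setIntegral_const,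
          integral_const_mul, smul_eq_mul, mul_comm (volume.real A)]
    _ ≤ 2 * (K * I) ^ 2 * volume.real A + 2 * ‖f₂‖ ^ 2 := by
        gcongr
        refine (setIntegral_le_integral hi2
          (Filter.Eventually.of_forall fun x => sq_nonneg _)).trans ?_
        rw [← L2Space.norm_sq_eq]
        have := hT₂ f₂
        gcongr
    _ = _ := by rw [hn]; ring

/-- The height is the value of `f*` on the sphere of radius `r`: by monotonicity it bounds `f*` from
above outside the ball and from below almost everywhere inside. -/
theorem exists_threshold (hd : d ≠ 0) (f : L2Space d) {r : ℝ} (hr : 0 < r) :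
    ∃ c, 0 ≤ c ∧ (∀ x, r ≤ ‖x‖ → symmRearr f x ≤ c) ∧
      c * volume.real (ball (0 : EuclideanSpace ℝ (Fin d)) r) ≤
        ∫ x in ball 0 r, symmRearr f x := by
  have : Nonempty (Fin d) := ⟨⟨0, Nat.pos_of_ne_zero hd⟩⟩
  obtain ⟨x₀, hx₀⟩ : ∃ x : EuclideanSpace ℝ (Fin d), ‖x‖ = r := exists_norm_eq _ hr.le
  have hx0 : x₀ ≠ 0 := fun h => by simp [h] at hx₀; exact hr.ne hx₀
  refine ⟨symmRearr f x₀, symmRearr_nonneg _ _, fun x hx =>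
    symmRearr_anti hd f hx0 (hx₀.trans_le hx), ?_⟩
  rw [mul_comm, ← smul_eq_mul, ← setIntegral_const]
  refine setIntegral_mono_on_ae (integrableOn_const measure_ball_lt_top.ne)
    (integrableOn_symmRearr_ball f r) measurableSet_ball ?_
  filter_upwards [compl_mem_ae_iff.2 (measure_singleton (0 : EuclideanSpace ℝ (Fin d)))]
    with x hx hxr
  exact symmRearr_anti hd f hx (by rw [hx₀]; exact (mem_ball_zero_iff.1 hxr).le)

/-- Inside the ball the integral is at most `c²|B_r|`, and `c|B_r| ≤ M` turns this into `M²/|B_r|`,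
with `M` the mass of `f*` in the ball. Outside, the truncation is simply dropped. -/
theorem integral_min_sq_le (hd : d ≠ 0) (f : L2Space d) {c r : ℝ} (hc : 0 ≤ c) (hr : 0 < r)
    (hcr : c * volume.real (ball (0 : EuclideanSpace ℝ (Fin d)) r) ≤
        ∫ x in ball 0 r, symmRearr f x) :
    ∫ x, min ‖f x‖ c ^ 2 ≤
      (volume.real (ball (0 : EuclideanSpace ℝ (Fin d)) r))⁻¹ *
        (∫ x in ball 0 r, symmRearr f x) ^ 2 + ∫ x in (ball 0 r)ᶜ, symmRearr f x ^ 2 := by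
  have hb : 0 < volume.real (ball (0 : EuclideanSpace ℝ (Fin d)) r) :=
    ENNReal.toReal_pos (measure_ball_pos _ _ hr).ne' measure_ball_lt_top.ne
  have hm := measurable_symmRearr f
  have hsq := integrable_symmRearr_sq f
  have hi : Integrable fun x => min (symmRearr f x) c ^ 2 := by
    refine hsq.mono' (by fun_prop) (Filter.Eventually.of_forall fun x => ?_)
    have h0 := symmRearr_nonneg f x
    rw [Real.norm_of_nonneg (by positivity)]
    gcongr
    exact min_le_left _ _
  rw [integral_min_symmRearr hd f hc, ← integral_add_compl measurableSet_ball hi]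
  refine add_le_add ?_ ?_
  · calc ∫ x in ball 0 r, min (symmRearr f x) c ^ 2 ≤
          ∫ _ in ball (0 : EuclideanSpace ℝ (Fin d)) r, c ^ 2 := by
          refine setIntegral_mono hi.integrableOn
            (integrableOn_const measure_ball_lt_top.ne) fun x => ?_
          have h0 := symmRearr_nonneg f x
          dsimp only
          gcongr
          exact min_le_right _ _
      _ = (volume.real (ball (0 : EuclideanSpace ℝ (Fin d)) r))⁻¹ *
            (c * volume.real (ball (0 : EuclideanSpace ℝ (Fin d)) r)) ^ 2 := by
          rw [setIntegral_const, smul_eq_mul]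
          field_simp
      _ ≤ _ := by gcongr
  · refine setIntegral_mono hi.integrableOn hsq.integrableOn fun x => ?_
    have h0 := symmRearr_nonneg f x
    dsimp only
    gcongr
    exact min_le_left _ _

/-- For the `L¹` estimates: bounded support replaces the `L²` tail of `f*`, which the Bochner-Riesz
integral is not used to control. -/
theorem integral_min_sq_le_of_support (f : L2Space d) {c S : ℝ} (hc : 0 ≤ c) (hS : 0 ≤ S)
    (hf : volume {x | f x ≠ 0} ≤ ENNReal.ofReal S) :
    ∫ x, min ‖f x‖ c ^ 2 ≤ S * c ^ 2 := by
  have hfm := (Lp.stronglyMeasurable f).measurable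
  have hset : MeasurableSet {x | f x ≠ 0} := (hfm (measurableSet_singleton 0)).compl
  have hlt : volume {x | f x ≠ 0} ≠ ∞ := (hf.trans_lt ENNReal.ofReal_lt_top).ne
  have h1 : volume.real {x | f x ≠ 0} ≤ S := ENNReal.toReal_le_of_le_ofReal hS hf
  calc ∫ x, min ‖f x‖ c ^ 2 ≤ ∫ x, {x | f x ≠ 0}.indicator (fun _ => c ^ 2) x := by
        refine integral_mono_of_nonneg (Filter.Eventually.of_forall fun x => sq_nonneg _)
          ((integrable_indicator_iff hset).2 (integrableOn_const hlt))
          (Filter.Eventually.of_forall fun x => ?_)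
        by_cases hx : f x = 0
        · simp [hx, hc]
        · simp only
          rw [indicator_of_mem (show x ∈ {x | f x ≠ 0} from hx)]
          have := norm_nonneg (f x)
          gcongr
          exact min_le_right _ _
    _ = volume.real {x | f x ≠ 0} * c ^ 2 := by
        rw [integral_indicator hset, setIntegral_const, smul_eq_mul]
    _ ≤ _ := by gcongr

end WeakType

/-! ### Lower bound for the low-frequency energy of a radially decreasing function. -/

section GaussianLowerBound

variable {d : ℕ}

/-- The real heat kernel: the Fourier transform of `exp (-π s |ξ|²)`. -/
noncomputable def heatKernel (s : ℝ) (x : EuclideanSpace ℝ (Fin d)) : ℝ :=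
  (1 / s) ^ ((d : ℝ) / 2) * Real.exp (-(Real.pi * (1 / s) * ‖x‖ ^ 2))

theorem continuous_heatKernel (s : ℝ) :
    Continuous (heatKernel s : EuclideanSpace ℝ (Fin d) → ℝ) := by
  unfold heatKernel
  fun_prop

theorem heatKernel_nonneg {s : ℝ} (hs : 0 < s) (x : EuclideanSpace ℝ (Fin d)) :
    0 ≤ heatKernel s x := by
  unfold heatKernel
  positivity

theorem heatKernel_le {s : ℝ} (hs : 0 < s) (x : EuclideanSpace ℝ (Fin d)) :
    heatKernel s x ≤ (1 / s) ^ ((d : ℝ) / 2) := by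
  unfold heatKernel
  refine mul_le_of_le_one_right (by positivity) (Real.exp_le_one_iff.2 ?_)
  have := Real.pi_pos
  rw [neg_nonpos]
  positivity

theorem complexGaussian_ofReal (s : ℝ) (ξ : EuclideanSpace ℝ (Fin d)) :
    complexGaussian (s : ℂ) ξ = ((Real.exp (-(Real.pi * s * ‖ξ‖ ^ 2)) : ℝ) : ℂ) := by
  rw [complexGaussian]
  push_cast
  congr 1
  ring

/-- Since `g` is real, the conjugate of `𝓕 g` is the transform of `x ↦ g (-x)`. Moving that
transform onto the Gaussian factor produces the heat kernel. -/
theorem integral_gaussian_mul_norm_fourier_sq {g : EuclideanSpace ℝ (Fin d) → ℝ}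
    (hg : Integrable g) {s : ℝ} (hs : 0 < s) :
    ∫ ξ, Real.exp (-(Real.pi * s * ‖ξ‖ ^ 2)) * ‖𝓕 (fun x => (g x : ℂ)) ξ‖ ^ 2 =
      ∫ x, g x * ∫ y, heatKernel s (x - y) * g y := by
  set G : EuclideanSpace ℝ (Fin d) → ℂ := fun x => (g x : ℂ) with hG
  have hGi : Integrable G := hg.ofReal
  have hsre : 0 < (s : ℂ).re := by simpa using hs
  set h : EuclideanSpace ℝ (Fin d) → ℂ := fun ξ => complexGaussian (s : ℂ) ξ * 𝓕 G ξ with hh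
  have hhi : Integrable h := (integrable_complexGaussian hsre).mul_bdd
    (continuous_fourier hGi).aestronglyMeasurable
    (Filter.Eventually.of_forall fun ξ => norm_fourier_le G ξ)
  have h1 := integral_fourier_mul_eq (f := fun x => G (-x)) (g := h) hGi.comp_neg hhi
  have hconj : ∀ ξ, 𝓕 (fun x => G (-x)) ξ = (starRingEnd ℂ) (𝓕 G ξ) := by
    intro ξ
    rw [← Real.fourierInv_eq_fourier_comp_neg, Real.fourierInv_eq', Real.fourier_eq',
      ← integral_conj]
    refine integral_congr_ae (Filter.Eventually.of_forall fun x => ?_)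
    simp only [smul_eq_mul, map_mul, hG, Complex.conj_ofReal, ← Complex.exp_conj, Complex.conj_I]
    congr 2
    push_cast
    ring
  have h2 : ∫ ξ, 𝓕 (fun x => G (-x)) ξ * h ξ =
      ((∫ ξ, Real.exp (-(Real.pi * s * ‖ξ‖ ^ 2)) * ‖𝓕 G ξ‖ ^ 2 : ℝ) : ℂ) := by
    rw [← integral_complex_ofReal]
    refine integral_congr_ae (Filter.Eventually.of_forall fun ξ => ?_)
    simp only [hconj, hh, complexGaussian_ofReal]
    rw [mul_left_comm, mul_comm ((starRingEnd ℂ) _), Complex.mul_conj, Complex.normSq_eq_norm_sq]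
    push_cast
    ring
  have h3 : ∫ x, G (-x) * 𝓕 h x = ((∫ x, g x * ∫ y, heatKernel s (x - y) * g y : ℝ) : ℂ) := by
    rw [← integral_neg_eq_self, ← integral_complex_ofReal]
    refine integral_congr_ae (Filter.Eventually.of_forall fun x => ?_)
    simp only [neg_neg]
    rw [← Real.fourierInv_eq_fourier_neg, hh, fourierInv_complexGaussian_mul_fourier hsre hGi,
      Complex.ofReal_mul, ← integral_complex_ofReal]
    congr 1
    refine integral_congr_ae (Filter.Eventually.of_forall fun y => ?_)
    simp only [hG, heatKernel]
    rw [show (1 : ℂ) / (s : ℂ) = ((1 / s : ℝ) : ℂ) by push_cast; rfl, complexGaussian_ofReal,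
      show ((d : ℂ) / 2) = (((d : ℝ) / 2 : ℝ) : ℂ) by push_cast; rfl,
      ← Complex.ofReal_cpow (by positivity)]
    push_cast
    ring
  rw [h2, h3] at h1
  exact_mod_cast h1

variable {g : EuclideanSpace ℝ (Fin d) → ℝ}

theorem integrable_heatKernel_mul (hg : Integrable g) {s : ℝ} (hs : 0 < s)
    (x : EuclideanSpace ℝ (Fin d)) : Integrable fun y => heatKernel s (x - y) * g y := by
  refine hg.bdd_mul (c := (1 / s) ^ ((d : ℝ) / 2)) ?_ (Filter.Eventually.of_forall fun y => ?_)
  · exact ((continuous_heatKernel s).comp (by fun_prop)).aestronglyMeasurable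
  · rw [Real.norm_of_nonneg (heatKernel_nonneg hs _)]
    exact heatKernel_le hs _

theorem integrable_mul_heatKernel_conv (hg : Integrable g) (hgm : Measurable g) {s : ℝ}
    (hs : 0 < s) : Integrable fun x => g x * ∫ y, heatKernel s (x - y) * g y := by
  have hm : StronglyMeasurable fun x => ∫ y, heatKernel s (x - y) * g y := by
    refine StronglyMeasurable.integral_prod_right' (ν := volume)
      (f := fun p : EuclideanSpace ℝ (Fin d) × EuclideanSpace ℝ (Fin d) =>
        heatKernel s (p.1 - p.2) * g p.2) ?_
    have h1 : Measurable fun p : EuclideanSpace ℝ (Fin d) × EuclideanSpace ℝ (Fin d) =>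
        heatKernel s (p.1 - p.2) :=
      (continuous_heatKernel s).measurable.comp (measurable_fst.sub measurable_snd)
    exact (h1.mul (hgm.comp measurable_snd)).stronglyMeasurable
  refine hg.mul_bdd (c := (1 / s) ^ ((d : ℝ) / 2) * ∫ y, ‖g y‖) hm.aestronglyMeasurable
    (Filter.Eventually.of_forall fun x => ?_)
  rw [← integral_const_mul]
  refine norm_integral_le_of_norm_le (hg.norm.const_mul _)
    (Filter.Eventually.of_forall fun y => ?_)
  rw [norm_mul, Real.norm_of_nonneg (heatKernel_nonneg hs _)]
  gcongr
  exact heatKernel_le hs _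

/-- At time `r²` the exponent at distance `2r` is `π · 4r² / r² = 4π`. -/
theorem le_heatKernel_of_norm_lt {r : ℝ} (hr : 0 < r) {x : EuclideanSpace ℝ (Fin d)}
    (hx : ‖x‖ ≤ 2 * r) : Real.exp (-(4 * Real.pi)) / r ^ d ≤ heatKernel (r ^ 2) x := by
  have h1 : (1 / r ^ 2) ^ ((d : ℝ) / 2) = 1 / r ^ d := by
    rw [Real.div_rpow zero_le_one (by positivity), Real.one_rpow, ← Real.rpow_natCast r 2,
      ← Real.rpow_mul hr.le]
    congr 1
    rw [show ((2 : ℕ) : ℝ) * ((d : ℝ) / 2) = d by push_cast; ring, Real.rpow_natCast]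
  rw [heatKernel, h1, div_eq_inv_mul, one_div]
  refine mul_le_mul_of_nonneg_left (Real.exp_le_exp.2 (neg_le_neg ?_)) (by positivity)
  have h2 : ‖x‖ ^ 2 ≤ 4 * r ^ 2 := by nlinarith [norm_nonneg x]
  calc Real.pi * (1 / r ^ 2) * ‖x‖ ^ 2 ≤ Real.pi * (1 / r ^ 2) * (4 * r ^ 2) := by
        have := Real.pi_pos
        gcongr
    _ = 4 * Real.pi := by field_simp

theorem le_heatKernel_conv (hg : Integrable g) (hg0 : ∀ x, 0 ≤ g x) {r : ℝ} (hr : 0 < r)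
    {x : EuclideanSpace ℝ (Fin d)} {B : Set (EuclideanSpace ℝ (Fin d))} (hB : MeasurableSet B)
    (h : ∀ y ∈ B, ‖x - y‖ ≤ 2 * r) :
    Real.exp (-(4 * Real.pi)) / r ^ d * ∫ y in B, g y ≤ ∫ y, heatKernel (r ^ 2) (x - y) * g y := by
  have hi := integrable_heatKernel_mul hg (show 0 < r ^ 2 by positivity) x
  rw [← integral_const_mul]
  calc ∫ y in B, Real.exp (-(4 * Real.pi)) / r ^ d * g y
      ≤ ∫ y in B, heatKernel (r ^ 2) (x - y) * g y :=
        setIntegral_mono_on (hg.integrableOn.const_mul _) hi.integrableOn hB fun y hy =>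
          mul_le_mul_of_nonneg_right (le_heatKernel_of_norm_lt hr (h y hy)) (hg0 y)
    _ ≤ _ := setIntegral_le_integral hi (Filter.Eventually.of_forall fun y =>
        mul_nonneg (heatKernel_nonneg (by positivity) _) (hg0 y))

/-- Two points of `B(0,r)` are at distance at most `2r`, so their interaction is at least `e^{-4π}
r^{-d}`; this gives the mass term. A point `x` outside the ball sees, within distance `2r`, a whole
ball of radius `r` on which `g ≥ g x` almost everywhere; this gives the tail term. -/
theorem le_integral_mul_heatKernel_conv (hd : d ≠ 0) (hg : Integrable g) (hgm : Measurable g)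
    (hg2 : Integrable fun x => g x ^ 2) (hg0 : ∀ x, 0 ≤ g x)
    (hanti : ∀ x y, x ≠ 0 → ‖x‖ ≤ ‖y‖ → g y ≤ g x) {r : ℝ} (hr : 0 < r) :
    Real.exp (-(4 * Real.pi)) * ((∫ x in ball 0 r, g x) ^ 2 / r ^ d +
        volume.real (ball (0 : EuclideanSpace ℝ (Fin d)) 1) * ∫ x in (ball 0 r)ᶜ, g x ^ 2) ≤
      ∫ x, g x * ∫ y, heatKernel (r ^ 2) (x - y) * g y := by
  have : Nonempty (Fin d) := ⟨⟨0, Nat.pos_of_ne_zero hd⟩⟩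
  have hi := integrable_mul_heatKernel_conv hg hgm (show 0 < r ^ 2 by positivity)
  set E := Real.exp (-(4 * Real.pi)) with hE
  set ω := volume.real (ball (0 : EuclideanSpace ℝ (Fin d)) 1) with hω
  rw [← integral_add_compl (measurableSet_ball (x := (0 : EuclideanSpace ℝ (Fin d))) (ε := r)) hi,
    mul_add]
  refine add_le_add ?_ ?_
  · calc E * ((∫ x in ball 0 r, g x) ^ 2 / r ^ d) =
          ∫ x in ball 0 r, g x * (E / r ^ d * ∫ y in ball 0 r, g y) := by
          rw [integral_mul_const]
          ring
      _ ≤ _ := by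
          refine setIntegral_mono_on (hg.integrableOn.mul_const _) hi.integrableOn
            measurableSet_ball fun x hx => ?_
          refine mul_le_mul_of_nonneg_left ?_ (hg0 x)
          refine le_heatKernel_conv hg hg0 hr measurableSet_ball fun y hy => ?_
          have h1 := mem_ball_zero_iff.1 hx
          have h2 := mem_ball_zero_iff.1 hy
          have h3 := norm_sub_le x y
          linarith
  · calc E * (ω * ∫ x in (ball 0 r)ᶜ, g x ^ 2) =
          ∫ x in (ball 0 r)ᶜ, g x * (E / r ^ d * (g x * (r ^ d * ω))) := by
          rw [← integral_const_mul, ← integral_const_mul]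
          congr 1
          funext x
          field_simp
      _ ≤ _ := by
          refine setIntegral_mono_on ?_ hi.integrableOn measurableSet_ball.compl fun x hx => ?_
          · refine (hg2.const_mul (E * ω)).integrableOn.congr_fun (fun x _ => ?_)
              measurableSet_ball.compl
            simp only
            field_simp
          refine mul_le_mul_of_nonneg_left ?_ (hg0 x)
          have hxr : r ≤ ‖x‖ := by simpa using hx
          have hx0 : 0 < ‖x‖ := hr.trans_le hxr
          -- The centre is `x` moved towards the origin by `r`. The ball of radius `r` around `z`
          -- consists of points of norm at most `‖x‖`, at distance at most `2r` from `x`.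
          set z : EuclideanSpace ℝ (Fin d) := (1 - r / ‖x‖) • x with hz
          have hzn : ‖z‖ = ‖x‖ - r := by
            rw [hz, norm_smul, Real.norm_of_nonneg (by rw [sub_nonneg]; exact (div_le_one hx0).2 hxr)]
            field_simp
          have hxz : ‖x - z‖ = r := by
            have : x - z = (r / ‖x‖) • x := by
              rw [hz, sub_smul, one_smul, sub_sub_cancel]
            rw [this, norm_smul, Real.norm_of_nonneg (by positivity)]
            field_simp
          have hvol : volume.real (ball z r) = r ^ d * ω := by
            rw [hω, ← volume_real_ball_eq hd hr.le, measureReal_def, measureReal_def,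
              Measure.addHaar_ball_center]
          refine le_trans ?_ (le_heatKernel_conv hg hg0 hr (measurableSet_ball (x := z) (ε := r))
            fun y hy => ?_)
          · gcongr
            rw [← hvol, mul_comm, ← smul_eq_mul, ← setIntegral_const]
            refine setIntegral_mono_on_ae (integrableOn_const measure_ball_lt_top.ne)
              hg.integrableOn measurableSet_ball ?_
            filter_upwards [compl_mem_ae_iff.2
              (measure_singleton (0 : EuclideanSpace ℝ (Fin d)))] with y hy hyr
            refine hanti y x hy ?_
            have h1 : ‖y - z‖ < r := mem_ball_iff_norm.1 hyr
            have h2 := norm_add_le (y - z) z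
            rw [sub_add_cancel] at h2
            linarith
          · have h1 : ‖y - z‖ < r := mem_ball_iff_norm.1 hy
            have h2 := norm_sub_le (x - z) (y - z)
            rw [sub_sub_sub_cancel_right] at h2
            linarith

/-- The kernel at time `s/4` has peak height `2^d` times larger and decays faster. The factor
`(1/2)^{d+1}` therefore leaves at most half of the kernel at time `s`. -/
theorem heatKernel_quarter (s : ℝ) (hs : 0 < s) (x : EuclideanSpace ℝ (Fin d)) :
    heatKernel s x / 2 ≤ heatKernel s x - (1 / 2) ^ (d + 1) * heatKernel (s / 4) x := by
  have h1 : (1 / (s / 4)) ^ ((d : ℝ) / 2) = 2 ^ d * (1 / s) ^ ((d : ℝ) / 2) := by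
    rw [show 1 / (s / 4) = 2 ^ (2 : ℝ) * (1 / s) by norm_num; field_simp,
      Real.mul_rpow (by positivity) (by positivity), ← Real.rpow_mul (by norm_num),
      show (2 : ℝ) * ((d : ℝ) / 2) = d by ring, Real.rpow_natCast]
  have h2 : (1 / 2 : ℝ) ^ (d + 1) * heatKernel (s / 4) x ≤ heatKernel s x / 2 := by
    rw [heatKernel, heatKernel, h1]
    have h3 : (1 / 2 : ℝ) ^ (d + 1) * 2 ^ d = 1 / 2 := by
      rw [pow_succ, mul_right_comm, ← mul_pow]
      norm_num
    calc (1 / 2 : ℝ) ^ (d + 1) * (2 ^ d * (1 / s) ^ ((d : ℝ) / 2) *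
          Real.exp (-(Real.pi * (1 / (s / 4)) * ‖x‖ ^ 2))) =
          ((1 / 2 : ℝ) ^ (d + 1) * 2 ^ d) * ((1 / s) ^ ((d : ℝ) / 2) *
          Real.exp (-(Real.pi * (1 / (s / 4)) * ‖x‖ ^ 2))) := by ring
      _ ≤ 1 / 2 * ((1 / s) ^ ((d : ℝ) / 2) * Real.exp (-(Real.pi * (1 / s) * ‖x‖ ^ 2))) := by
          rw [h3]
          have := Real.pi_pos
          gcongr
          linarith
      _ = _ := by ring
  linarith

/-- Outside the ball the wide Gaussian must beat the narrow one, which requires `(3π/4) s|ξ|² ≥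
(d+1) log 2`. The choice of `s` gives `s|ξ|² ≥ d + 1` there, and `3π/4 > log 2`. -/
theorem gaussian_sub_le_indicator {σ s : ℝ} (hσ : 0 < σ) (hs : s = (d + 1) / σ ^ 2)
    (ξ : EuclideanSpace ℝ (Fin d)) :
    Real.exp (-(Real.pi * s * ‖ξ‖ ^ 2)) -
        (1 / 2) ^ (d + 1) * Real.exp (-(Real.pi * (s / 4) * ‖ξ‖ ^ 2)) ≤
      (ball (0 : EuclideanSpace ℝ (Fin d)) σ).indicator (fun _ => (1 : ℝ)) ξ := by
  have hpi := Real.pi_gt_three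
  have hs0 : 0 < s := by rw [hs]; positivity
  by_cases h : ξ ∈ ball (0 : EuclideanSpace ℝ (Fin d)) σ
  · rw [indicator_of_mem h]
    have h1 : Real.exp (-(Real.pi * s * ‖ξ‖ ^ 2)) ≤ 1 := by
      rw [Real.exp_le_one_iff, neg_nonpos]
      positivity
    have h2 : 0 ≤ (1 / 2 : ℝ) ^ (d + 1) * Real.exp (-(Real.pi * (s / 4) * ‖ξ‖ ^ 2)) := by positivity
    linarith
  · rw [indicator_of_notMem h, sub_nonpos]
    have hξ : σ ≤ ‖ξ‖ := by simpa using h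
    have h1 : (d : ℝ) + 1 ≤ s * ‖ξ‖ ^ 2 := by
      rw [hs, div_mul_eq_mul_div, le_div_iff₀ (by positivity)]
      gcongr
    have h2 : (1 / 2 : ℝ) ^ (d + 1) = Real.exp (-((d + 1) * Real.log 2)) := by
      rw [← Real.rpow_natCast, Real.rpow_def_of_pos (by norm_num), one_div, Real.log_inv]
      push_cast
      congr 1
      ring
    rw [h2, ← Real.exp_add, Real.exp_le_exp]
    have h3 := Real.log_two_lt_d9
    have h4 : 0 < Real.log 2 := Real.log_pos one_lt_two
    nlinarith

/-- The Gaussian difference minorizes the indicator of the ball of frequencies, while on the space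
side the subtracted heat energy costs at most half of the main one. The two scales are linked by `r²
= s = (d+1)/σ²`. -/
theorem le_setIntegral_norm_fourier_sq (hd : d ≠ 0) (hg : Integrable g) (hgm : Measurable g)
    (hg2 : MemLp (fun x => (g x : ℂ)) 2) (hg0 : ∀ x, 0 ≤ g x)
    (hanti : ∀ x y, x ≠ 0 → ‖x‖ ≤ ‖y‖ → g y ≤ g x) {σ : ℝ} (hσ : 0 < σ) {r : ℝ}
    (hr : r = √(d + 1) / σ) :
    Real.exp (-(4 * Real.pi)) / 2 * ((∫ x in ball 0 r, g x) ^ 2 / r ^ d +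
        volume.real (ball (0 : EuclideanSpace ℝ (Fin d)) 1) * ∫ x in (ball 0 r)ᶜ, g x ^ 2) ≤
      ∫ ξ in ball 0 σ, ‖𝓕 (fun x => (g x : ℂ)) ξ‖ ^ 2 := by
  have hr0 : 0 < r := by rw [hr]; positivity
  have hrs : r ^ 2 = (d + 1) / σ ^ 2 := by
    rw [hr, div_pow, Real.sq_sqrt (by positivity)]
  have hsq : Integrable fun x => g x ^ 2 := by
    simpa using (memLp_two_iff_integrable_sq_norm hg2.aestronglyMeasurable).1 hg2
  have hF2 : MemLp (𝓕 (fun x => (g x : ℂ))) 2 :=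
    (Lp.memLp (𝓕 (hg2.toLp _) : L2Space d)).ae_eq (fourier_toLp_ae_eq hg.ofReal hg2)
  have hFi : Integrable fun ξ => ‖𝓕 (fun x => (g x : ℂ)) ξ‖ ^ 2 :=
    (memLp_two_iff_integrable_sq_norm hF2.aestronglyMeasurable).1 hF2
  have hGi : ∀ s : ℝ, 0 < s → Integrable fun ξ =>
      Real.exp (-(Real.pi * s * ‖ξ‖ ^ 2)) * ‖𝓕 (fun x => (g x : ℂ)) ξ‖ ^ 2 := fun s hs => by
    refine hFi.bdd_mul (c := 1) (by fun_prop) (Filter.Eventually.of_forall fun ξ => ?_)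
    rw [Real.norm_of_nonneg (Real.exp_pos _).le, Real.exp_le_one_iff, neg_nonpos]
    have := Real.pi_pos
    positivity
  have hs : 0 < r ^ 2 := by positivity
  have hs4 : 0 < r ^ 2 / 4 := by positivity
  have h1 := le_integral_mul_heatKernel_conv hd hg hgm hsq hg0 hanti hr0
  have h2 : (∫ x, g x * ∫ y, heatKernel (r ^ 2) (x - y) * g y) / 2 ≤
      (∫ x, g x * ∫ y, heatKernel (r ^ 2) (x - y) * g y) -
        (1 / 2) ^ (d + 1) * ∫ x, g x * ∫ y, heatKernel (r ^ 2 / 4) (x - y) * g y := by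
    have hi1 := integrable_mul_heatKernel_conv hg hgm hs
    have hi2 := integrable_mul_heatKernel_conv hg hgm hs4
    rw [← integral_const_mul, ← integral_sub hi1 (hi2.const_mul _), ← integral_div]
    refine integral_mono (hi1.div_const 2) (hi1.sub (hi2.const_mul _)) fun x => ?_
    have hk1 := integrable_heatKernel_mul hg hs x
    have hk2 := integrable_heatKernel_mul hg hs4 x
    have h3 : (∫ y, heatKernel (r ^ 2) (x - y) * g y) / 2 ≤
        (∫ y, heatKernel (r ^ 2) (x - y) * g y) -
          (1 / 2) ^ (d + 1) * ∫ y, heatKernel (r ^ 2 / 4) (x - y) * g y := by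
      rw [← integral_const_mul, ← integral_sub hk1 (hk2.const_mul _), ← integral_div]
      refine integral_mono (hk1.div_const 2) (hk1.sub (hk2.const_mul _)) fun y => ?_
      have := mul_le_mul_of_nonneg_right (heatKernel_quarter (r ^ 2) hs (x - y)) (hg0 y)
      simp only
      linarith
    have := mul_le_mul_of_nonneg_left h3 (hg0 x)
    simp only
    linarith
  have h4 : (∫ ξ, Real.exp (-(Real.pi * r ^ 2 * ‖ξ‖ ^ 2)) * ‖𝓕 (fun x => (g x : ℂ)) ξ‖ ^ 2) -
      (1 / 2) ^ (d + 1) * ∫ ξ, Real.exp (-(Real.pi * (r ^ 2 / 4) * ‖ξ‖ ^ 2)) *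
        ‖𝓕 (fun x => (g x : ℂ)) ξ‖ ^ 2 ≤ ∫ ξ in ball 0 σ, ‖𝓕 (fun x => (g x : ℂ)) ξ‖ ^ 2 := by
    rw [← integral_const_mul, ← integral_sub (hGi _ hs) ((hGi _ hs4).const_mul _),
      ← integral_indicator measurableSet_ball]
    refine integral_mono ((hGi _ hs).sub ((hGi _ hs4).const_mul _))
      (hFi.indicator measurableSet_ball) fun ξ => ?_
    have h5 := mul_le_mul_of_nonneg_right (gaussian_sub_le_indicator hσ hrs ξ)
      (sq_nonneg ‖𝓕 (fun x => (g x : ℂ)) ξ‖)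
    have h6 : (ball (0 : EuclideanSpace ℝ (Fin d)) σ).indicator (fun _ => (1 : ℝ)) ξ *
        ‖𝓕 (fun x => (g x : ℂ)) ξ‖ ^ 2 = (ball (0 : EuclideanSpace ℝ (Fin d)) σ).indicator
          (fun ξ => ‖𝓕 (fun x => (g x : ℂ)) ξ‖ ^ 2) ξ := by
      by_cases h : ξ ∈ ball (0 : EuclideanSpace ℝ (Fin d)) σ <;> simp [h]
    rw [h6] at h5
    simp only
    linarith
  rw [integral_gaussian_mul_norm_fourier_sq hg hs, integral_gaussian_mul_norm_fourier_sq hg hs4]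
    at h4
  linarith

theorem coeFn_rearrL2 (f : L2Space d) :
    rearrL2 f =ᵐ[volume] fun x => (symmRearr f x : ℂ) := (memLp_symmRearr f).coeFn_toLp

theorem setIntegral_norm_sq_le_add (u w : L2Space d) (A : Set (EuclideanSpace ℝ (Fin d))) :
    ∫ ξ in A, ‖u ξ‖ ^ 2 ≤ 2 * ‖u - w‖ ^ 2 + 2 * ∫ ξ in A, ‖w ξ‖ ^ 2 := by
  have hi1 := L2Space.integrable_norm_sq (u - w)
  have hi2 := L2Space.integrable_norm_sq w
  calc ∫ ξ in A, ‖u ξ‖ ^ 2 ≤ ∫ ξ in A, (2 * ‖(u - w) ξ‖ ^ 2 + 2 * ‖w ξ‖ ^ 2) := by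
        refine setIntegral_mono_ae (L2Space.integrable_norm_sq u).integrableOn
          ((hi1.const_mul 2).add (hi2.const_mul 2)).integrableOn ?_
        filter_upwards [Lp.coeFn_sub u w] with ξ hξ
        rw [hξ, Pi.sub_apply]
        have h3 := norm_add_le (u ξ - w ξ) (w ξ)
        rw [sub_add_cancel] at h3
        have h5 : ‖u ξ‖ ^ 2 ≤ (‖u ξ - w ξ‖ + ‖w ξ‖) ^ 2 := by gcongr
        nlinarith [sq_nonneg (‖u ξ - w ξ‖ - ‖w ξ‖)]
    _ = 2 * (∫ ξ in A, ‖(u - w) ξ‖ ^ 2) + 2 * ∫ ξ in A, ‖w ξ‖ ^ 2 := by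
        rw [integral_add (hi1.const_mul 2).integrableOn (hi2.const_mul 2).integrableOn,
          integral_const_mul, integral_const_mul]
    _ ≤ _ := by
        gcongr
        rw [L2Space.norm_sq_eq]
        exact setIntegral_le_integral hi1 (Filter.Eventually.of_forall fun x => sq_nonneg _)

/-- A rearrangement is only in `L²`, so the integrable case is applied to its restriction to
`B(0,n)`, which is still radially decreasing. By Plancherel the error is the `L²` tail beyond `n`,
which tends to 0. Splitting the square costs the second factor `1/2`. -/
theorem le_setIntegral_norm_fourier_rearrL2_sq (hd : d ≠ 0) (f : L2Space d) {σ : ℝ} (hσ : 0 < σ)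
    {r : ℝ} (hr : r = √(d + 1) / σ) :
    Real.exp (-(4 * Real.pi)) / 4 * ((∫ x in ball 0 r, symmRearr f x) ^ 2 / r ^ d +
        volume.real (ball (0 : EuclideanSpace ℝ (Fin d)) 1) *
          ∫ x in (ball 0 r)ᶜ, symmRearr f x ^ 2) ≤
      ∫ ξ in ball 0 σ, ‖(𝓕 (rearrL2 f) : L2Space d) ξ‖ ^ 2 := by
  have hr0 : 0 < r := by rw [hr]; positivity
  set ω := volume.real (ball (0 : EuclideanSpace ℝ (Fin d)) 1) with hω
  set E := Real.exp (-(4 * Real.pi)) with hE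
  have hsq := integrable_symmRearr_sq f
  have hgm := measurable_symmRearr f
  set ε : ℕ → ℝ := fun n => ∫ x in (ball (0 : EuclideanSpace ℝ (Fin d)) n)ᶜ, symmRearr f x ^ 2
    with hε
  have hεt : Filter.Tendsto ε Filter.atTop (nhds 0) := by
    have h := tendsto_setIntegral_of_antitone (μ := volume) (f := fun x => symmRearr f x ^ 2)
      (s := fun n : ℕ => (ball (0 : EuclideanSpace ℝ (Fin d)) n)ᶜ)
      (fun n => measurableSet_ball.compl) (fun m n hmn => compl_subset_compl.2
        (ball_subset_ball (by exact_mod_cast hmn))) ⟨0, hsq.integrableOn⟩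
    rwa [← compl_iUnion, iUnion_ball_nat, compl_univ, setIntegral_empty] at h
  have key : ∀ᶠ n : ℕ in Filter.atTop, E / 2 * ((∫ x in ball 0 r, symmRearr f x) ^ 2 / r ^ d +
      ω * ((∫ x in (ball 0 r)ᶜ, symmRearr f x ^ 2) - ε n)) ≤
      2 * ε n + 2 * ∫ ξ in ball 0 σ, ‖(𝓕 (rearrL2 f) : L2Space d) ξ‖ ^ 2 := by
    filter_upwards [(tendsto_natCast_atTop_atTop (R := ℝ)).eventually_ge_atTop r] with n hn
    set g : EuclideanSpace ℝ (Fin d) → ℝ := (ball 0 (n : ℝ)).indicator (symmRearr f) with hg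
    have hgi : Integrable g :=
      (integrable_indicator_iff measurableSet_ball).2 (integrableOn_symmRearr_ball f n)
    have hgmeas : Measurable g := hgm.indicator measurableSet_ball
    have hg0 : ∀ x, 0 ≤ g x := fun x => indicator_nonneg (fun _ _ => symmRearr_nonneg f _) x
    have hganti : ∀ x y, x ≠ 0 → ‖x‖ ≤ ‖y‖ → g y ≤ g x := by
      intro x y hx hxy
      by_cases hy : y ∈ ball (0 : EuclideanSpace ℝ (Fin d)) n
      · have hxm : x ∈ ball (0 : EuclideanSpace ℝ (Fin d)) n :=
          mem_ball_zero_iff.2 (hxy.trans_lt (mem_ball_zero_iff.1 hy))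
        rw [hg, indicator_of_mem hy, indicator_of_mem hxm]
        exact symmRearr_anti hd f hx hxy
      · rw [hg, indicator_of_notMem hy]
        exact hg0 x
    have hg2 : MemLp (fun x => (g x : ℂ)) 2 := by
      refine (memLp_symmRearr f).mono
        (Complex.measurable_ofReal.comp hgmeas).aestronglyMeasurable
        (Filter.Eventually.of_forall fun x => ?_)
      rw [Complex.norm_real, Complex.norm_real]
      exact norm_indicator_le_norm_self _ _
    have h1 := le_setIntegral_norm_fourier_sq hd hgi hgmeas hg2 hg0 hganti hσ hr
    have e1 : ∫ x in ball 0 r, g x = ∫ x in ball 0 r, symmRearr f x := by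
      refine setIntegral_congr_fun measurableSet_ball fun x hx => ?_
      exact indicator_of_mem (ball_subset_ball hn hx) _
    have e2 : ∫ x in (ball 0 r)ᶜ, g x ^ 2 = (∫ x in (ball 0 r)ᶜ, symmRearr f x ^ 2) - ε n := by
      have h2 : ∀ x, g x ^ 2 = symmRearr f x ^ 2 -
          (ball (0 : EuclideanSpace ℝ (Fin d)) n)ᶜ.indicator (fun x => symmRearr f x ^ 2) x := by
        intro x
        by_cases hx : x ∈ ball (0 : EuclideanSpace ℝ (Fin d)) n
        · rw [hg, indicator_of_mem hx, indicator_of_notMem (notMem_compl_iff.2 hx), sub_zero]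
        · rw [hg, indicator_of_notMem hx, indicator_of_mem (show x ∈ (ball _ _)ᶜ from hx), sub_self,
            zero_pow two_ne_zero]
      simp_rw [h2]
      rw [integral_sub hsq.integrableOn (hsq.indicator measurableSet_ball.compl).integrableOn,
        setIntegral_indicator measurableSet_ball.compl, inter_eq_self_of_subset_right
          (compl_subset_compl.2 (ball_subset_ball hn))]
    have e3 : ‖(hg2.toLp _ : L2Space d) - rearrL2 f‖ ^ 2 = ε n := by
      rw [L2Space.norm_sq_eq, hε]
      simp only
      rw [← integral_indicator measurableSet_ball.compl]
      refine integral_congr_ae ?_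
      filter_upwards [Lp.coeFn_sub (hg2.toLp _ : L2Space d) (rearrL2 f), hg2.coeFn_toLp,
        coeFn_rearrL2 f] with x h2 h3 h4
      rw [h2, Pi.sub_apply, h3, h4, ← Complex.ofReal_sub, Complex.norm_real, Real.norm_eq_abs,
        sq_abs]
      by_cases hx : x ∈ ball (0 : EuclideanSpace ℝ (Fin d)) n
      · rw [hg, indicator_of_mem hx, indicator_of_notMem (notMem_compl_iff.2 hx), sub_self,
          zero_pow two_ne_zero]
      · rw [hg, indicator_of_notMem hx, indicator_of_mem (show x ∈ (ball _ _)ᶜ from hx)]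
        ring
    have e4 : ∫ ξ in ball 0 σ, ‖𝓕 (fun x => (g x : ℂ)) ξ‖ ^ 2 ≤
        2 * ε n + 2 * ∫ ξ in ball 0 σ, ‖(𝓕 (rearrL2 f) : L2Space d) ξ‖ ^ 2 := by
      set u : L2Space d := 𝓕 (hg2.toLp _) with hu
      set w : L2Space d := 𝓕 (rearrL2 f) with hw
      have hF : (u : EuclideanSpace ℝ (Fin d) → ℂ) =ᵐ[volume] 𝓕 (fun x => (g x : ℂ)) :=
        fourier_toLp_ae_eq hgi.ofReal hg2
      have hn1 : ‖u - w‖ ^ 2 = ε n := by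
        rw [hu, hw, ← e3, ← Lp.norm_fourier_eq (hg2.toLp _ - rearrL2 f)]
        congr 2
        exact ((Lp.fourierTransformₗᵢ (EuclideanSpace ℝ (Fin d)) ℂ).map_sub _ _).symm
      calc ∫ ξ in ball 0 σ, ‖𝓕 (fun x => (g x : ℂ)) ξ‖ ^ 2
          = ∫ ξ in ball 0 σ, ‖u ξ‖ ^ 2 := by
            refine integral_congr_ae (ae_restrict_of_ae ?_)
            filter_upwards [hF] with ξ hξ
            rw [hξ]
        _ ≤ _ := by
            rw [← hn1]
            exact setIntegral_norm_sq_le_add u w _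
    rw [e1, e2] at h1
    exact h1.trans e4
  have hl : Filter.Tendsto (fun n => E / 2 * ((∫ x in ball 0 r, symmRearr f x) ^ 2 / r ^ d +
      ω * ((∫ x in (ball 0 r)ᶜ, symmRearr f x ^ 2) - ε n))) Filter.atTop
      (nhds (E / 2 * ((∫ x in ball 0 r, symmRearr f x) ^ 2 / r ^ d +
      ω * ((∫ x in (ball 0 r)ᶜ, symmRearr f x ^ 2) - 0)))) :=
    (((hεt.const_sub _).const_mul ω).const_add _).const_mul _
  have hr' : Filter.Tendsto (fun n => 2 * ε n + 2 * ∫ ξ in ball 0 σ,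
      ‖(𝓕 (rearrL2 f) : L2Space d) ξ‖ ^ 2) Filter.atTop
      (nhds (2 * 0 + 2 * ∫ ξ in ball 0 σ, ‖(𝓕 (rearrL2 f) : L2Space d) ξ‖ ^ 2)) :=
    (hεt.const_mul 2).add_const _
  have := le_of_tendsto_of_tendsto hl hr' key
  rw [sub_zero] at this
  linarith

end GaussianLowerBound

/-! ### Sturm comparison for `y'' + q y = 0` with increasing `q`. -/

section Sturm

variable {y y' q : ℝ → ℝ}

theorem exists_first_nonpos (hy : Continuous y) {δ b : ℝ} (hδ : 0 < δ)
    (hpos : ∀ t ∈ Ioo 0 δ, 0 < y t) (hb : 0 < b) (hyb : y b ≤ 0) :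
    ∃ c, 0 < c ∧ c ≤ b ∧ y c ≤ 0 ∧ ∀ t ∈ Ioo 0 c, 0 < y t := by
  have hK : IsCompact (Icc (min δ b) b ∩ {t | y t ≤ 0}) :=
    isCompact_Icc.inter_right (isClosed_le hy continuous_const)
  obtain ⟨c, ⟨⟨hc1, hc2⟩, hc3⟩, hc4⟩ := hK.exists_isLeast ⟨b, ⟨min_le_right _ _, le_rfl⟩, hyb⟩
  have hm : 0 < min δ b := lt_min hδ hb
  refine ⟨c, hm.trans_le hc1, hc2, hc3, fun t ht => ?_⟩
  by_contra hcon
  rw [not_lt] at hcon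
  by_cases htδ : t < δ
  · exact absurd (hpos t ⟨ht.1, htδ⟩) (not_lt.2 hcon)
  · exact absurd (hc4 ⟨⟨(min_le_left _ _).trans (not_lt.1 htδ), ht.2.le.trans hc2⟩, hcon⟩)
      (not_le.2 ht.2)

/-- If `q z < 0`, then `q < 0` on all of `(0, z]`, so `y` is convex as long as it is positive. A
convex function that starts at 0 and is positive near 0 cannot return to 0. -/
theorem nonneg_of_sturm_zero (hy : Continuous y) (hd1 : ∀ t, 0 < t → HasDerivAt y (y' t) t)
    (hd2 : ∀ t, 0 < t → HasDerivAt y' (-(q t * y t)) t) (hq : MonotoneOn q (Ioi 0))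
    (h0 : y 0 = 0) {δ : ℝ} (hδ : 0 < δ) (hpos : ∀ t ∈ Ioo 0 δ, 0 < y t) {z : ℝ} (hz : 0 < z)
    (hyz : y z = 0) : 0 ≤ q z := by
  by_contra hcon
  rw [not_le] at hcon
  obtain ⟨c, hc0, hcz, hyc, hypos⟩ := exists_first_nonpos hy hδ hpos hz hyz.le
  have hconv : ConvexOn ℝ (Icc 0 c) y := by
    refine convexOn_of_hasDerivWithinAt2_nonneg (convex_Icc 0 c) hy.continuousOn
      (f' := y') (f'' := fun t => -(q t * y t)) ?_ ?_ ?_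
    · intro t ht
      rw [interior_Icc] at ht
      exact (hd1 t ht.1).hasDerivWithinAt
    · intro t ht
      rw [interior_Icc] at ht
      exact (hd2 t ht.1).hasDerivWithinAt
    · intro t ht
      rw [interior_Icc] at ht
      have h1 : q t ≤ q z := hq ht.1 hz (ht.2.le.trans hcz)
      have h2 := hypos t ht
      nlinarith
  have h1 := hconv.2 (left_mem_Icc.2 hc0.le) (right_mem_Icc.2 hc0.le)
    (show (0 : ℝ) ≤ 1 / 2 by norm_num) (show (0 : ℝ) ≤ 1 / 2 by norm_num) (by norm_num)
  simp only [smul_eq_mul, h0, mul_zero, zero_add] at h1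
  have h2 := hypos (1 / 2 * c) ⟨by positivity, by linarith⟩
  linarith

/-- After `z` both `q ≥ 0` and `y < 0`, so `y'' ≥ 0`. If `y' z` were nonnegative, `y` would increase
from 0 instead of being negative. -/
theorem deriv_neg_of_sturm_zero (hy : Continuous y) (hd1 : ∀ t, 0 < t → HasDerivAt y (y' t) t)
    (hd2 : ∀ t, 0 < t → HasDerivAt y' (-(q t * y t)) t) (hq : MonotoneOn q (Ioi 0))
    (h0 : y 0 = 0) {δ : ℝ} (hδ : 0 < δ) (hpos : ∀ t ∈ Ioo 0 δ, 0 < y t) {z a : ℝ} (hz : 0 < z)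
    (ha : 0 < a) (hyz : y z = 0) (hneg : ∀ t ∈ Ioc z (z + a), y t < 0) : y' z < 0 := by
  by_contra hcon
  rw [not_lt] at hcon
  have hqz := nonneg_of_sturm_zero hy hd1 hd2 hq h0 hδ hpos hz hyz
  have hmono : MonotoneOn y' (Icc z (z + a)) := by
    refine monotoneOn_of_hasDerivWithinAt_nonneg (convex_Icc _ _)
      (f' := fun t => -(q t * y t))
      (fun t ht => (hd2 t (hz.trans_le ht.1)).continuousAt.continuousWithinAt) ?_ ?_
    · intro t ht
      rw [interior_Icc] at ht
      exact (hd2 t (hz.trans ht.1)).hasDerivWithinAt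
    · intro t ht
      rw [interior_Icc] at ht
      have h1 : q z ≤ q t := hq hz (hz.trans ht.1) ht.1.le
      have h2 := hneg t ⟨ht.1, ht.2.le⟩
      nlinarith
  have hmono2 : MonotoneOn y (Icc z (z + a)) := by
    refine monotoneOn_of_hasDerivWithinAt_nonneg (convex_Icc _ _) (f' := y')
      hy.continuousOn ?_ ?_
    · intro t ht
      rw [interior_Icc] at ht
      exact (hd1 t (hz.trans ht.1)).hasDerivWithinAt
    · intro t ht
      rw [interior_Icc] at ht
      exact hcon.trans (hmono (left_mem_Icc.2 (by linarith)) ⟨ht.1.le, ht.2.le⟩ ht.1.le)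
  have h1 := hmono2 (left_mem_Icc.2 (by linarith)) (right_mem_Icc.2 (by linarith))
    (show z ≤ z + a by linarith)
  have h2 := hneg (z + a) ⟨by linarith, le_rfl⟩
  linarith

/-- The reflected values `A t = y (z - t)` and `B t = -y (z + t)` solve equations with coefficients
`q (z - t) ≤ q (z + t)` and have equal slopes at 0. The arch after `z` therefore bends faster and
stays below the reflected one. -/
theorem sturm_reflection (hy : Continuous y) (hd1 : ∀ t, 0 < t → HasDerivAt y (y' t) t)
    (hd2 : ∀ t, 0 < t → HasDerivAt y' (-(q t * y t)) t) (hq : MonotoneOn q (Ioi 0))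
    (h0 : y 0 = 0) {δ : ℝ} (hδ : 0 < δ) (hpos : ∀ t ∈ Ioo 0 δ, 0 < y t) {z a : ℝ} (hz : 0 < z)
    (ha : 0 < a) (hyz : y z = 0) (hneg : ∀ t ∈ Ioc z (z + a), y t < 0) :
    a < z ∧ ∀ t ∈ Icc 0 a, -y (z + t) ≤ y (z - t) := by
  have hk := deriv_neg_of_sturm_zero hy hd1 hd2 hq h0 hδ hpos hz ha hyz hneg
  set A : ℝ → ℝ := fun t => y (z - t) with hA
  set B : ℝ → ℝ := fun t => -y (z + t) with hB
  have hAc : Continuous A := hy.comp (continuous_const.sub continuous_id)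
  have hBc : Continuous B := (hy.comp (continuous_const.add continuous_id)).neg
  have hA1 : ∀ t, t < z → HasDerivAt A (-y' (z - t)) t := fun t ht =>
    (hd1 (z - t) (by linarith)).comp_const_sub z t
  have hB1 : ∀ t, -z < t → HasDerivAt B (-y' (z + t)) t := fun t ht =>
    ((hd1 (z + t) (by linarith)).comp_const_add z t).neg
  have hBpos : ∀ t ∈ Ioc 0 a, 0 < B t := fun t ht =>
    neg_pos.2 (hneg (z + t) ⟨by linarith [ht.1], by linarith [ht.2]⟩)
  -- the Wronskian is nonnegative, so the quotient is monotone as long as `A` stays positive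
  have hquot : ∀ c, 0 < c → c ≤ a → c < z → (∀ t ∈ Ioo 0 c, 0 < A t) →
      MonotoneOn (fun t => A t / B t) (Ioc 0 c) := by
    intro c hc hca hcz hApos
    have hW : ∀ t ∈ Icc 0 c, HasDerivAt (fun t => -y' (z - t) * B t - A t * -y' (z + t))
        ((q (z + t) - q (z - t)) * (A t * B t)) t := by
      intro t ht
      have e1 := ((hd2 (z - t) (by linarith [ht.2])).comp_const_sub z t).neg
      have e2 := ((hd2 (z + t) (by linarith [ht.1])).comp_const_add z t).neg
      have e3 := hA1 t (by linarith [ht.2])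
      have e4 := hB1 t (by linarith [ht.1])
      refine ((e1.mul e4).sub (e3.mul e2)).congr_deriv ?_
      simp only [hA, hB, Pi.neg_apply]
      ring
    have hWmono : MonotoneOn (fun t => -y' (z - t) * B t - A t * -y' (z + t)) (Icc 0 c) := by
      refine monotoneOn_of_hasDerivWithinAt_nonneg (convex_Icc _ _)
        (f' := fun t => (q (z + t) - q (z - t)) * (A t * B t))
        (fun t ht => (hW t ht).continuousAt.continuousWithinAt) ?_ ?_
      · intro t ht
        rw [interior_Icc] at ht
        exact (hW t ⟨ht.1.le, ht.2.le⟩).hasDerivWithinAt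
      · intro t ht
        rw [interior_Icc] at ht
        have h1 : q (z - t) ≤ q (z + t) := hq (show (0 : ℝ) < z - t by linarith [ht.2])
          (show (0 : ℝ) < z + t by linarith [ht.1]) (by linarith [ht.1])
        exact mul_nonneg (sub_nonneg.2 h1)
          (mul_nonneg (hApos t ht).le (hBpos t ⟨ht.1, ht.2.le.trans hca⟩).le)
    have hWnn : ∀ t ∈ Icc 0 c, 0 ≤ -y' (z - t) * B t - A t * -y' (z + t) := by
      intro t ht
      have := hWmono (left_mem_Icc.2 hc.le) ht ht.1
      simpa [hA, hB, hyz] using this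
    refine monotoneOn_of_hasDerivWithinAt_nonneg (convex_Ioc _ _)
      (f' := fun t => (-y' (z - t) * B t - A t * -y' (z + t)) / B t ^ 2)
      (hAc.continuousOn.div hBc.continuousOn fun t ht => (hBpos t ⟨ht.1, ht.2.trans hca⟩).ne') ?_ ?_
    · intro t ht
      rw [interior_Ioc] at ht
      exact ((hA1 t (ht.2.trans hcz)).div (hB1 t (by linarith [ht.1]))
        (hBpos t ⟨ht.1, ht.2.le.trans hca⟩).ne').hasDerivWithinAt
    · intro t ht
      rw [interior_Ioc] at ht
      exact div_nonneg (hWnn t ⟨ht.1.le, ht.2.le⟩) (sq_nonneg _)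
  have hslopeA : Filter.Tendsto (fun t => A t / t) (nhdsWithin 0 (Ioi 0)) (nhds (-y' z)) := by
    have h := hasDerivAt_iff_tendsto_slope_zero.1 (hA1 0 hz)
    have h' := h.mono_left (nhdsWithin_mono 0 (fun t (ht : 0 < t) => ht.ne') :
      nhdsWithin (0 : ℝ) (Ioi 0) ≤ _)
    simp only [hA, zero_add, sub_zero, hyz, smul_eq_mul] at h'
    simpa [hA, div_eq_inv_mul] using h'
  have hslopeB : Filter.Tendsto (fun t => B t / t) (nhdsWithin 0 (Ioi 0)) (nhds (-y' z)) := by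
    have h := hasDerivAt_iff_tendsto_slope_zero.1 (hB1 0 (by linarith))
    have h' := h.mono_left (nhdsWithin_mono 0 (fun t (ht : 0 < t) => ht.ne') :
      nhdsWithin (0 : ℝ) (Ioi 0) ≤ _)
    simp only [hB, zero_add, add_zero, hyz, smul_eq_mul] at h'
    simpa [hB, div_eq_inv_mul] using h'
  have hkpos : 0 < -y' z := by linarith
  obtain ⟨η, hη, hAη⟩ : ∃ η > 0, ∀ t ∈ Ioo 0 η, 0 < A t := by
    have h1 := hslopeA.eventually (lt_mem_nhds hkpos)
    obtain ⟨η, hη, h2⟩ := mem_nhdsGT_iff_exists_Ioo_subset.1 h1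
    refine ⟨η, hη, fun t ht => ?_⟩
    have h3 : 0 < A t / t := h2 ht
    exact (div_pos_iff_of_pos_right ht.1).1 h3
  -- Up to the first point where `A` would fail to be positive the quotient `A / B` is nondecreasing
  -- and starts positive, so it cannot drop to a nonpositive value.
  have hApos : ∀ c, 0 < c → c ≤ a → c < z → 0 < A c := by
    intro c hc hca hcz
    by_contra hcon
    rw [not_lt] at hcon
    obtain ⟨e, he0, hec, hAe, hAe'⟩ := exists_first_nonpos hAc hη hAη hc hcon
    have h1 := hquot e he0 (hec.trans hca) (hec.trans_lt hcz) hAe'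
      (show e / 2 ∈ Ioc 0 e from ⟨by linarith, by linarith⟩) (right_mem_Ioc.2 he0)
      (show e / 2 ≤ e by linarith)
    have h2 : 0 < A (e / 2) / B (e / 2) := div_pos (hAe' _ ⟨by linarith, by linarith⟩)
      (hBpos _ ⟨by linarith, by linarith⟩)
    have h3 : A e / B e ≤ 0 := div_nonpos_of_nonpos_of_nonneg hAe
      (hBpos e ⟨he0, hec.trans hca⟩).le
    have h4 : A (e / 2) / B (e / 2) ≤ A e / B e := h1
    linarith
  have hlim : Filter.Tendsto (fun t => A t / B t) (nhdsWithin 0 (Ioi 0)) (nhds 1) := by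
    have h := hslopeA.div hslopeB hkpos.ne'
    rw [div_self hkpos.ne'] at h
    refine h.congr' ?_
    filter_upwards [self_mem_nhdsWithin] with t ht
    have : t ≠ 0 := ne_of_gt ht
    simp only [Pi.div_apply]
    exact div_div_div_cancel_right₀ this _ _
  have hle : ∀ c, 0 < c → c ≤ a → c < z → B c ≤ A c := by
    intro c hc hca hcz
    have hm := hquot c hc hca hcz fun t ht => hApos t ht.1 (ht.2.le.trans hca) (ht.2.trans hcz)
    have h1 : 1 ≤ A c / B c := by
      refine le_of_tendsto hlim ?_
      filter_upwards [Ioo_mem_nhdsGT hc] with t ht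
      exact hm ⟨ht.1, ht.2.le⟩ (right_mem_Ioc.2 hc) ht.2.le
    exact (one_le_div (hBpos c ⟨hc, hca⟩)).1 h1
  -- Otherwise the comparison extends to `t = z` by continuity and gives `B z ≤ A z = y 0 = 0`,
  -- although `B z > 0`.
  have haz : a < z := by
    by_contra hcon
    rw [not_lt] at hcon
    have h1 : B z ≤ A z := by
      refine le_of_tendsto_of_tendsto (f := fun t => B t) (g := fun t => A t)
        (b := nhdsWithin z (Iio z)) (hBc.continuousWithinAt) (hAc.continuousWithinAt) ?_
      filter_upwards [Ioo_mem_nhdsLT hz] with t ht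
      exact hle t ht.1 (ht.2.le.trans hcon) ht.2
    have h2 := hBpos z ⟨hz, hcon⟩
    have h3 : A z = 0 := by simp [hA, h0]
    linarith
  refine ⟨haz, fun t ht => ?_⟩
  rcases ht.1.eq_or_lt with h | h
  · simp [← h, hyz]
  · exact hle t h ht.2 (ht.2.trans_lt haz)

/-- A solution of `y'' + q y = 0` on `(0, ∞)` with `q` increasing, `y 0 = 0` and `y > 0` near `0`
has nonnegative primitive. -/
theorem integral_nonneg_of_sturm (hy : Continuous y) (hd1 : ∀ t, 0 < t → HasDerivAt y (y' t) t)
    (hd2 : ∀ t, 0 < t → HasDerivAt y' (-(q t * y t)) t) (hq : MonotoneOn q (Ioi 0))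
    (h0 : y 0 = 0) {δ : ℝ} (hδ : 0 < δ) (hpos : ∀ t ∈ Ioo 0 δ, 0 < y t) {x : ℝ} (hx : 0 ≤ x) :
    0 ≤ ∫ t in 0..x, y t := by
  by_contra hcon
  rw [not_le] at hcon
  have hx0 : 0 < x := by
    rcases hx.eq_or_lt with h | h
    · rw [← h, intervalIntegral.integral_same] at hcon
      exact absurd hcon (lt_irrefl _)
    · exact h
  have hYd : ∀ t, HasDerivAt (fun t => ∫ s in 0..t, y s) (y t) t := fun t =>
    intervalIntegral.integral_hasDerivAt_right (hy.intervalIntegrable _ _)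
      (hy.stronglyMeasurableAtFilter _ _) hy.continuousAt
  set Y : ℝ → ℝ := fun t => ∫ s in 0..t, y s with hY
  have hYc : Continuous Y := continuous_iff_continuousAt.2 fun t => (hYd t).continuousAt
  -- The tilt `Y t + ε t` is still negative at `x`. At its minimum `p` it forces `y p ≤ -ε`, so `p`
  -- lies strictly inside a negative arch; it also makes the final comparison strict.
  set ε : ℝ := -Y x / (2 * x) with hε
  have hYx : Y x < 0 := hcon
  have hε0 : 0 < ε := div_pos (by linarith) (by linarith)
  obtain ⟨p, hp, hmin⟩ := isCompact_Icc.exists_isMinOn (nonempty_Icc.2 hx)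
    (f := fun t => Y t + ε * t) (by fun_prop)
  have hHp : Y p + ε * p < 0 := by
    have h1 : Y p + ε * p ≤ Y x + ε * x := hmin (right_mem_Icc.2 hx)
    have h2 : ε * x = -Y x / 2 := by rw [hε]; field_simp
    linarith
  have hp0 : 0 < p := by
    rcases hp.1.eq_or_lt with h | h
    · rw [← h] at hHp
      simp [hY] at hHp
    · exact h
  have hyp : y p < 0 := by
    have hd : HasDerivAt (fun t => Y t + ε * t) (y p + ε) p := by
      exact ((hYd p).add ((hasDerivAt_id p).const_mul ε)).congr_deriv (by simp)
    have h1 : y p + ε ≤ 0 := by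
      have hs := (hasDerivWithinAt_iff_tendsto_slope' (by simp : p ∉ Iio p)).1
        (hd.hasDerivWithinAt (s := Iio p))
      refine le_of_tendsto hs ?_
      filter_upwards [Ioo_mem_nhdsLT hp0] with t ht
      rw [slope_def_field]
      refine div_nonpos_of_nonneg_of_nonpos ?_ (by linarith [ht.2])
      have h2 : Y p + ε * p ≤ Y t + ε * t := hmin ⟨ht.1.le, ht.2.le.trans hp.2⟩
      linarith
    linarith
  have hK : IsCompact (Icc 0 p ∩ {t | 0 ≤ y t}) :=
    isCompact_Icc.inter_right (isClosed_le continuous_const hy)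
  -- `z` is the last zero before `p`, the start of the negative arch containing `p`.
  obtain ⟨z, ⟨⟨hz1, hz2⟩, hz3⟩, hz4⟩ := hK.exists_isGreatest ⟨0, ⟨le_rfl, hp0.le⟩, h0.ge⟩
  have hz3' : 0 ≤ y z := hz3
  have hzp : z < p := lt_of_le_of_ne hz2 fun h => by rw [h] at hz3'; linarith
  have hneg : ∀ t ∈ Ioc z (z + (p - z)), y t < 0 := by
    intro t ht
    by_contra hc
    rw [not_lt] at hc
    have := hz4 ⟨⟨hz1.trans ht.1.le, by linarith [ht.2]⟩, hc⟩
    linarith [ht.1]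
  have hz0 : 0 < z := by
    have hm : 0 < min δ p := lt_min hδ hp0
    have h1 : min δ p / 2 ≤ z := hz4 ⟨⟨by linarith, by linarith [min_le_right δ p]⟩,
      (hpos _ ⟨by linarith, by linarith [min_le_left δ p]⟩).le⟩
    linarith
  have hyz : y z = 0 := by
    refine le_antisymm ?_ hz3'
    refine le_of_tendsto (hy.continuousWithinAt (s := Ioi z)).tendsto ?_
    filter_upwards [Ioo_mem_nhdsGT hzp] with t ht
    exact (hneg t ⟨ht.1, by linarith [ht.2]⟩).le
  obtain ⟨haz, hle⟩ := sturm_reflection hy hd1 hd2 hq h0 hδ hpos hz0 (sub_pos.2 hzp) hyz hneg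
  set a := p - z with ha
  have ha0 : 0 < a := sub_pos.2 hzp
  have h1 : ∫ t in 0..a, -y (z + t) ≤ ∫ t in 0..a, y (z - t) :=
    intervalIntegral.integral_mono_on ha0.le
      ((hy.comp (continuous_const.add continuous_id)).neg.intervalIntegrable _ _)
      ((hy.comp (continuous_const.sub continuous_id)).intervalIntegrable _ _) hle
  rw [intervalIntegral.integral_neg, intervalIntegral.integral_comp_add_left (fun t => y t) z,
    intervalIntegral.integral_comp_sub_left (fun t => y t) z, add_zero, sub_zero] at h1
  -- The positive values on `[z - a, z]` outweigh the negative ones on `[z, z + a] = [z, p]`. Hence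
  -- the tilted primitive is smaller at `z - a` than at `p`, contradicting minimality.
  have h2 : Y (z - a) ≤ Y p := by
    have e1 := intervalIntegral.integral_add_adjacent_intervals
      (hy.intervalIntegrable (μ := volume) 0 (z - a)) (hy.intervalIntegrable (z - a) z)
    have e2 := intervalIntegral.integral_add_adjacent_intervals
      (hy.intervalIntegrable (μ := volume) 0 z) (hy.intervalIntegrable z (z + a))
    have e3 : z + a = p := by rw [ha]; ring
    rw [e3] at e2 h1
    simp only [hY]
    linarith
  have h3 : Y p + ε * p ≤ Y (z - a) + ε * (z - a) :=
    hmin ⟨by linarith, by linarith [hp.2]⟩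
  have h4 : ε * (z - a) < ε * p := mul_lt_mul_of_pos_left (by linarith) hε0
  linarith

end Sturm

/-! ### Positivity of weighted integrals of the Bessel function. -/

section BesselPositivity

theorem hasDerivAt_integral_cos {w : ℝ → ℝ} (hw : Continuous w) (t : ℝ) :
    HasDerivAt (fun t => ∫ s in (-1)..1, w s * Real.cos (t * s))
      (-∫ s in (-1)..1, s * w s * Real.sin (t * s)) t := by
  have h := (intervalIntegral.hasDerivAt_integral_of_dominated_loc_of_deriv_le
    (μ := volume) (a := -1) (b := 1) (x₀ := t) (s := univ)
    (F := fun t s => w s * Real.cos (t * s)) (F' := fun t s => -(s * w s * Real.sin (t * s)))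
    (bound := fun s => |s * w s|) Filter.univ_mem
    (Filter.Eventually.of_forall fun t => by fun_prop)
    (Continuous.intervalIntegrable (by fun_prop) _ _) (by fun_prop)
    (Filter.Eventually.of_forall fun s _ t _ => ?_)
    (Continuous.intervalIntegrable (by fun_prop) _ _)
    (Filter.Eventually.of_forall fun s _ t _ => ?_)).2
  · rwa [intervalIntegral.integral_neg] at h
  · rw [norm_neg, norm_mul, Real.norm_eq_abs, Real.norm_eq_abs]
    exact mul_le_of_le_one_right (abs_nonneg _) (Real.abs_sin_le_one _)
  · exact ((((hasDerivAt_id t).mul_const s).cos).const_mul (w s)).congr_deriv (by simp; ring)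

theorem hasDerivAt_integral_sin {w : ℝ → ℝ} (hw : Continuous w) (t : ℝ) :
    HasDerivAt (fun t => ∫ s in (-1)..1, w s * Real.sin (t * s))
      (∫ s in (-1)..1, s * w s * Real.cos (t * s)) t := by
  refine (intervalIntegral.hasDerivAt_integral_of_dominated_loc_of_deriv_le
    (μ := volume) (a := -1) (b := 1) (x₀ := t) (s := univ)
    (F := fun t s => w s * Real.sin (t * s)) (F' := fun t s => s * w s * Real.cos (t * s))
    (bound := fun s => |s * w s|) Filter.univ_mem
    (Filter.Eventually.of_forall fun t => by fun_prop)
    (Continuous.intervalIntegrable (by fun_prop) _ _) (by fun_prop)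
    (Filter.Eventually.of_forall fun s _ t _ => ?_)
    (Continuous.intervalIntegrable (by fun_prop) _ _)
    (Filter.Eventually.of_forall fun s _ t _ => ?_)).2
  · rw [norm_mul, Real.norm_eq_abs, Real.norm_eq_abs]
    exact mul_le_of_le_one_right (abs_nonneg _) (Real.abs_cos_le_one _)
  · exact ((((hasDerivAt_id t).mul_const s).sin).const_mul (w s)).congr_deriv (by simp; ring)

/-- The Poisson integral, a multiple of `J_ν(t) / t ^ ν` with `ν = γ + 1/2`. -/
noncomputable def poissonIntegral (γ t : ℝ) : ℝ :=
  ∫ s in (-1)..1, (1 - s ^ 2) ^ γ * Real.cos (t * s)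

/-- The derivative of `poissonIntegral`. -/
noncomputable def poissonIntegralDeriv (γ t : ℝ) : ℝ :=
  -∫ s in (-1)..1, s * (1 - s ^ 2) ^ γ * Real.sin (t * s)

variable {γ : ℝ}

theorem continuous_one_sub_sq_rpow (hγ : 0 ≤ γ) : Continuous fun s : ℝ => (1 - s ^ 2) ^ γ :=
  (Real.continuous_rpow_const hγ).comp (by fun_prop)

theorem hasDerivAt_poissonIntegral (hγ : 0 ≤ γ) (t : ℝ) :
    HasDerivAt (poissonIntegral γ) (poissonIntegralDeriv γ t) t :=
  hasDerivAt_integral_cos (continuous_one_sub_sq_rpow hγ) t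

theorem continuous_poissonIntegral (hγ : 0 ≤ γ) : Continuous (poissonIntegral γ) :=
  continuous_iff_continuousAt.2 fun t => (hasDerivAt_poissonIntegral hγ t).continuousAt

/-- Bessel's equation in the form `t (u + u'') + 2(γ+1) u' = 0`. It follows from integrating the
derivative of `(1-s²)^{γ+1} sin(ts)` over `[-1,1]`, where the boundary terms vanish. -/
theorem poissonIntegral_ode (hγ : 0 ≤ γ) (t : ℝ) :
    t * (poissonIntegral γ t - ∫ s in (-1)..1, s * (s * (1 - s ^ 2) ^ γ) * Real.cos (t * s)) +
      2 * (γ + 1) * poissonIntegralDeriv γ t = 0 := by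
  have hw := continuous_one_sub_sq_rpow hγ
  have hd : ∀ s : ℝ, HasDerivAt (fun s => (1 - s ^ 2) ^ (γ + 1) * Real.sin (t * s))
      (t * ((1 - s ^ 2) ^ (γ + 1) * Real.cos (t * s)) -
        2 * (γ + 1) * (s * (1 - s ^ 2) ^ γ * Real.sin (t * s))) s := by
    intro s
    have h1 : HasDerivAt (fun s : ℝ => 1 - s ^ 2) (-(2 * s)) s := by
      simpa using (hasDerivAt_pow 2 s).const_sub 1
    have h2 := h1.rpow_const (p := γ + 1) (Or.inr (by linarith))
    have h3 := ((hasDerivAt_id s).const_mul t).sin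
    refine (h2.mul h3).congr_deriv ?_
    simp only [id, add_sub_cancel_right]
    ring
  have hI := intervalIntegral.integral_eq_sub_of_hasDerivAt (a := -1) (b := 1)
    (fun s _ => hd s) (Continuous.intervalIntegrable (by
      have := continuous_one_sub_sq_rpow (γ := γ + 1) (by linarith)
      fun_prop) _ _)
  have hz : (0 : ℝ) ^ (γ + 1) = 0 := Real.zero_rpow (by linarith)
  rw [intervalIntegral.integral_sub (Continuous.intervalIntegrable (by
      have := continuous_one_sub_sq_rpow (γ := γ + 1) (by linarith)
      fun_prop) _ _) (Continuous.intervalIntegrable (by fun_prop) _ _),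
    intervalIntegral.integral_const_mul, intervalIntegral.integral_const_mul] at hI
  norm_num [hz] at hI
  have h4 : poissonIntegral γ t - ∫ s in (-1)..1, s * (s * (1 - s ^ 2) ^ γ) * Real.cos (t * s) =
      ∫ s in (-1)..1, (1 - s ^ 2) ^ (γ + 1) * Real.cos (t * s) := by
    rw [poissonIntegral, ← intervalIntegral.integral_sub
      (Continuous.intervalIntegrable (by fun_prop) _ _)
      (Continuous.intervalIntegrable (by fun_prop) _ _)]
    refine intervalIntegral.integral_congr fun s hs => ?_
    rw [uIcc_of_le (by norm_num)] at hs
    have h5 : 0 ≤ 1 - s ^ 2 := by nlinarith [hs.1, hs.2]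
    rw [Real.rpow_add_one' h5 (by linarith)]
    ring
  rw [h4, poissonIntegralDeriv]
  linarith

theorem half_le_cos {x : ℝ} (hx : |x| ≤ 1) : 1 / 2 ≤ Real.cos x := by
  have h1 := Real.one_sub_sq_div_two_le_cos (x := x)
  have h2 : x ^ 2 ≤ 1 := (sq_le_one_iff_abs_le_one x).2 hx
  linarith

theorem poissonIntegral_zero_pos (hγ : 0 ≤ γ) : 0 < poissonIntegral γ 0 := by
  have hw := continuous_one_sub_sq_rpow hγ
  unfold poissonIntegral
  refine intervalIntegral.intervalIntegral_pos_of_pos_on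
    (Continuous.intervalIntegrable (by fun_prop) _ _) (fun s hs => ?_) (by norm_num)
  have : 0 < 1 - s ^ 2 := by nlinarith [hs.1, hs.2]
  rw [zero_mul, Real.cos_zero, mul_one]
  positivity

theorem half_le_poissonIntegral (hγ : 0 ≤ γ) {t : ℝ} (ht : |t| ≤ 1) :
    poissonIntegral γ 0 / 2 ≤ poissonIntegral γ t := by
  have hw := continuous_one_sub_sq_rpow hγ
  unfold poissonIntegral
  rw [← intervalIntegral.integral_div]
  refine intervalIntegral.integral_mono_on (by norm_num)
    (Continuous.intervalIntegrable (by fun_prop) _ _)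
    (Continuous.intervalIntegrable (by fun_prop) _ _) fun s hs => ?_
  have h1 : 0 ≤ 1 - s ^ 2 := by nlinarith [hs.1, hs.2]
  rw [zero_mul, Real.cos_zero, mul_one, div_eq_mul_one_div]
  refine mul_le_mul_of_nonneg_left (half_le_cos ?_) (by positivity)
  rw [abs_mul]
  exact mul_le_one₀ ht (abs_nonneg _) (abs_le.2 hs)

/-- The factor `t^{γ+1}` removes the first-order term of Bessel's equation. The resulting potential
`1 - γ(γ+1)/t²` is increasing because `γ ≥ 0`, so the Sturm result applies. -/
theorem integral_rpow_mul_poissonIntegral_nonneg (hγ : 0 ≤ γ) {x : ℝ} (hx : 0 ≤ x) :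
    0 ≤ ∫ t in 0..x, t ^ (γ + 1) * poissonIntegral γ t := by
  have hm : 0 ≤ γ + 1 := by linarith
  have huc := continuous_poissonIntegral hγ
  have hyc : Continuous fun t : ℝ => t ^ (γ + 1) * poissonIntegral γ t :=
    (Real.continuous_rpow_const hm).mul huc
  refine integral_nonneg_of_sturm (q := fun t => 1 - γ * (γ + 1) / t ^ 2)
    (y' := fun t => (γ + 1) * t ^ γ * poissonIntegral γ t +
      t ^ (γ + 1) * poissonIntegralDeriv γ t) hyc ?_ ?_ ?_ ?_ one_pos ?_ hx
  · intro t ht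
    have h1 := Real.hasDerivAt_rpow_const (x := t) (p := γ + 1) (Or.inl ht.ne')
    rw [add_sub_cancel_right] at h1
    exact h1.mul (hasDerivAt_poissonIntegral hγ t)
  · intro t ht
    have h1 := Real.hasDerivAt_rpow_const (x := t) (p := γ + 1) (Or.inl ht.ne')
    have h2 := Real.hasDerivAt_rpow_const (x := t) (p := γ) (Or.inl ht.ne')
    rw [add_sub_cancel_right] at h1
    have hu := hasDerivAt_poissonIntegral hγ t
    have hu' : HasDerivAt (poissonIntegralDeriv γ)
        (-∫ s in (-1)..1, s * (s * (1 - s ^ 2) ^ γ) * Real.cos (t * s)) t :=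
      (hasDerivAt_integral_sin (w := fun s => s * (1 - s ^ 2) ^ γ)
        (by have := continuous_one_sub_sq_rpow hγ; fun_prop) t).neg
    refine (((h2.const_mul (γ + 1)).mul hu).add (h1.mul hu')).congr_deriv ?_
    have hode := poissonIntegral_ode hγ t
    set V := ∫ s in (-1)..1, s * (s * (1 - s ^ 2) ^ γ) * Real.cos (t * s)
    have e1 : t ^ (γ + 1) = t ^ γ * t := Real.rpow_add_one ht.ne' γ
    have e2 : t ^ (γ - 1) = t ^ γ / t := Real.rpow_sub_one ht.ne' γ
    rw [e1, e2]
    field_simp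
    linear_combination (t ^ 1) * hode
  · intro s hs t ht hst
    have hs' : 0 < s := hs
    have : 0 ≤ γ * (γ + 1) := by positivity
    simp only
    gcongr
  · simp [Real.zero_rpow (show γ + 1 ≠ 0 by linarith)]
  · intro t ht
    refine mul_pos (Real.rpow_pos_of_pos ht.1 _) ?_
    have h1 := half_le_poissonIntegral hγ (show |t| ≤ 1 by rw [abs_of_pos ht.1]; exact ht.2.le)
    have h2 := poissonIntegral_zero_pos hγ
    linarith

/-- `t^a` is `t^{γ+1}` times the decreasing weight `t^{-p}` with `p = γ + 1 - a > 0`. Integration by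
parts against the nonnegative primitive of `t^{γ+1} u` transfers its positivity and leaves a
definite gain from `[0,1]`. -/
theorem exists_le_integral_pow_mul_poissonIntegral {a : ℕ} (ha : (a : ℝ) ≤ γ) :
    ∃ c, 0 < c ∧ ∀ x, 0 ≤ x →
      c * min 1 (x ^ (a + 1)) ≤ ∫ t in 0..x, t ^ a * poissonIntegral γ t := by
  have hγ : 0 ≤ γ := (Nat.cast_nonneg a).trans ha
  have huc := continuous_poissonIntegral hγ
  have hκ := poissonIntegral_zero_pos hγ
  set κ := poissonIntegral γ 0 with hκdef
  have hm : 0 ≤ γ + 1 := by linarith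
  have hrc : Continuous fun t : ℝ => t ^ (γ + 1) := Real.continuous_rpow_const hm
  -- This is `∫₀¹ (t^a - t^{γ+1}) κ/2 dt`; on `[0,1]` the Poisson integral is at least `κ/2`.
  set c := κ / 2 * (1 / ((a : ℝ) + 1) - 1 / (γ + 1 + 1)) with hc
  have hc0 : 0 < c := by
    have : 1 / (γ + 1 + 1) < 1 / ((a : ℝ) + 1) := by gcongr; linarith
    exact mul_pos (by positivity) (by linarith)
  refine ⟨c, hc0, fun x hx => ?_⟩
  rcases le_total x 1 with hx1 | hx1
  · calc c * min 1 (x ^ (a + 1)) ≤ κ / 2 * (1 / ((a : ℝ) + 1)) * x ^ (a + 1) := by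
          refine mul_le_mul ?_ (min_le_right _ _) (by positivity) (by positivity)
          rw [hc]
          have : 0 < 1 / (γ + 1 + 1) := by positivity
          gcongr
          linarith
      _ = ∫ t in 0..x, t ^ a * (κ / 2) := by
          rw [intervalIntegral.integral_mul_const, integral_pow]
          simp
          ring
      _ ≤ _ := by
          refine intervalIntegral.integral_mono_on hx
            (Continuous.intervalIntegrable (by fun_prop) _ _)
            (Continuous.intervalIntegrable (by fun_prop) _ _) fun t ht => ?_
          refine mul_le_mul_of_nonneg_left ?_ (pow_nonneg ht.1 _)
          exact half_le_poissonIntegral hγ (by rw [abs_of_nonneg ht.1]; exact ht.2.trans hx1)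
  · set p := γ + 1 - a with hp
    have hp0 : 0 < p := by rw [hp]; linarith
    have hyc : Continuous fun t : ℝ => t ^ (γ + 1) * poissonIntegral γ t := hrc.mul huc
    have hic : Continuous fun t : ℝ => t ^ a * poissonIntegral γ t := by fun_prop
    set Y : ℝ → ℝ := fun x => ∫ t in 0..x, t ^ (γ + 1) * poissonIntegral γ t with hY
    set J : ℝ → ℝ := fun x => ∫ t in 0..x, t ^ a * poissonIntegral γ t with hJ
    have hYd : ∀ x, HasDerivAt Y (x ^ (γ + 1) * poissonIntegral γ x) x := fun x =>
      intervalIntegral.integral_hasDerivAt_right (hyc.intervalIntegrable _ _)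
        (hyc.stronglyMeasurableAtFilter _ _) hyc.continuousAt
    have hJd : ∀ x, HasDerivAt J (x ^ a * poissonIntegral γ x) x := fun x =>
      intervalIntegral.integral_hasDerivAt_right (hic.intervalIntegrable _ _)
        (hic.stronglyMeasurableAtFilter _ _) hic.continuousAt
    -- The terms containing `u` cancel because `x^{-p} x^{γ+1} = x^a`. What remains has the sign of
    -- `Y`, so this difference is nondecreasing from `x = 1` on.
    have hd : ∀ x, 0 < x → HasDerivAt (fun x => J x - x ^ (-p) * Y x)
        (p * x ^ (-p - 1) * Y x) x := by
      intro x hx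
      have h1 := Real.hasDerivAt_rpow_const (x := x) (p := -p) (Or.inl hx.ne')
      refine ((hJd x).sub (h1.mul (hYd x))).congr_deriv ?_
      have e : x ^ (-p) * x ^ (γ + 1) = x ^ a := by
        rw [← Real.rpow_add hx, ← Real.rpow_natCast]
        congr 1
        rw [hp]
        ring
      linear_combination -(poissonIntegral γ x) * e
    have hmono : MonotoneOn (fun x => J x - x ^ (-p) * Y x) (Icc 1 x) := by
      refine monotoneOn_of_hasDerivWithinAt_nonneg (convex_Icc _ _)
        (f' := fun x => p * x ^ (-p - 1) * Y x)
        (fun t ht => (hd t (one_pos.trans_le ht.1)).continuousAt.continuousWithinAt) ?_ ?_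
      · intro t ht
        rw [interior_Icc] at ht
        exact (hd t (one_pos.trans ht.1)).hasDerivWithinAt
      · intro t ht
        rw [interior_Icc] at ht
        have ht0 : 0 < t := one_pos.trans ht.1
        have := integral_rpow_mul_poissonIntegral_nonneg hγ ht0.le
        exact mul_nonneg (by positivity) this
    have h1 : J 1 - 1 ^ (-p) * Y 1 ≤ J x - x ^ (-p) * Y x :=
      hmono (left_mem_Icc.2 hx1) (right_mem_Icc.2 hx1) hx1
    have h2 : 0 ≤ x ^ (-p) * Y x :=
      mul_nonneg (by positivity) (integral_rpow_mul_poissonIntegral_nonneg hγ hx)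
    have h3 : c ≤ J 1 - Y 1 := by
      have e1 : ∫ t in (0 : ℝ)..1, (t ^ a - t ^ (γ + 1)) * (κ / 2) = c := by
        rw [intervalIntegral.integral_mul_const, intervalIntegral.integral_sub
          (Continuous.intervalIntegrable (by fun_prop) _ _) (hrc.intervalIntegrable _ _),
          integral_pow, integral_rpow (Or.inl (by linarith)), hc,
          Real.zero_rpow (by linarith)]
        simp
        ring
      rw [← e1, hJ, hY]
      simp only
      rw [← intervalIntegral.integral_sub (hic.intervalIntegrable _ _)
        (hyc.intervalIntegrable _ _)]
      refine intervalIntegral.integral_mono_on zero_le_one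
        (Continuous.intervalIntegrable (by fun_prop) _ _)
        (Continuous.intervalIntegrable (by fun_prop) _ _) fun t ht => ?_
      rw [← sub_mul]
      refine mul_le_mul_of_nonneg_left
        (half_le_poissonIntegral hγ (by rw [abs_of_nonneg ht.1]; exact ht.2)) ?_
      rw [sub_nonneg, ← Real.rpow_natCast]
      exact Real.rpow_le_rpow_of_exponent_ge_of_imp ht.1 ht.2 (by linarith)
        (fun h1 h2 => by linarith)
    rw [Real.one_rpow, one_mul] at h1
    calc c * min 1 (x ^ (a + 1)) ≤ c * 1 := by gcongr; exact min_le_left _ _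
      _ ≤ J x := by linarith

end BesselPositivity

/-! ### The Fourier transform of the Bochner-Riesz weight. -/

section BochnerRieszWeight

variable {d : ℕ} {β : ℝ}

theorem bochnerRieszWeight_of_norm_lt {ξ : EuclideanSpace ℝ (Fin d)} (hξ : ‖ξ‖ < 1) :
    bochnerRieszWeight β ξ = (1 - ‖ξ‖ ^ 2) ^ β :=
  indicator_of_mem (mem_ball_zero_iff.2 hξ) _

theorem bochnerRieszWeight_of_le_norm {ξ : EuclideanSpace ℝ (Fin d)} (hξ : 1 ≤ ‖ξ‖) :
    bochnerRieszWeight β ξ = 0 :=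
  indicator_of_notMem (fun h => hξ.not_gt (mem_ball_zero_iff.1 h)) _

theorem bochnerRieszWeight_congr {ξ η : EuclideanSpace ℝ (Fin d)} (h : ‖ξ‖ = ‖η‖) :
    bochnerRieszWeight β ξ = bochnerRieszWeight β η := by
  rcases lt_or_ge ‖ξ‖ 1 with h1 | h1
  · rw [bochnerRieszWeight_of_norm_lt h1, bochnerRieszWeight_of_norm_lt (h ▸ h1), h]
  · rw [bochnerRieszWeight_of_le_norm h1, bochnerRieszWeight_of_le_norm (h ▸ h1)]

theorem one_sub_norm_sq_pos {ξ : EuclideanSpace ℝ (Fin d)} (hξ : ‖ξ‖ < 1) : 0 < 1 - ‖ξ‖ ^ 2 := by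
  have := pow_lt_one₀ (norm_nonneg ξ) hξ two_ne_zero
  linarith

theorem bochnerRieszWeight_nonneg (ξ : EuclideanSpace ℝ (Fin d)) : 0 ≤ bochnerRieszWeight β ξ := by
  rcases lt_or_ge ‖ξ‖ 1 with h1 | h1
  · rw [bochnerRieszWeight_of_norm_lt h1]
    exact Real.rpow_nonneg (one_sub_norm_sq_pos h1).le _
  · rw [bochnerRieszWeight_of_le_norm h1]

theorem bochnerRieszWeight_le (hβ : 0 ≤ β) (ξ : EuclideanSpace ℝ (Fin d)) :
    bochnerRieszWeight β ξ ≤ (ball (0 : EuclideanSpace ℝ (Fin d)) 1).indicator (fun _ => 1) ξ := by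
  refine indicator_le_indicator' fun hξ => ?_
  have h := one_sub_norm_sq_pos (mem_ball_zero_iff.1 hξ)
  exact Real.rpow_le_one h.le (by linarith [sq_nonneg ‖ξ‖]) hβ

theorem measurable_bochnerRieszWeight :
    Measurable (bochnerRieszWeight β : EuclideanSpace ℝ (Fin d) → ℝ) :=
  Measurable.indicator (by fun_prop) measurableSet_ball

theorem integrable_bochnerRieszWeight (hβ : 0 ≤ β) :
    Integrable (bochnerRieszWeight β : EuclideanSpace ℝ (Fin d) → ℝ) := by
  refine Integrable.mono' (g := (ball (0 : EuclideanSpace ℝ (Fin d)) 1).indicator (fun _ => 1))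
    ((integrable_indicator_iff measurableSet_ball).2 (integrableOn_const measure_ball_lt_top.ne))
    measurable_bochnerRieszWeight.aestronglyMeasurable (Filter.Eventually.of_forall fun ξ => ?_)
  rw [Real.norm_of_nonneg (bochnerRieszWeight_nonneg ξ)]
  exact bochnerRieszWeight_le hβ ξ

theorem integral_bochnerRieszWeight_pos (hβ : 0 ≤ β) :
    0 < ∫ ξ : EuclideanSpace ℝ (Fin d), bochnerRieszWeight β ξ := by
  rw [integral_pos_iff_support_of_nonneg bochnerRieszWeight_nonneg
    (integrable_bochnerRieszWeight hβ)]
  refine (measure_ball_pos volume (0 : EuclideanSpace ℝ (Fin d)) one_pos).trans_le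
    (measure_mono fun ξ hξ => ?_)
  rw [mem_ball_zero_iff] at hξ
  rw [Function.mem_support, bochnerRieszWeight_of_norm_lt hξ]
  exact (Real.rpow_pos_of_pos (one_sub_norm_sq_pos hξ) _).ne'

/-- Splitting off the first coordinate of `ℝⁿ⁺¹`. -/
noncomputable def consMeasurableEquiv (n : ℕ) :
    (ℝ × EuclideanSpace ℝ (Fin n)) ≃ᵐ EuclideanSpace ℝ (Fin (n + 1)) :=
  ((MeasurableEquiv.refl ℝ).prodCongr (MeasurableEquiv.toLp 2 (Fin n → ℝ)).symm).trans
    ((MeasurableEquiv.piFinSuccAbove (fun _ => ℝ) 0).symm.trans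
      (MeasurableEquiv.toLp 2 (Fin (n + 1) → ℝ)))

variable {n : ℕ}

theorem consMeasurableEquiv_zero (p : ℝ × EuclideanSpace ℝ (Fin n)) :
    consMeasurableEquiv n p 0 = p.1 := rfl

theorem consMeasurableEquiv_succ (p : ℝ × EuclideanSpace ℝ (Fin n)) (i : Fin n) :
    consMeasurableEquiv n p i.succ = p.2 i := rfl

theorem norm_consMeasurableEquiv_sq (p : ℝ × EuclideanSpace ℝ (Fin n)) :
    ‖consMeasurableEquiv n p‖ ^ 2 = p.1 ^ 2 + ‖p.2‖ ^ 2 := by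
  rw [EuclideanSpace.norm_sq_eq, EuclideanSpace.norm_sq_eq, Fin.sum_univ_succ]
  simp only [consMeasurableEquiv_zero, consMeasurableEquiv_succ, Real.norm_eq_abs, sq_abs]

theorem measurePreserving_consMeasurableEquiv (n : ℕ) :
    MeasurePreserving (consMeasurableEquiv n) := by
  have h1 : MeasurePreserving
      ((MeasurableEquiv.refl ℝ).prodCongr (MeasurableEquiv.toLp 2 (Fin n → ℝ)).symm)
      volume volume :=
    (MeasurePreserving.id volume).prod
      (EuclideanSpace.volume_preserving_symm_measurableEquiv_toLp (Fin n))
  have h2 := (volume_preserving_piFinSuccAbove (fun _ : Fin (n + 1) => ℝ) 0).symm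
  have h3 := PiLp.volume_preserving_toLp (Fin (n + 1))
  exact h3.comp (h2.comp h1)

/-- On the slice at first coordinate `s` the substitution `z ↦ √(1-s²) z` factors out `(1-s²)^β`
from the weight and `(1-s²)^{n/2}` from the volume. -/
theorem integral_bochnerRieszWeight_cons (s : ℝ) :
    ∫ z : EuclideanSpace ℝ (Fin n), bochnerRieszWeight β (consMeasurableEquiv n (s, z)) =
      (Ioo (-1 : ℝ) 1).indicator (fun s => (1 - s ^ 2) ^ (β + n / 2)) s *
        ∫ z : EuclideanSpace ℝ (Fin n), bochnerRieszWeight β z := by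
  by_cases hs : s ∈ Ioo (-1 : ℝ) 1
  · rw [indicator_of_mem hs]
    have h0 : 0 < 1 - s ^ 2 := by nlinarith [hs.1, hs.2]
    have hsq : √(1 - s ^ 2) ^ 2 = 1 - s ^ 2 := Real.sq_sqrt h0.le
    have hn : √(1 - s ^ 2) ^ n = (1 - s ^ 2) ^ ((n : ℝ) / 2) := by
      rw [Real.sqrt_eq_rpow, ← Real.rpow_natCast, ← Real.rpow_mul h0.le]
      congr 1
      ring
    have hpos : 0 < √(1 - s ^ 2) ^ n := pow_pos (Real.sqrt_pos.2 h0) n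
    have hw : ∀ z : EuclideanSpace ℝ (Fin n),
        bochnerRieszWeight β (consMeasurableEquiv n (s, √(1 - s ^ 2) • z)) =
          (1 - s ^ 2) ^ β * bochnerRieszWeight β z := by
      intro z
      have hz : ‖consMeasurableEquiv n (s, √(1 - s ^ 2) • z)‖ ^ 2 =
          1 - (1 - s ^ 2) * (1 - ‖z‖ ^ 2) := by
        rw [norm_consMeasurableEquiv_sq, norm_smul, mul_pow, Real.norm_eq_abs, sq_abs, hsq]
        ring
      rcases lt_or_ge ‖z‖ 1 with h1 | h1
      · have h2 := one_sub_norm_sq_pos h1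
        rw [bochnerRieszWeight_of_norm_lt h1, bochnerRieszWeight_of_norm_lt, hz, sub_sub_cancel,
          Real.mul_rpow h0.le h2.le]
        refine (sq_lt_one_iff₀ (norm_nonneg _)).1 ?_
        rw [hz]
        linarith [mul_pos h0 h2]
      · rw [bochnerRieszWeight_of_le_norm h1, bochnerRieszWeight_of_le_norm, mul_zero]
        refine (one_le_sq_iff₀ (norm_nonneg _)).1 ?_
        rw [hz]
        have := (one_le_sq_iff₀ (norm_nonneg _)).2 h1
        nlinarith
    have h := Measure.integral_comp_smul volume
      (fun z : EuclideanSpace ℝ (Fin n) => bochnerRieszWeight β (consMeasurableEquiv n (s, z)))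
      (√(1 - s ^ 2))
    simp only [hw] at h
    rw [integral_const_mul, finrank_euclideanSpace_fin, abs_of_pos (inv_pos.2 hpos), smul_eq_mul,
      eq_inv_mul_iff_mul_eq₀ hpos.ne'] at h
    rw [← h, hn, Real.rpow_add h0]
    ring
  · rw [indicator_of_notMem hs, zero_mul]
    refine integral_eq_zero_of_ae (Filter.Eventually.of_forall fun z => ?_)
    refine bochnerRieszWeight_of_le_norm ((one_le_sq_iff₀ (norm_nonneg _)).1 ?_)
    rw [norm_consMeasurableEquiv_sq]
    have h1 : 1 ≤ s ^ 2 := by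
      by_contra! h
      exact hs (abs_lt.1 ((sq_lt_one_iff_abs_lt_one s).1 h))
    have := sq_nonneg ‖z‖
    simp only
    linarith

theorem fourier_comp_isometry (f : EuclideanSpace ℝ (Fin d) → ℂ)
    (A : EuclideanSpace ℝ (Fin d) ≃ₗᵢ[ℝ] EuclideanSpace ℝ (Fin d)) (hf : ∀ x, f (A x) = f x)
    (ξ : EuclideanSpace ℝ (Fin d)) : 𝓕 f (A ξ) = 𝓕 f ξ := by
  have h := Real.fourier_comp_linearIsometry A f ξ
  rw [← h, show f ∘ A = f from funext hf]

theorem fourier_bochnerRieszWeight_congr {x y : EuclideanSpace ℝ (Fin d)} (h : ‖x‖ = ‖y‖) :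
    𝓕 (fun ξ : EuclideanSpace ℝ (Fin d) => (bochnerRieszWeight β ξ : ℂ)) x =
      𝓕 (fun ξ : EuclideanSpace ℝ (Fin d) => (bochnerRieszWeight β ξ : ℂ)) y := by
  rw [← Submodule.reflection_sub h]
  refine (fourier_comp_isometry _ _ (fun ξ => ?_) x).symm
  rw [bochnerRieszWeight_congr (LinearIsometryEquiv.norm_map _ _)]

/-- Averaging the integrand over `s ↦ -s` removes the odd sine part. -/
theorem integral_exp_eq_poissonIntegral {γ : ℝ} (hγ : 0 ≤ γ) (ρ : ℝ) :
    ∫ s in (-1 : ℝ)..1, Complex.exp (-(ρ * s : ℝ) * Complex.I) * ((1 - s ^ 2) ^ γ : ℝ) =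
      poissonIntegral γ ρ := by
  have hw := continuous_one_sub_sq_rpow hγ
  have hc : Continuous fun s : ℝ =>
      Complex.exp (-(ρ * s : ℝ) * Complex.I) * ((1 - s ^ 2) ^ γ : ℝ) := by fun_prop
  have h := intervalIntegral.integral_comp_neg (a := -1) (b := 1) fun s : ℝ =>
      Complex.exp (-(ρ * s : ℝ) * Complex.I) * ((1 - s ^ 2) ^ γ : ℝ)
  rw [neg_neg] at h
  have h2 : (2 : ℂ) * ∫ s in (-1 : ℝ)..1,
      Complex.exp (-(ρ * s : ℝ) * Complex.I) * ((1 - s ^ 2) ^ γ : ℝ) =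
      2 * poissonIntegral γ ρ := by
    rw [two_mul]
    nth_rewrite 1 [← h]
    rw [← intervalIntegral.integral_add (Continuous.intervalIntegrable (by fun_prop) _ _)
      (hc.intervalIntegrable _ _), poissonIntegral, ← intervalIntegral.integral_ofReal,
      ← intervalIntegral.integral_const_mul]
    refine intervalIntegral.integral_congr fun s _ => ?_
    rw [Complex.ofReal_mul ((1 - s ^ 2) ^ γ), Complex.ofReal_cos, neg_sq]
    have h3 := Complex.two_cos (ρ * s : ℝ)
    have h4 : (-(ρ * -s : ℝ) : ℂ) * Complex.I = (ρ * s : ℝ) * Complex.I := by push_cast; ring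
    rw [h4]
    linear_combination (-((1 - s ^ 2) ^ γ : ℝ) : ℂ) * h3
  exact mul_left_cancel₀ two_ne_zero h2

/-- By rotation invariance `x` may be placed on the first axis. The phase then depends on the first
coordinate only, and integrating out the others raises the exponent to `β + n/2`. -/
theorem fourier_bochnerRieszWeight (hβ : 0 ≤ β) (x : EuclideanSpace ℝ (Fin (n + 1))) :
    𝓕 (fun ξ : EuclideanSpace ℝ (Fin (n + 1)) => (bochnerRieszWeight β ξ : ℂ)) x =
      (((∫ z : EuclideanSpace ℝ (Fin n), bochnerRieszWeight β z) *
        poissonIntegral (β + n / 2) (2 * Real.pi * ‖x‖) : ℝ) : ℂ) := by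
  have hγ : 0 ≤ β + n / 2 := by positivity
  have hx : ‖x‖ = ‖EuclideanSpace.single (0 : Fin (n + 1)) ‖x‖‖ := by simp
  rw [fourier_bochnerRieszWeight_congr hx, Real.fourier_eq',
    ← (measurePreserving_consMeasurableEquiv n).integral_comp' , Measure.volume_eq_prod,
    integral_prod]
  · have h1 : ∀ s : ℝ, ∀ z : EuclideanSpace ℝ (Fin n), Complex.exp (↑(-2 * Real.pi *
        inner ℝ (consMeasurableEquiv n (s, z)) (EuclideanSpace.single (0 : Fin (n + 1)) ‖x‖)) *
          Complex.I) • (bochnerRieszWeight β (consMeasurableEquiv n (s, z)) : ℂ) =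
        Complex.exp (-((2 * Real.pi * ‖x‖) * s : ℝ) * Complex.I) *
          (bochnerRieszWeight β (consMeasurableEquiv n (s, z)) : ℂ) := by
      intro s z
      rw [EuclideanSpace.inner_single_right, consMeasurableEquiv_zero, smul_eq_mul]
      congr 3
      simp
      ring
    simp only [h1, integral_const_mul, integral_complex_ofReal, integral_bochnerRieszWeight_cons]
    rw [Complex.ofReal_mul, ← integral_exp_eq_poissonIntegral hγ,
      intervalIntegral.integral_of_le (by norm_num), integral_Ioc_eq_integral_Ioo,
      ← integral_indicator measurableSet_Ioo, ← integral_const_mul]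
    refine integral_congr_ae (Filter.Eventually.of_forall fun s => ?_)
    by_cases hs : s ∈ Ioo (-1 : ℝ) 1
    · simp only [indicator_of_mem hs]
      push_cast
      ring
    · simp only [indicator_of_notMem hs]
      simp
  · have hw : Integrable fun ξ : EuclideanSpace ℝ (Fin (n + 1)) =>
        (bochnerRieszWeight β ξ : ℂ) := (integrable_bochnerRieszWeight hβ).ofReal
    have h2 := hw.bdd_mul (f := fun ξ => Complex.exp (↑(-2 * Real.pi *
      inner ℝ ξ (EuclideanSpace.single (0 : Fin (n + 1)) ‖x‖)) * Complex.I)) (c := 1)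
      (Continuous.aestronglyMeasurable (by fun_prop))
      (Filter.Eventually.of_forall fun ξ => by rw [Complex.norm_exp_ofReal_mul_I])
    exact ((measurePreserving_consMeasurableEquiv n).integrable_comp_emb
      (consMeasurableEquiv n).measurableEmbedding).2 h2

end BochnerRieszWeight

/-! ### Pairing a rearrangement with a radial weight. -/

section RadialWeights

variable {d : ℕ}

theorem integral_nonneg_iff_lintegral_le {α : Type*} [MeasurableSpace α] {μ : Measure α}
    {h : α → ℝ} (hh : Integrable h μ) :
    0 ≤ ∫ x, h x ∂μ ↔ ∫⁻ x, ENNReal.ofReal (-h x) ∂μ ≤ ∫⁻ x, ENNReal.ofReal (h x) ∂μ := by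
  have h1 : ∫⁻ x, ENNReal.ofReal (h x) ∂μ ≠ ∞ := hh.lintegral_lt_top.ne
  have h2 : ∫⁻ x, ENNReal.ofReal (-h x) ∂μ ≠ ∞ := hh.neg.lintegral_lt_top.ne
  rw [integral_eq_lintegral_pos_part_sub_lintegral_neg_part hh, sub_nonneg,
    ENNReal.toReal_le_toReal h2 h1]

theorem level_symmRearr_ae_eq (hd : d ≠ 0) (f : L2Space d) {s : ℝ} (hs : 0 < s) :
    {x | s < symmRearr f x} =ᵐ[volume] symmRearrSet {y | s < ‖f y‖} := by
  refine ae_eq_of_subset_of_measure_ge (level_symmRearr_subset f hs) ?_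
    (measurableSet_lt measurable_const (measurable_symmRearr f)).nullMeasurableSet
    measure_ball_lt_top.ne
  rw [volume_level_symmRearr hd f hs, volume_symmRearrSet hd (volume_level_ne_top f hs)]

/-- The layer-cake formula for the measure with density `V`: the superlevel sets of `f*` are centred
balls up to null sets. -/
theorem lintegral_mul_symmRearr (hd : d ≠ 0) (f : L2Space d)
    {V : EuclideanSpace ℝ (Fin d) → ℝ≥0∞} (hV : Measurable V) :
    ∫⁻ x, V x * ENNReal.ofReal (symmRearr f x) =
      ∫⁻ s in Ioi (0 : ℝ), ∫⁻ x in symmRearrSet {y | s < ‖f y‖}, V x := by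
  have hm := measurable_symmRearr f
  have h := lintegral_withDensity_eq_lintegral_mul volume hV (hm.ennreal_ofReal)
  simp only [Pi.mul_apply] at h
  rw [← h, lintegral_eq_lintegral_meas_lt _ (Filter.Eventually.of_forall (symmRearr_nonneg f))
    hm.aemeasurable]
  refine setLIntegral_congr_fun measurableSet_Ioi fun s hs => ?_
  rw [withDensity_apply _ (measurableSet_lt measurable_const hm)]
  exact setLIntegral_congr (level_symmRearr_ae_eq hd f hs)

/-- `f*` is a nonnegative superposition of indicators of centred balls, and `V` has nonnegative
integral over each of them. The positive and negative parts of `V` are treated separately so that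
Tonelli applies. -/
theorem integral_symmRearr_mul_nonneg (hd : d ≠ 0) (f : L2Space d)
    (hg : Integrable (symmRearr f)) {V : EuclideanSpace ℝ (Fin d) → ℝ} (hV : Measurable V)
    {M : ℝ} (hM : ∀ x, |V x| ≤ M) (h : ∀ R, 0 ≤ ∫ x in ball 0 R, V x) :
    0 ≤ ∫ x, symmRearr f x * V x := by
  have hi : Integrable fun x => symmRearr f x * V x :=
    hg.mul_bdd (c := M) hV.aestronglyMeasurable (Filter.Eventually.of_forall hM)
  rw [integral_nonneg_iff_lintegral_le hi]
  have e1 : ∀ x, ENNReal.ofReal (symmRearr f x * V x) =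
      ENNReal.ofReal (V x) * ENNReal.ofReal (symmRearr f x) := fun x => by
    rw [mul_comm, ENNReal.ofReal_mul' (symmRearr_nonneg f x)]
  have e2 : ∀ x, ENNReal.ofReal (-(symmRearr f x * V x)) =
      ENNReal.ofReal (-V x) * ENNReal.ofReal (symmRearr f x) := fun x => by
    rw [← mul_neg, mul_comm, ENNReal.ofReal_mul' (symmRearr_nonneg f x)]
  simp only [e1, e2]
  rw [lintegral_mul_symmRearr hd f hV.ennreal_ofReal,
    lintegral_mul_symmRearr hd f (V := fun x => ENNReal.ofReal (-V x)) hV.neg.ennreal_ofReal]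
  refine lintegral_mono fun s => ?_
  refine (integral_nonneg_iff_lintegral_le ?_).1 (h _)
  exact Integrable.mono' (integrableOn_const (C := M) measure_ball_lt_top.ne)
    hV.aestronglyMeasurable (Filter.Eventually.of_forall hM)

theorem setIntegral_ball_radial {n : ℕ} (u : ℝ → ℝ) {R : ℝ} (hR : 0 ≤ R) :
    ∫ x in ball (0 : EuclideanSpace ℝ (Fin (n + 1))) R, u ‖x‖ =
      (n + 1) * volume.real (ball (0 : EuclideanSpace ℝ (Fin (n + 1))) 1) *
        ∫ ρ in 0..R, ρ ^ n * u ρ := by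
  have h := integral_fun_norm_addHaar (volume : Measure (EuclideanSpace ℝ (Fin (n + 1))))
    ((Iio R).indicator u)
  rw [← integral_indicator measurableSet_ball]
  have e1 : ∀ x : EuclideanSpace ℝ (Fin (n + 1)),
      (ball (0 : EuclideanSpace ℝ (Fin (n + 1))) R).indicator (fun x => u ‖x‖) x =
        (Iio R).indicator u ‖x‖ := by
    intro x
    simp only [indicator, mem_ball_zero_iff, mem_Iio]
  simp only [e1]
  rw [h, finrank_euclideanSpace_fin, intervalIntegral.integral_of_le hR,
    integral_Ioc_eq_integral_Ioo, Nat.add_sub_cancel]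
  have e2 : ∫ y in Ioi (0 : ℝ), y ^ n • (Iio R).indicator u y = ∫ ρ in Ioo 0 R, ρ ^ n * u ρ := by
    rw [← Ioi_inter_Iio, ← setIntegral_indicator measurableSet_Iio]
    refine integral_congr_ae (Filter.Eventually.of_forall fun y => ?_)
    simp [indicator]
  rw [e2]
  simp
  ring

/-- Polar coordinates reduce this to the weighted Bessel integral with power `n` and `γ = β + n/2`.
The requirement `n ≤ γ` is precisely `β ≥ n/2`. -/
theorem exists_le_setIntegral_fourier_bochnerRieszWeight {n : ℕ} {β : ℝ} (hβ : (n : ℝ) / 2 ≤ β) :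
    ∃ c, 0 < c ∧ ∀ R, c * volume.real (ball (0 : EuclideanSpace ℝ (Fin (n + 1))) 1 ∩ ball 0 R) ≤
      ∫ x in ball (0 : EuclideanSpace ℝ (Fin (n + 1))) R,
        (∫ z : EuclideanSpace ℝ (Fin n), bochnerRieszWeight β z) *
          poissonIntegral (β + n / 2) (2 * Real.pi * ‖x‖) := by
  have hn : (0 : ℝ) ≤ n := n.cast_nonneg
  have hβ0 : 0 ≤ β := by linarith
  obtain ⟨c, hc, hcx⟩ := exists_le_integral_pow_mul_poissonIntegral (γ := β + n / 2) (a := n)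
    (by linarith)
  have hκ := integral_bochnerRieszWeight_pos (d := n) hβ0
  set κ := ∫ z : EuclideanSpace ℝ (Fin n), bochnerRieszWeight β z
  set ω := volume.real (ball (0 : EuclideanSpace ℝ (Fin (n + 1))) 1) with hω
  have hω0 : 0 < ω := volume_real_unitBall_pos
  have hπ := Real.pi_pos
  refine ⟨(n + 1) * κ * c / (2 * Real.pi) ^ (n + 1), by positivity, fun R => ?_⟩
  rcases lt_or_ge R 0 with hR | hR
  · simp [ball_eq_empty.2 hR.le]
  rw [setIntegral_ball_radial (fun ρ => κ * poissonIntegral (β + n / 2) (2 * Real.pi * ρ)) hR]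
  have e1 : ball (0 : EuclideanSpace ℝ (Fin (n + 1))) 1 ∩ ball 0 R = ball 0 (min 1 R) := by
    ext x
    simp
  rw [e1, volume_real_ball_eq n.succ_ne_zero (by positivity), ← hω]
  have e2 : ∫ ρ in 0..R, ρ ^ n * (κ * poissonIntegral (β + n / 2) (2 * Real.pi * ρ)) =
      κ / (2 * Real.pi) ^ (n + 1) *
        ∫ t in 0..(2 * Real.pi * R), t ^ n * poissonIntegral (β + n / 2) t := by
    have h := intervalIntegral.integral_comp_mul_left (a := 0) (b := R)
      (fun t => t ^ n * poissonIntegral (β + n / 2) t) (c := 2 * Real.pi) (by positivity)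
    rw [mul_zero, smul_eq_mul, eq_inv_mul_iff_mul_eq₀ (by positivity)] at h
    rw [← h, ← intervalIntegral.integral_const_mul, ← intervalIntegral.integral_const_mul]
    refine intervalIntegral.integral_congr fun ρ _ => ?_
    rw [mul_pow (2 * Real.pi) ρ n, pow_succ]
    field_simp
  rw [e2]
  have h1 := hcx (2 * Real.pi * R) (by positivity)
  have h2 : min 1 R ^ (n + 1) ≤ min 1 ((2 * Real.pi * R) ^ (n + 1)) := by
    refine le_min (pow_le_one₀ (by positivity) (min_le_left _ _)) ?_
    refine pow_le_pow_left₀ (by positivity) ((min_le_right _ _).trans ?_) _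
    nlinarith [Real.pi_gt_three]
  calc (n + 1) * κ * c / (2 * Real.pi) ^ (n + 1) * (min 1 R ^ (n + 1) * ω)
      = (n + 1) * ω * (κ / (2 * Real.pi) ^ (n + 1) * (c * min 1 R ^ (n + 1))) := by ring
    _ ≤ _ := by
        gcongr
        exact (mul_le_mul_of_nonneg_left h2 hc.le).trans h1

theorem integrable_of_support {f : L2Space d} {S : ℝ}
    (hf : volume {x | f x ≠ 0} ≤ ENNReal.ofReal S) : Integrable f := by
  have hm : MeasurableSet {x | f x ≠ 0} :=
    ((Lp.stronglyMeasurable f).measurable (measurableSet_singleton 0)).compl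
  have hi : IntegrableOn f {x | f x ≠ 0} := by
    have : IsFiniteMeasure (volume.restrict {x | f x ≠ 0}) :=
      ⟨by rw [Measure.restrict_apply_univ]; exact hf.trans_lt ENNReal.ofReal_lt_top⟩
    exact ((Lp.memLp f).restrict _).integrable (by norm_num)
  refine (integrableOn_iff_integrable_of_support_subset ?_).1 hi
  exact fun x hx => hx

theorem integrable_symmRearr (hd : d ≠ 0) {f : L2Space d} (hf : Integrable f) :
    Integrable (symmRearr f) := by
  refine ⟨(measurable_symmRearr f).aestronglyMeasurable, ?_⟩
  have h := lintegral_sub_symmRearr hd f le_rfl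
  simp only [sub_zero, max_eq_left (norm_nonneg _), max_eq_left (symmRearr_nonneg f _)] at h
  rw [hasFiniteIntegral_iff_ofReal (Filter.Eventually.of_forall (symmRearr_nonneg f)), ← h]
  exact hf.norm.lintegral_lt_top

/-- Moving the transform onto the weight gives the pairing of `f*` with the real function `V`. The
difference of `V` and `c` times the indicator of `B(0,1)` has nonnegative integral over every
centred ball. -/
theorem exists_le_bochnerRieszIntegral (hd : d ≠ 0) {β : ℝ} (hβ : ((d : ℝ) - 1) / 2 ≤ β) :
    ∃ c, 0 < c ∧ ∀ f : L2Space d, Integrable f →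
      (bochnerRieszIntegral β (rearrL2 f)).im = 0 ∧
      c * ∫ x in ball 0 1, symmRearr f x ≤ (bochnerRieszIntegral β (rearrL2 f)).re := by
  obtain ⟨n, rfl⟩ := Nat.exists_eq_succ_of_ne_zero hd
  rw [Nat.succ_eq_add_one] at *
  have hn : (0 : ℝ) ≤ n := n.cast_nonneg
  push_cast at hβ
  rw [add_sub_cancel_right] at hβ
  have hβ0 : 0 ≤ β := by linarith
  have hγ : 0 ≤ β + n / 2 := by linarith
  obtain ⟨c, hc, hcR⟩ := exists_le_setIntegral_fourier_bochnerRieszWeight hβ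
  refine ⟨c, hc, fun f hf => ?_⟩
  have hg := integrable_symmRearr hd hf
  set κ := ∫ z : EuclideanSpace ℝ (Fin n), bochnerRieszWeight β z
  set V : EuclideanSpace ℝ (Fin (n + 1)) → ℝ :=
    fun x => κ * poissonIntegral (β + n / 2) (2 * Real.pi * ‖x‖)
  have hw : Integrable fun ξ : EuclideanSpace ℝ (Fin (n + 1)) =>
    (bochnerRieszWeight β ξ : ℂ) := (integrable_bochnerRieszWeight hβ0).ofReal
  have hVw : ∀ x, 𝓕 (fun ξ : EuclideanSpace ℝ (Fin (n + 1)) =>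
      (bochnerRieszWeight β ξ : ℂ)) x = (V x : ℂ) := fourier_bochnerRieszWeight hβ0
  have hVc : Continuous V :=
    continuous_const.mul ((continuous_poissonIntegral hγ).comp (by fun_prop))
  obtain ⟨M, hM⟩ : ∃ M, ∀ x, |V x| ≤ M := by
    refine ⟨∫ ξ : EuclideanSpace ℝ (Fin (n + 1)), ‖(bochnerRieszWeight β ξ : ℂ)‖, fun x => ?_⟩
    rw [← Real.norm_eq_abs, ← Complex.norm_real, ← hVw]
    exact norm_fourier_le _ x
  have hbr : bochnerRieszIntegral β (rearrL2 f) = ((∫ x, symmRearr f x * V x : ℝ) : ℂ) := by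
    rw [bochnerRieszIntegral, ← integral_complex_ofReal]
    have hgc : Integrable fun x => (symmRearr f x : ℂ) := hg.ofReal
    have h1 := fourier_toLp_ae_eq hgc (memLp_symmRearr f)
    calc ∫ ξ, (bochnerRieszWeight β ξ : ℂ) * (𝓕 (rearrL2 f) : L2Space (n + 1)) ξ
        = ∫ ξ, 𝓕 (fun x => (symmRearr f x : ℂ)) ξ * (bochnerRieszWeight β ξ : ℂ) := by
          refine integral_congr_ae (h1.mono fun ξ hξ => ?_)
          simp only [rearrL2]
          rw [hξ, mul_comm]
      _ = ∫ x, (symmRearr f x : ℂ) * (V x : ℂ) := by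
          rw [integral_fourier_mul_eq hgc hw]
          simp only [hVw]
      _ = _ := by simp only [Complex.ofReal_mul]
  rw [hbr, Complex.ofReal_im, Complex.ofReal_re]
  refine ⟨rfl, ?_⟩
  have hI : Measurable ((ball (0 : EuclideanSpace ℝ (Fin (n + 1))) 1).indicator fun _ => c) :=
    measurable_const.indicator measurableSet_ball
  have hI1 : ∀ x, |(ball (0 : EuclideanSpace ℝ (Fin (n + 1))) 1).indicator (fun _ => c) x| ≤ c := by
    intro x
    by_cases hx : x ∈ ball (0 : EuclideanSpace ℝ (Fin (n + 1))) 1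
    · rw [indicator_of_mem hx, abs_of_pos hc]
    · rw [indicator_of_notMem hx, abs_zero]
      exact hc.le
  have hmain := integral_symmRearr_mul_nonneg hd f hg (hVc.measurable.sub hI) (M := M + c)
    (fun x => (abs_sub _ _).trans (add_le_add (hM x) (hI1 x))) fun R => by
      simp only [Pi.sub_apply]
      rw [integral_sub, setIntegral_indicator measurableSet_ball, setIntegral_const, smul_eq_mul,
        inter_comm, sub_nonneg, mul_comm]
      · exact hcR R
      · exact Integrable.mono' (integrableOn_const (C := M) measure_ball_lt_top.ne)
          hVc.aestronglyMeasurable (Filter.Eventually.of_forall hM)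
      · exact Integrable.mono' (integrableOn_const (C := c) measure_ball_lt_top.ne)
          hI.aestronglyMeasurable (Filter.Eventually.of_forall hI1)
  simp only [Pi.sub_apply, mul_sub] at hmain
  rw [integral_sub (hg.mul_bdd (c := M) hVc.aestronglyMeasurable (Filter.Eventually.of_forall hM))
    (hg.mul_bdd (c := c) hI.aestronglyMeasurable (Filter.Eventually.of_forall hI1)), sub_nonneg] at hmain
  refine le_trans (le_of_eq ?_) hmain
  rw [← integral_const_mul, ← integral_indicator measurableSet_ball]
  refine integral_congr_ae (Filter.Eventually.of_forall fun x => ?_)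
  by_cases hx : x ∈ ball (0 : EuclideanSpace ℝ (Fin (n + 1))) 1
  · simp only [indicator_of_mem hx, mul_comm]
  · simp only [indicator_of_notMem hx, mul_zero]

end RadialWeights

/-! ### Rearrangement estimates for operators bounded on `L²` and from `L¹` to `L^∞`. -/

section RearrangementEstimates

variable {d : ℕ}

/-- With `r = √(d+1)/σ` the hypothesis makes `K²|A|` a constant multiple of `r^{-d}`. The upper
bound by splitting and the lower bound by Gaussians then both have the size of `r^{-d} M² + ωQ`. -/
theorem exists_setIntegral_sq_le (hd : d ≠ 0) :
    ∃ C : ℝ, 0 < C ∧ ∀ (T : L2Space d →ₗ[ℂ] L2Space d) (K : ℝ), 0 < K → (∀ h, ‖T h‖ ≤ ‖h‖) →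
      (∀ h : L2Space d, Integrable h → ∀ᵐ x, ‖T h x‖ ≤ K * ∫ y, ‖h y‖) →
      ∀ (f : L2Space d) (A : Set (EuclideanSpace ℝ (Fin d))), volume A ≠ ∞ → ∀ σ : ℝ, 0 ≤ σ →
      K ^ 2 * volume.real A = σ ^ d * volume.real (ball (0 : EuclideanSpace ℝ (Fin d)) 1) →
      ∫ x in A, ‖T f x‖ ^ 2 ≤ C * ∫ ξ in ball 0 σ, ‖(𝓕 (rearrL2 f) : L2Space d) ξ‖ ^ 2 := by
  set ω := volume.real (ball (0 : EuclideanSpace ℝ (Fin d)) 1) with hω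
  have hω0 : 0 < ω := volume_real_unitBall_pos
  set e := Real.exp (-(4 * Real.pi)) / 4 with he
  have he0 : 0 < e := by positivity
  set C₁ := 2 * (√(d + 1) ^ d * ω + ω⁻¹) with hC₁
  refine ⟨C₁ / e, by positivity, fun T K hK hT₂ hT₁ f A hA σ hσ hKA => ?_⟩
  -- For `σ = 0` no radius `r` is available, but then `A` is a null set because `K > 0`.
  rcases hσ.eq_or_lt with rfl | hσ0
  · have hA0 : volume.real A = 0 := by
      rw [zero_pow hd, zero_mul] at hKA
      exact (mul_eq_zero.1 hKA).resolve_left (by positivity)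
    rw [setIntegral_measure_zero _ ((measureReal_eq_zero_iff hA).1 hA0)]
    positivity
  obtain ⟨r, hr⟩ : ∃ r, r = √(d + 1) / σ := ⟨_, rfl⟩
  have hr0 : 0 < r := by rw [hr]; positivity
  obtain ⟨c, hc, hcr, hcM⟩ := exists_threshold hd f hr0
  have h1 := setIntegral_sq_le_of_weakType hd T hT₂ hT₁ f hA hK.le hc hcr
  have h2 := integral_min_sq_le hd f hc hr0 hcM
  have h3 := le_setIntegral_norm_fourier_rearrL2_sq hd f hσ0 hr
  rw [← he, ← hω] at h3
  rw [volume_real_ball_eq hd hr0.le, ← hω] at h2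
  have hσr : σ ^ d = √(d + 1) ^ d / r ^ d := by
    rw [hr, div_pow]
    field_simp
  set M := ∫ x in ball 0 r, symmRearr f x
  set Q := ∫ x in (ball 0 r)ᶜ, symmRearr f x ^ 2
  have hQ : 0 ≤ Q := integral_nonneg fun x => sq_nonneg _
  set F := ∫ ξ in ball 0 σ, ‖(𝓕 (rearrL2 f) : L2Space d) ξ‖ ^ 2
  rw [hKA, hσr] at h1
  have h4 : 2 * (√(d + 1) ^ d / r ^ d * ω * M ^ 2) + 2 * ((r ^ d * ω)⁻¹ * M ^ 2 + Q) ≤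
      C₁ * (M ^ 2 / r ^ d + ω * Q) := by
    have e1 : C₁ * (M ^ 2 / r ^ d + ω * Q) =
        2 * (√(d + 1) ^ d / r ^ d * ω * M ^ 2) + 2 * ((r ^ d * ω)⁻¹ * M ^ 2 + Q) +
          2 * (√(d + 1) ^ d * ω * ω * Q) := by
      rw [hC₁]
      field_simp
      ring
    rw [e1]
    exact le_add_of_nonneg_right (by positivity)
  calc ∫ x in A, ‖T f x‖ ^ 2 ≤ C₁ * (M ^ 2 / r ^ d + ω * Q) := by linarith
    _ = C₁ / e * (e * (M ^ 2 / r ^ d + ω * Q)) := by field_simp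
    _ ≤ C₁ / e * F := by gcongr

theorem setIntegral_norm_le_sqrt (f : L2Space d) {A : Set (EuclideanSpace ℝ (Fin d))}
    (hA : volume A ≠ ∞) :
    ∫ x in A, ‖f x‖ ≤ √(volume.real A) * √(∫ x in A, ‖f x‖ ^ 2) := by
  have hfin : IsFiniteMeasure (volume.restrict A) :=
    ⟨by rw [Measure.restrict_apply_univ]; exact hA.lt_top⟩
  have hsq : IntegrableOn (fun x => ‖f x‖ ^ 2) A := (L2Space.integrable_norm_sq f).integrableOn
  have hi : IntegrableOn (fun x => ‖f x‖) A :=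
    (((Lp.memLp f).restrict A).integrable (by norm_num)).norm
  rw [← Real.sqrt_mul measureReal_nonneg]
  refine Real.le_sqrt_of_sq_le ?_
  set m := ∫ x in A, ‖f x‖
  -- Cauchy-Schwarz as nonnegativity of a variance.
  have key : 0 ≤ ∫ x in A, (volume.real A * ‖f x‖ - m) ^ 2 :=
    integral_nonneg fun x => sq_nonneg _
  have e1 : ∀ x, (volume.real A * ‖f x‖ - m) ^ 2 =
      volume.real A ^ 2 * ‖f x‖ ^ 2 - 2 * m * volume.real A * ‖f x‖ + m ^ 2 := fun x => by ring
  simp only [e1] at key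
  rw [integral_add (by exact (hsq.const_mul _).sub (hi.const_mul _)) (integrable_const _),
    integral_sub (hsq.const_mul _) (hi.const_mul _), integral_const_mul, integral_const_mul,
    setIntegral_const, smul_eq_mul] at key
  have hA0 : 0 ≤ volume.real A := measureReal_nonneg
  rcases hA0.eq_or_lt with h0 | h0
  · have : m = 0 := setIntegral_measure_zero _ ((measureReal_eq_zero_iff hA).1 h0.symm)
    rw [this, ← h0]
    simp
  · refine le_of_mul_le_mul_left ?_ h0
    nlinarith [key]

/-- Splitting is done at radius 1, with `c ≤ M/ω`. The support bound controls the low part by `S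
c²`, so everything is a multiple of `M²`, and the Bochner-Riesz integral dominates `M`. Its
nonnegativity is recorded so that the other factors may later be enlarged. -/
theorem exists_setIntegral_norm_le (hd : d ≠ 0) {β : ℝ} (hβ : ((d : ℝ) - 1) / 2 ≤ β) :
    ∃ C : ℝ, 0 < C ∧ ∀ (f : L2Space d) (S : ℝ), 0 ≤ S →
      volume {x | f x ≠ 0} ≤ ENNReal.ofReal S →
      (bochnerRieszIntegral β (rearrL2 f)).im = 0 ∧
      0 ≤ (bochnerRieszIntegral β (rearrL2 f)).re ∧
      ∀ (T : L2Space d →ₗ[ℂ] L2Space d) (K : ℝ), 0 ≤ K → (∀ h, ‖T h‖ ≤ ‖h‖) →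
      (∀ h : L2Space d, Integrable h → ∀ᵐ x, ‖T h x‖ ≤ K * ∫ y, ‖h y‖) →
      ∀ A : Set (EuclideanSpace ℝ (Fin d)), volume A ≠ ∞ →
      ∫ x in A, ‖T f x‖ ≤ C * √(volume.real A) * √(1 + K ^ 2 * volume.real A) * √(1 + S) *
        (bochnerRieszIntegral β (rearrL2 f)).re := by
  set ω := volume.real (ball (0 : EuclideanSpace ℝ (Fin d)) 1) with hω
  have hω0 : 0 < ω := volume_real_unitBall_pos
  obtain ⟨c₀, hc₀, hbr⟩ := exists_le_bochnerRieszIntegral hd hβ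
  refine ⟨√(2 * (1 + (ω⁻¹) ^ 2)) / c₀, by positivity, fun f S hS hf => ?_⟩
  obtain ⟨him, hre⟩ := hbr f (integrable_of_support hf)
  set B := (bochnerRieszIntegral β (rearrL2 f)).re
  obtain ⟨c, hc, hcr, hcM⟩ := exists_threshold hd f one_pos
  rw [← hω] at hcM
  set M := ∫ x in ball 0 1, symmRearr f x
  have hM : 0 ≤ M := integral_nonneg fun x => symmRearr_nonneg f x
  refine ⟨him, (mul_nonneg hc₀.le hM).trans hre, fun T K hK hT₂ hT₁ A hA => ?_⟩
  have h1 := setIntegral_sq_le_of_weakType hd T hT₂ hT₁ f hA hK hc hcr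
  have h2 := integral_min_sq_le_of_support f hc hS hf
  have hA0 : 0 ≤ volume.real A := measureReal_nonneg
  have hX : 0 ≤ K ^ 2 * volume.real A := by positivity
  have hc2 : c ≤ ω⁻¹ * M := by
    rw [inv_mul_eq_div, le_div_iff₀ hω0]
    exact hcM
  have h3 : ∫ x in A, ‖T f x‖ ^ 2 ≤
      2 * (1 + (ω⁻¹) ^ 2) * (1 + K ^ 2 * volume.real A) * (1 + S) * M ^ 2 := by
    set X := K ^ 2 * volume.real A
    have h4 : S * c ^ 2 ≤ S * (ω⁻¹ * M) ^ 2 := by gcongr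
    calc ∫ x in A, ‖T f x‖ ^ 2 ≤ 2 * (X * M ^ 2) + 2 * (S * (ω⁻¹ * M) ^ 2) := by linarith
      _ ≤ 2 * (X * M ^ 2) + 2 * (S * (ω⁻¹ * M) ^ 2) +
          2 * (1 + X * S + S + (ω⁻¹) ^ 2 * (1 + X + X * S)) * M ^ 2 :=
        le_add_of_nonneg_right (by positivity)
      _ = _ := by ring
  have hM2 : M ≤ B / c₀ := by
    rw [le_div_iff₀ hc₀, mul_comm]
    exact hre
  calc ∫ x in A, ‖T f x‖ ≤ √(volume.real A) * √(∫ x in A, ‖T f x‖ ^ 2) :=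
        setIntegral_norm_le_sqrt _ hA
    _ ≤ √(volume.real A) *
          √(2 * (1 + (ω⁻¹) ^ 2) * (1 + K ^ 2 * volume.real A) * (1 + S) * M ^ 2) := by gcongr
    _ = √(volume.real A) * (√(2 * (1 + (ω⁻¹) ^ 2)) * √(1 + K ^ 2 * volume.real A) *
          √(1 + S) * M) := by
        rw [Real.sqrt_mul (by positivity), Real.sqrt_mul (by positivity),
          Real.sqrt_mul (by positivity), Real.sqrt_sq hM]
    _ ≤ √(volume.real A) * (√(2 * (1 + (ω⁻¹) ^ 2)) * √(1 + K ^ 2 * volume.real A) *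
          √(1 + S) * (B / c₀)) := by gcongr
    _ = _ := by ring

/-- The inverse Fourier transform after multiplication by `exp (-π z |ξ|²)`. -/
noncomputable def fourierInvGaussianMul (z : ℂ) (hz : 0 ≤ z.re) : L2Space d →ₗ[ℂ] L2Space d :=
  (Lp.fourierTransformₗᵢ (EuclideanSpace ℝ (Fin d)) ℂ).symm.toLinearEquiv.toLinearMap ∘ₗ
    gaussianMul z hz

theorem fourierInvGaussianMul_apply {z : ℂ} (hz : 0 ≤ z.re) (f : L2Space d) :
    fourierInvGaussianMul z hz f = 𝓕⁻ (gaussianMul z hz f) := rfl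

theorem norm_fourierInvGaussianMul_le {z : ℂ} (hz : 0 ≤ z.re) (f : L2Space d) :
    ‖fourierInvGaussianMul z hz f‖ ≤ ‖f‖ := by
  rw [fourierInvGaussianMul_apply, Lp.norm_fourierInv_eq]
  exact norm_gaussianMul_le hz f

/-- The trivial bound of an inverse transform by the `L¹` norm, which the multiplier does not
increase. -/
theorem ae_norm_fourierInvGaussianMul_le {z : ℂ} (hz : 0 ≤ z.re) {f : L2Space d}
    (hf : Integrable f) : ∀ᵐ x, ‖fourierInvGaussianMul z hz f x‖ ≤ 1 * ∫ y, ‖f y‖ := by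
  have hle : ∀ᵐ y, ‖gaussianMul z hz f y‖ ≤ ‖f y‖ := by
    filter_upwards [coeFn_gaussianMul hz f] with y hy
    rw [hy, norm_mul]
    exact mul_le_of_le_one_left (norm_nonneg _) (norm_complexGaussian_le_one hz y)
  have hi : Integrable (gaussianMul z hz f) :=
    hf.norm.mono' (Lp.aestronglyMeasurable _) hle
  have h := fourierInv_toLp_ae_eq hi (Lp.memLp (gaussianMul z hz f))
  rw [Lp.toLp_coeFn] at h
  filter_upwards [h] with x hx
  rw [fourierInvGaussianMul_apply, hx, Real.fourierInv_eq_fourier_neg, one_mul]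
  exact (norm_fourier_le _ _).trans (integral_mono_ae hi.norm hf.norm hle)

theorem setIntegral_ball_comp_inv_smul (G : EuclideanSpace ℝ (Fin d) → ℝ) (τ : ℝ) {t : ℝ}
    (ht : 0 < t) :
    t⁻¹ ^ d * ∫ ξ in ball 0 τ, G (t⁻¹ • ξ) = ∫ ξ in ball 0 (τ / t), G ξ := by
  have h := Measure.integral_comp_smul volume
    ((ball (0 : EuclideanSpace ℝ (Fin d)) (τ / t)).indicator G) t⁻¹
  rw [finrank_euclideanSpace_fin, integral_indicator measurableSet_ball,
    abs_of_pos (by positivity), smul_eq_mul, eq_inv_mul_iff_mul_eq₀ (by positivity)] at h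
  rw [← h, ← integral_indicator measurableSet_ball]
  congr 2
  funext ξ
  have e : ξ ∈ ball (0 : EuclideanSpace ℝ (Fin d)) τ ↔
      t⁻¹ • ξ ∈ ball (0 : EuclideanSpace ℝ (Fin d)) (τ / t) := by
    rw [mem_ball_zero_iff, mem_ball_zero_iff, norm_smul, Real.norm_of_nonneg (by positivity),
      inv_mul_eq_div, div_lt_div_iff_of_pos_right ht]
  by_cases hξ : ξ ∈ ball (0 : EuclideanSpace ℝ (Fin d)) τ
  · rw [indicator_of_mem hξ, indicator_of_mem (e.1 hξ)]
  · rw [indicator_of_notMem hξ, indicator_of_notMem (fun h => hξ (e.2 h))]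

theorem one_add_pow_le_one_add_pow {x : ℝ} (hx : 0 ≤ x) (hd : d ≠ 0) :
    1 + x ^ d ≤ (1 + x) ^ d := by
  have := pow_add_pow_le (x := 1) zero_le_one hx hd
  simpa using this

theorem sqrt_one_add_pow_le {x : ℝ} (hx : 0 ≤ x) (hd : d ≠ 0) :
    √(1 + x ^ d) ≤ (1 + x) ^ ((d : ℝ) / 2) := by
  have h1 : (1 + x) ^ ((d : ℝ) / 2) = √((1 + x) ^ d) := by
    rw [Real.sqrt_eq_rpow, ← Real.rpow_natCast, ← Real.rpow_mul (by positivity)]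
    congr 1
    ring
  rw [h1]
  exact Real.sqrt_le_sqrt (one_add_pow_le_one_add_pow hx hd)

end RearrangementEstimates

/-! ### Assembly of the estimates for the Schrödinger solution. -/

theorem mainTheorem8 (d : ℕ) (hd : 1 ≤ d) (β : ℝ) (hβ : ((d : ℝ) - 1) / 2 ≤ β) :
    ∃ C : ℝ, 0 < C ∧
      ∀ (v₀ : L2Space d) (v : ℝ → L2Space d), IsFreeSchrodingerSolution v₀ v →
      ∀ A : Set (EuclideanSpace ℝ (Fin d)), NullMeasurableSet A volume → volume A ≠ ∞ →
      ∀ τ : ℝ, 0 ≤ τ → volume (ball (0 : EuclideanSpace ℝ (Fin d)) τ) = volume A →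
      ∀ t : ℝ, 0 < t →
        -- the estimates in terms of the Fourier transform of the initial datum
        ((∫ x in A, ‖v t x‖ ^ 2) ≤
            C * ∫ ξ in ball (0 : EuclideanSpace ℝ (Fin d)) τ,
              ‖(𝓕 (rearrL2 (𝓕 v₀)) : L2Space d) ξ‖ ^ 2) ∧
        (∀ S : ℝ, 0 ≤ S →
          volume {ξ | (𝓕 v₀ : L2Space d) ξ ≠ 0} ≤ ENNReal.ofReal S →
            (bochnerRieszIntegral β (rearrL2 (𝓕 v₀))).im = 0 ∧
            (∫ x in A, ‖v t x‖) ≤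
              C * volume.real A ^ (1 / 2 : ℝ) *
                (1 + volume.real A ^ (1 / (d : ℝ))) ^ ((d : ℝ) / 2) * (1 + S) *
                (bochnerRieszIntegral β (rearrL2 (𝓕 v₀))).re) ∧
        -- the estimates in terms of the initial datum itself
        ((∫ x in A, ‖v t x‖ ^ 2) ≤
            C * t⁻¹ ^ d * ∫ ξ in ball (0 : EuclideanSpace ℝ (Fin d)) τ,
              ‖(𝓕 (rearrL2 v₀) : L2Space d) (t⁻¹ • ξ)‖ ^ 2) ∧
        (C * t⁻¹ ^ d * ∫ ξ in ball (0 : EuclideanSpace ℝ (Fin d)) τ,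
              ‖(𝓕 (rearrL2 v₀) : L2Space d) (t⁻¹ • ξ)‖ ^ 2 =
            C * ∫ ξ in ball (0 : EuclideanSpace ℝ (Fin d)) (τ / t),
              ‖(𝓕 (rearrL2 v₀) : L2Space d) ξ‖ ^ 2) ∧
        (∀ S : ℝ, 0 ≤ S →
          volume {x | v₀ x ≠ 0} ≤ ENNReal.ofReal S →
            (bochnerRieszIntegral β (rearrL2 v₀)).im = 0 ∧
            (∫ x in A, ‖v t x‖) ≤
              C * volume.real A ^ (1 / 2 : ℝ) *
                (1 + volume.real A ^ (1 / (d : ℝ)) / t) ^ ((d : ℝ) / 2) *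
                (1 + S) ^ ((d : ℝ) / 2) *
                (bochnerRieszIntegral β (rearrL2 v₀)).re) := by
  have hd0 : d ≠ 0 := by omega
  have hd1 : (1 : ℝ) ≤ d := by exact_mod_cast hd
  obtain ⟨C₁, hC₁, hL2⟩ := exists_setIntegral_sq_le hd0
  obtain ⟨C₂, hC₂, hL1⟩ := exists_setIntegral_norm_le hd0 hβ
  refine ⟨C₁ + C₂, by positivity, fun v₀ v hv A _ hA τ hτ hAτ t ht => ?_⟩
  have hAreal : volume.real A = τ ^ d * volume.real (ball (0 : EuclideanSpace ℝ (Fin d)) 1) := by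
    rw [← volume_real_ball_eq hd0 hτ, measureReal_def, measureReal_def, hAτ]
  have hA0 : 0 ≤ volume.real A := measureReal_nonneg
  have hz := (re_I_mul t).ge
  set z : ℂ := Complex.I * t with hzdef
  have hzn : ‖z‖ = t := by simp [hzdef, abs_of_pos ht]
  have hz0 : z ≠ 0 := norm_ne_zero_iff.1 (hzn ▸ ht.ne')
  -- The same function read in two ways: as an operator with `K = 1` acting on `𝓕 v₀`, and as one
  -- with `K = t^{-d/2}` acting on `v₀`.
  have hv1 : v t = fourierInvGaussianMul z hz (𝓕 v₀) := hv.eq_gaussianPropagator ht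
  have hv2 : v t = gaussianPropagator z hz v₀ := hv.eq_gaussianPropagator ht
  set K := (1 / t) ^ ((d : ℝ) / 2) with hKdef
  have hK0 : 0 < K := by positivity
  have hK2 : K ^ 2 = (1 / t) ^ d := by
    rw [hKdef, ← Real.rpow_natCast, ← Real.rpow_mul (by positivity), ← Real.rpow_natCast]
    congr 1
    push_cast
    ring
  have hT₁ : ∀ h : L2Space d, Integrable h →
      ∀ᵐ x, ‖gaussianPropagator z hz h x‖ ≤ K * ∫ y, ‖h y‖ := fun h hh => by
    have := ae_norm_gaussianPropagator_le hz hz0 hh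
    rwa [hzn] at this
  have hroot : (volume.real A ^ (1 / (d : ℝ))) ^ d = volume.real A := by
    rw [one_div]
    exact Real.rpow_inv_natCast_pow hA0 hd0
  have hroot0 : 0 ≤ volume.real A ^ (1 / (d : ℝ)) := by positivity
  have hball := setIntegral_ball_comp_inv_smul
    (fun ξ => ‖(𝓕 (rearrL2 v₀) : L2Space d) ξ‖ ^ 2) τ ht
  have heq : (C₁ + C₂) * t⁻¹ ^ d * ∫ ξ in ball (0 : EuclideanSpace ℝ (Fin d)) τ,
        ‖(𝓕 (rearrL2 v₀) : L2Space d) (t⁻¹ • ξ)‖ ^ 2 =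
      (C₁ + C₂) * ∫ ξ in ball (0 : EuclideanSpace ℝ (Fin d)) (τ / t),
        ‖(𝓕 (rearrL2 v₀) : L2Space d) ξ‖ ^ 2 := by rw [mul_assoc, hball]
  refine ⟨?_, fun S hS hf => ?_, ?_, heq, fun S hS hf => ?_⟩
  · have h := hL2 _ 1 one_pos (norm_fourierInvGaussianMul_le hz)
      (fun h => ae_norm_fourierInvGaussianMul_le hz) (𝓕 v₀) A hA τ hτ (by rw [hAreal]; ring)
    rw [← hv1] at h
    refine h.trans ?_
    gcongr
    linarith
  · obtain ⟨him, hre, h⟩ := hL1 (𝓕 v₀) S hS hf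
    refine ⟨him, ?_⟩
    have h := h _ 1 zero_le_one (norm_fourierInvGaussianMul_le hz)
      (fun h => ae_norm_fourierInvGaussianMul_le hz) A hA
    rw [← hv1, one_pow, one_mul] at h
    refine h.trans ?_
    have e1 : √(1 + volume.real A) ≤
        (1 + volume.real A ^ (1 / (d : ℝ))) ^ ((d : ℝ) / 2) := by
      have := sqrt_one_add_pow_le hroot0 hd0
      rwa [hroot] at this
    -- The general estimate already gives the factor `√(1 + S)`; the stated power of `1 + S` is
    -- weaker.
    have e2 : √(1 + S) ≤ 1 + S := Real.sqrt_le_self_iff.2 (Or.inr (by linarith))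
    rw [Real.sqrt_eq_rpow (volume.real A)]
    gcongr
    linarith
  · rw [heq]
    -- Since `K² = t^{-d}` and `|A| = τ^d ω`, the matching frequency radius is `τ / t`.
    have h := hL2 _ K hK0 (norm_gaussianPropagator_le hz) hT₁ v₀ A hA (τ / t) (by positivity)
      (by rw [hK2, hAreal, div_pow, div_pow, one_pow]; ring)
    rw [← hv2] at h
    refine h.trans ?_
    gcongr
    linarith
  · obtain ⟨him, hre, h⟩ := hL1 v₀ S hS hf
    refine ⟨him, ?_⟩
    have h := h _ K hK0.le (norm_gaussianPropagator_le hz) hT₁ A hA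
    rw [← hv2] at h
    refine h.trans ?_
    have e1 : √(1 + K ^ 2 * volume.real A) ≤
        (1 + volume.real A ^ (1 / (d : ℝ)) / t) ^ ((d : ℝ) / 2) := by
      have := sqrt_one_add_pow_le (div_nonneg hroot0 ht.le) hd0
      rwa [div_pow, hroot, div_eq_inv_mul, ← one_div, ← one_div_pow, ← hK2] at this
    -- The exponent `d/2` is at least `1/2` and the base is at least 1.
    have e2 : √(1 + S) ≤ (1 + S) ^ ((d : ℝ) / 2) := by
      rw [Real.sqrt_eq_rpow]
      exact Real.rpow_le_rpow_of_exponent_le (by linarith) (by linarith)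
    rw [Real.sqrt_eq_rpow (volume.real A)]
    gcongr
    linarith
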